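/- Let $k$ be an arbitrary field and let $C$ be a regular curve over $k$ (an integral separated scheme of finite type over $k$, of dimension one, with regular local rings) such that $k$ is algebraically closed in the function field $k(C)$. Let $M$ be a lattice of finite rank (the character lattice of a split torus $\mathbb{T}$), $N=\mathrm{Hom}(M,\mathbb{Z})$, $M_{\mathbb Q}=\mathbb{Q}\otimes M$, $N_{\mathbb Q}=\mathbb{Q}\otimes N$. Let $\mathfrak{D}=\sum_{y}\mathfrak{D}_y\cdot[y]$ be a $\sigma$-polyhedral divisor on $C$, where $y$ runs over the closed points of $C$: $\sigma\subseteq N_{\mathbb Q}$ is a polyhedral cone whose dual $\sigma^\vee\subseteq M_{\mathbb Q}$ is full-dimensional, each $\mathfrak{D}_y\subseteq N_{\mathbb Q}$ is the Minkowski sum of a non-empty polytope and $\sigma$, and $\mathfrak{D}_y=\sigma$ for almost all $y$. For $m\in\sigma^\vee$ put $\mathfrak{D}(m)=\sum_y\min_{v\in\mathfrak{D}_y}\langle m,v\rangle\cdot[y]$. Assume that $\mathfrak{D}$ is proper: either $C$ is affine, or $C$ is projective, $\deg\mathfrak{D}:=\sum_y[\kappa_y:k]\cdot\mathfrak{D}_y\subsetneq\sigma$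 (where $\kappa_y$ is the residue field of $y$), and for every $m\in\sigma^\vee$ with $\deg\mathfrak{D}(m)=0$ some positive integral multiple of $\mathfrak{D}(m)$ is principal. Let $$A=A[C,\mathfrak{D}]=\bigoplus_{m\in\sigma^\vee\cap M}H^0(C,\mathcal{O}_C(\lfloor\mathfrak{D}(m)\rfloor))\,\chi^m\subseteq k(C)[M],\qquad X=\mathrm{Spec}\,A .$$ A locally finite iterative higher derivation (LFIHD) on $A$ is a family $\partial=\{\partial^{(i)}\}_{i\ge 0}$ of $k$-linear operators on $A$ with $\partial^{(0)}=\mathrm{id}$, $\partial^{(i)}(ab)=\sum_{i_1+i_2=i}\partial^{(i_1)}(a)\,\partial^{(i_2)}(b)$, $\partial^{(u)}\circ\partial^{(v)}=\binom{u+v}{u}\partial^{(u+v)}$, and, for each $a\in A$, $\partial^{(j)}(a)=0$ for $j\gg 0$. It is homogeneous of degree $e\in M$ if each $\partial^{(j)}$ maps homogeneous elements of degree $m$ to homogeneous elements of degree $m+je$. A homogeneous LFIHD is horizontal if, for its unique extension to a family of operators on the function field $k(X)$ satisfying the first three identities, $\partial^{(j)}(k(X)^{\mathbb T})\ne 0$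 for some $j>0$. Its kernel is $\ker(\partial)=\bigcap_{i\ge 1}\ker(\partial^{(i)})$. Suppose that $\partial$ is a homogeneous horizontal LFIHD on $A$. Then the following assertions hold. (i) The kernel of $\partial$ is a semigroup algebra: there are a full-dimensional polyhedral cone $\omega\subseteq M_{\mathbb Q}$, a sublattice $L\subseteq M$ with $M/L$ finite, and elements $\varphi_m\in k(C)^\star$ with $\varphi_{m+m'}=\varphi_m\varphi_{m'}$ for $m,m'\in\omega\cap L$, such that $$\ker(\partial)=\bigoplus_{m\in\omega\cap L}k\,\varphi_m\chi^m .$$ (ii) If $C$ is projective, then $C\simeq\mathbb{P}^1_k$ over $k$. (iii) The variety $X$ is geometrically integral over $k$. (iv) If $C$ is affine, then $C\simeq\mathbb{A}^1_k$ over $k$, and $\mathrm{div}(\varphi_m)+\mathfrak{D}(m)=0$ for every $m\in\omega\cap L$. -/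

import Mathlib

open CategoryTheory AlgebraicGeometry TensorProduct
open scoped Pointwise

universe u

noncomputable section

/-! ### Regular curves over a field -/

/-- A regular curve over the field `k`: an integral separated scheme of finite type over `k`, of
dimension one, all of whose local rings are regular. -/
structure RegularCurve (k : Type u) [Field k] where
  /-- The underlying scheme. -/
  X : Scheme.{u}
  /-- The structure morphism. -/
  s : X ⟶ Spec (.of k)
  isIntegral : IsIntegral X
  isSeparated : IsSeparated s
  locallyOfFiniteType : LocallyOfFiniteType s
  quasiCompact : QuasiCompact s
  dim_eq_one : topologicalKrullDim X = 1
  regular : ∀ x : X, IsRegularLocalRing (X.presheaf.stalk x)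

namespace RegularCurve

variable {k : Type u} [Field k] (C : RegularCurve k)

instance : Nonempty (⊤ : C.X.Opens) :=
  haveI := C.isIntegral
  ⟨⟨genericPoint C.X, trivial⟩⟩

instance : IsIntegral C.X := C.isIntegral

instance : IsLocallyNoetherian C.X :=
  haveI := C.locallyOfFiniteType
  LocallyOfFiniteType.isLocallyNoetherian C.s

/-- The function field `k(C)`. -/
abbrev K : Type u := C.X.functionField

/-- The homomorphism from `k` to the ring of global functions of `C`. -/
def globalConst : k →+* Γ(C.X, ⊤) :=
  (C.s.appTop.hom).comp (Scheme.ΓSpecIso (.of k)).inv.hom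

/-- The embedding of the constants `k` in `k(C)`, induced by the structure morphism. -/
def const : k →+* C.K :=
  (C.X.germToFunctionField ⊤).hom.comp C.globalConst

instance : Algebra k C.K := C.const.toAlgebra

/-- The closed points of `C`. -/
abbrev ClosedPoint : Type u := {y : C.X // IsClosed ({y} : Set C.X)}

/-- The order of vanishing of a rational function at a closed point (with value `0` at `f = 0`). -/
def ord (f : C.K) (y : C.ClosedPoint) : ℤ := Scheme.ord f y.1

/-- The degree `[κ_y : k]` of the residue field of a closed point over the base field. -/
def degree (y : C.ClosedPoint) : ℕ := C.s.residueDegree y.1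

lemma ord_mul {f g : C.K} (hf : f ≠ 0) (hg : g ≠ 0) (y : C.ClosedPoint) :
    C.ord (f * g) y = C.ord f y + C.ord g y := Scheme.ord_mul hf hg

lemma ord_add {f g : C.K} (hfg : f + g ≠ 0) (y : C.ClosedPoint) :
    min (C.ord f y) (C.ord g y) ≤ C.ord (f + g) y := by
  by_cases hy : Order.coheight y.1 = 1
  · have hreg := C.regular y.1
    have hdim : ringKrullDim (C.X.presheaf.stalk y.1) = 1 := by
      rw [ringKrullDim_stalk_eq_coheight, hy]; rfl
    have hnf : ¬ IsField (C.X.presheaf.stalk y.1) := fun h => by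
      rw [ringKrullDim_eq_zero_of_isField h] at hdim
      exact zero_ne_one hdim
    have : IsDiscreteValuationRing (C.X.presheaf.stalk y.1) := by
      refine ((IsDiscreteValuationRing.TFAE _ hnf).out 0 5).2 ?_
      have h := (IsRegularLocalRing.iff_finrank_cotangentSpace _).1 hreg
      rw [hdim] at h
      exact_mod_cast h
    exact Scheme.ord_add hfg
  · simp [ord, Scheme.ord_eq_zero_of_coheight_neq_one hy]

lemma ord_smul (a : k) {f : C.K} (ha : a ≠ 0) (y : C.ClosedPoint) :
    C.ord f y ≤ C.ord (a • f) y := by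
  have h0 : C.globalConst a ≠ 0 := by simpa using ha
  have h1 : a • f = C.globalConst a • f := by
    rw [Algebra.smul_def, Algebra.smul_def]; rfl
  rw [h1]
  exact Scheme.ord_le_smul (U := ⊤) (x := y.1) trivial h0 f

lemma ord_one (y : C.ClosedPoint) : C.ord 1 y = 0 := by
  have h := C.ord_mul one_ne_zero one_ne_zero y
  rw [mul_one] at h
  omega

/-- `H⁰(C, 𝒪_C(E))` for an integral divisor `E`: the rational functions `f` with `f = 0` or
`div f + E ≥ 0`. -/
def H0 (E : C.ClosedPoint → ℤ) : Submodule k C.K where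
  carrier := {f | f ≠ 0 → ∀ y, 0 ≤ C.ord f y + E y}
  zero_mem' h := absurd rfl h
  add_mem' {f g} hf hg hfg y := by
    by_cases hf0 : f = 0
    · subst hf0
      rw [zero_add] at hfg ⊢
      exact hg hfg y
    by_cases hg0 : g = 0
    · subst hg0
      rw [add_zero] at hfg ⊢
      exact hf hfg y
    have h1 := hf hf0 y
    have h2 := hg hg0 y
    have h3 := C.ord_add hfg y
    omega
  smul_mem' a f hf haf y := by
    have ha : a ≠ 0 := by rintro rfl; simp at haf
    have hf0 : f ≠ 0 := by rintro rfl; simp at haf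
    have h1 := hf hf0 y
    have h2 := C.ord_smul a (f := f) ha y
    omega

/-- The base field is algebraically closed in the function field of the curve. -/
def AlgClosedInK : Prop := ∀ f : C.K, IsAlgebraic k f → f ∈ (algebraMap k C.K).range

/-- `C` is an affine curve. -/
def IsAffineCurve : Prop := IsAffine C.X

/-- `C` is a complete curve; for curves over a field, complete and projective mean the same. -/
def IsProjectiveCurve : Prop := AlgebraicGeometry.IsProper C.s

end RegularCurve

/-- The affine line `𝔸¹ₖ = Spec k[t]` as a scheme over `k`. -/
def affineLine (k : Type u) [Field k] : Over (Spec (.of k)) :=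
  Over.mk (Spec.map (CommRingCat.ofHom (algebraMap k (Polynomial k))))

/-- The grading of `k[x₀, x₁]` by the degree. -/
instance homogeneousGrading (k : Type u) [Field k] :
    GradedRing (MvPolynomial.homogeneousSubmodule (Fin 2) k) :=
  MvPolynomial.gradedAlgebra

/-- The projective line `ℙ¹ₖ = Proj k[x₀, x₁]` as a scheme over `k`. -/
def projectiveLine (k : Type u) [Field k] : Over (Spec (.of k)) :=
  Over.mk (Proj.toSpecZero (MvPolynomial.homogeneousSubmodule (Fin 2) k) ≫
    Spec.map (CommRingCat.ofHom
      (algebraMap k (MvPolynomial.homogeneousSubmodule (Fin 2) k 0))))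

/-- `C` is isomorphic, over `k`, to the affine line. -/
def RegularCurve.IsAffineLine {k : Type u} [Field k] (C : RegularCurve k) : Prop :=
  Nonempty (Over.mk C.s ≅ affineLine k)

/-- `C` is isomorphic, over `k`, to the projective line. -/
def RegularCurve.IsProjectiveLine {k : Type u} [Field k] (C : RegularCurve k) : Prop :=
  Nonempty (Over.mk C.s ≅ projectiveLine k)

/-! ### Polyhedral divisors -/

/-- The rational vector space `M_ℚ = ℚ ⊗ M` of a lattice `M`. -/
abbrev LatticeQ (M : Type) [AddCommGroup M] : Type := ℚ ⊗[ℤ] M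

/-- The rational vector space `N_ℚ = ℚ ⊗ N` of the dual lattice `N = Hom(M, ℤ)`, realised as the
space of linear forms on `M_ℚ`; the duality bracket `⟨m, v⟩` is `v m`. -/
abbrev DualLatticeQ (M : Type) [AddCommGroup M] : Type := Module.Dual ℚ (LatticeQ M)

/-- The image of a lattice vector in `M_ℚ`. -/
abbrev latticeToQ {M : Type} [AddCommGroup M] (m : M) : LatticeQ M := (1 : ℚ) ⊗ₜ[ℤ] m

/-- The dual cone `σ^∨ ⊆ M_ℚ` of a cone `σ ⊆ N_ℚ`. -/
def dualCone {M : Type} [AddCommGroup M] (σ : PointedCone ℚ (DualLatticeQ M)) :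
    PointedCone ℚ (LatticeQ M) :=
  PointedCone.dual (LinearMap.id : DualLatticeQ M →ₗ[ℚ] LatticeQ M →ₗ[ℚ] ℚ) (σ : Set _)

/-- A polyhedral divisor over the curve `C`, for the lattice `M`: a polyhedral cone `σ ⊆ N_ℚ` whose
dual is full-dimensional, and for every closed point `y` of `C` the Minkowski sum `𝔇_y` of a
(non-empty) polytope with `σ`, such that `𝔇_y = σ` for almost all `y`. -/
structure PolyhedralDivisor {k : Type u} [Field k] (C : RegularCurve k)
    (M : Type) [AddCommGroup M] where
  /-- The tail cone. -/
  σ : PointedCone ℚ (DualLatticeQ M)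
  σ_fg : σ.FG
  dual_full : Submodule.span ℚ (dualCone σ : Set (LatticeQ M)) = ⊤
  /-- The polyhedral coefficients. -/
  coeff : C.ClosedPoint → Set (DualLatticeQ M)
  coeff_eq : ∀ y, ∃ P : Finset (DualLatticeQ M), P.Nonempty ∧
    coeff y = convexHull ℚ (P : Set (DualLatticeQ M)) + (σ : Set (DualLatticeQ M))
  finite_coeff_ne : {y | coeff y ≠ (σ : Set (DualLatticeQ M))}.Finite

namespace PolyhedralDivisor

variable {k : Type u} [Field k] {C : RegularCurve k} {M : Type} [AddCommGroup M]
  (D : PolyhedralDivisor C M)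

open Classical in
/-- The evaluation `𝔇(m) = ∑_y min_{v ∈ 𝔇_y} ⟨m, v⟩ · [y]`, as a function of the closed point `y`.
For `m ∈ σ^∨` the minimum exists; otherwise the value is `0` and is never used. -/
def eval (m : LatticeQ M) (y : C.ClosedPoint) : ℚ :=
  if h : ∃ q : ℚ, IsLeast ((fun v : DualLatticeQ M => v m) '' D.coeff y) q then h.choose else 0

/-- The degree `deg 𝔇 = ∑_y [κ_y : k] · 𝔇_y`, a Minkowski sum in which all but finitely many of the
summands are equal to `σ`. -/
def deg : Set (DualLatticeQ M) :=
  (D.σ : Set (DualLatticeQ M)) + ∑ y ∈ D.finite_coeff_ne.toFinset, (C.degree y : ℚ) • D.coeff y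

/-- The degree of the `ℚ`-divisor `𝔇(m)`. -/
def degEval (m : LatticeQ M) : ℚ := ∑ᶠ y, (C.degree y : ℚ) * D.eval m y

/-- The positivity condition on a polyhedral divisor: no condition if `C` is affine; if `C` is
projective, then `deg 𝔇` is a proper subset of `σ`, and for every `m ∈ σ^∨` such that `𝔇(m)` has
degree zero a positive multiple of `𝔇(m)` is principal. (Such an `m` is automatically on the
boundary of `σ^∨`, and on `ℙ¹` the last condition always holds.) -/
def IsProper : Prop :=
  C.IsAffineCurve ∨
    (C.IsProjectiveCurve ∧ D.deg ⊂ (D.σ : Set (DualLatticeQ M)) ∧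
      ∀ m ∈ dualCone D.σ, D.degEval m = 0 →
        ∃ r : ℕ, 0 < r ∧ ∃ f : C.K, f ≠ 0 ∧ ∀ y, (C.ord f y : ℚ) = r * D.eval m y)

lemma isLeast_eval {m : LatticeQ M} (hm : m ∈ dualCone D.σ) (y : C.ClosedPoint) :
    IsLeast ((fun v : DualLatticeQ M => v m) '' D.coeff y) (D.eval m y) := by
  have h : ∃ q : ℚ, IsLeast ((fun v : DualLatticeQ M => v m) '' D.coeff y) q := by
    obtain ⟨P, hP, hPc⟩ := D.coeff_eq y
    obtain ⟨v₀, hv₀, hmin⟩ := P.exists_min_image (fun v : DualLatticeQ M => v m) hP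
    refine ⟨v₀ m, ⟨v₀, ?_, rfl⟩, ?_⟩
    · rw [hPc]
      exact ⟨v₀, subset_convexHull ℚ _ hv₀, 0, D.σ.zero_mem, add_zero _⟩
    · rintro _ ⟨v, hv, rfl⟩
      rw [hPc] at hv
      obtain ⟨a, ha, b, hb, rfl⟩ := hv
      have h1 : v₀ m ≤ a m := by
        have hsub : convexHull ℚ (P : Set (DualLatticeQ M)) ⊆ {w | v₀ m ≤ w m} := by
          refine convexHull_min (fun w hw => hmin w hw) ?_
          exact convex_halfSpace_ge (f := fun w : DualLatticeQ M => w m)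
            ⟨fun _ _ => rfl, fun _ _ => rfl⟩ _
        exact hsub ha
      have h2 : 0 ≤ b m := hm hb
      change v₀ m ≤ a m + b m
      linarith
  rw [eval, dif_pos h]
  exact h.choose_spec

lemma eval_add_le {m m' : LatticeQ M} (hm : m ∈ dualCone D.σ) (hm' : m' ∈ dualCone D.σ)
    (y : C.ClosedPoint) : D.eval m y + D.eval m' y ≤ D.eval (m + m') y := by
  obtain ⟨v, hv, hvm⟩ := (D.isLeast_eval (add_mem hm hm') y).1
  have h1 := (D.isLeast_eval hm y).2 ⟨v, hv, rfl⟩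
  have h2 := (D.isLeast_eval hm' y).2 ⟨v, hv, rfl⟩
  rw [← hvm]
  change _ ≤ v (m + m')
  rw [map_add]
  exact add_le_add h1 h2

lemma eval_zero (y : C.ClosedPoint) : D.eval 0 y = 0 := by
  obtain ⟨v, -, hv⟩ := (D.isLeast_eval (m := 0) (zero_mem _) y).1
  rw [← hv]
  exact map_zero v

open Classical in
/-- The piece of degree `m`: the space `H⁰(C, 𝒪_C(⌊𝔇(m)⌋))` if `m ∈ σ^∨`, and zero otherwise. -/
def piece (m : M) : Submodule k C.K :=
  if latticeToQ m ∈ dualCone D.σ then C.H0 (fun y => ⌊D.eval (latticeToQ m) y⌋) else ⊥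

lemma mul_mem_piece {m m' : M} {f g : C.K} (hf : f ∈ D.piece m) (hg : g ∈ D.piece m') :
    f * g ∈ D.piece (m + m') := by
  by_cases hm : latticeToQ m ∈ dualCone D.σ
  swap
  · rw [piece, if_neg hm, Submodule.mem_bot] at hf
    subst hf
    rw [zero_mul]
    exact zero_mem _
  by_cases hm' : latticeToQ m' ∈ dualCone D.σ
  swap
  · rw [piece, if_neg hm', Submodule.mem_bot] at hg
    subst hg
    rw [mul_zero]
    exact zero_mem _
  have hadd : latticeToQ (m + m') = latticeToQ m + latticeToQ m' := TensorProduct.tmul_add _ _ _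
  have hmm' : latticeToQ (m + m') ∈ dualCone D.σ := hadd ▸ add_mem hm hm'
  rw [piece, if_pos hm] at hf
  rw [piece, if_pos hm'] at hg
  rw [piece, if_pos hmm']
  intro hfg y
  have hf0 := left_ne_zero_of_mul hfg
  have hg0 := right_ne_zero_of_mul hfg
  have h1 := hf hf0 y
  have h2 := hg hg0 y
  have h3 := C.ord_mul hf0 hg0 y
  have h4 := Int.le_floor_add (D.eval (latticeToQ m) y) (D.eval (latticeToQ m') y)
  have h5 := Int.floor_le_floor (D.eval_add_le hm hm' y)
  rw [← hadd] at h5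
  simp only at h1 h2 ⊢
  omega

lemma one_mem_piece : (1 : C.K) ∈ D.piece 0 := by
  have h0 : latticeToQ (0 : M) = 0 := TensorProduct.tmul_zero _ _
  rw [piece, if_pos (h0 ▸ zero_mem _)]
  intro _ y
  simp only [h0, C.ord_one, D.eval_zero]
  simp

/-- The `M`-graded algebra `A[C, 𝔇] = ⨁_{m ∈ σ^∨ ∩ M} H⁰(C, 𝒪_C(⌊𝔇(m)⌋)) χ^m`, as a subalgebra of
`k(C)[M] = ⨁_{m ∈ M} k(C) χ^m`. -/
def algebra : Subalgebra k (AddMonoidAlgebra C.K M) where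
  carrier := {a | ∀ m, a.coeff m ∈ D.piece m}
  zero_mem' m := zero_mem _
  add_mem' ha hb m := add_mem (ha m) (hb m)
  mul_mem' {a b} ha hb m := by
    classical
    rw [AddMonoidAlgebra.coeff_mul]
    refine Submodule.sum_mem _ fun m₁ _ => Submodule.sum_mem _ fun m₂ _ => ?_
    dsimp only
    split_ifs with h
    · exact h ▸ D.mul_mem_piece (ha m₁) (hb m₂)
    · exact zero_mem _
  algebraMap_mem' c m := by
    classical
    rw [AddMonoidAlgebra.coe_algebraMap, Function.comp_apply, AddMonoidAlgebra.coeff_single,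
      Finsupp.single_apply]
    split_ifs with h
    · subst h
      rw [Algebra.algebraMap_eq_smul_one]
      exact Submodule.smul_mem _ c D.one_mem_piece
    · exact zero_mem _

/-- The affine variety `X = Spec A[C, 𝔇]`, as a scheme over `k`. -/
def toSpec : Spec (.of D.algebra) ⟶ Spec (.of k) :=
  Spec.map (CommRingCat.ofHom (algebraMap k D.algebra))

/-- The coaction `χ^m ↦ χ^m ⊗ χ^m` of the torus `𝕋 = Spec k[M]`, on `k(C)[M]`. For `a` in
`A[C, 𝔇]` it gives the pull-back of the function `a` along the action `𝕋 × X → X`, an element of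
`k[𝕋 × X] = A[C, 𝔇][M] ⊆ k(C)[M][M]`. -/
def coaction : AddMonoidAlgebra C.K M →ₐ[C.K] AddMonoidAlgebra (AddMonoidAlgebra C.K M) M :=
  AddMonoidAlgebra.lift C.K (AddMonoidAlgebra (AddMonoidAlgebra C.K M) M) M
    { toFun := fun m => .single m.toAdd (.single m.toAdd 1)
      map_one' := rfl
      map_mul' := fun m m' => by
        simp [AddMonoidAlgebra.single_mul_single] }

/-- The field `k(X)` of rational functions on `X`. -/
abbrev functionField : Type u := FractionRing D.algebra

/-- The rational function `f` on `X` is invariant under the torus: `f` is a fraction `a / b` whose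
pull-backs along the action and along the projection `𝕋 × X → X` coincide. This does not depend on
the choice of the fraction. -/
def IsInvariant (f : D.functionField) : Prop :=
  ∃ a b : D.algebra, b ≠ 0 ∧ f * algebraMap D.algebra D.functionField b =
      algebraMap D.algebra D.functionField a ∧
    coaction (a : AddMonoidAlgebra C.K M) * .single 0 (b : AddMonoidAlgebra C.K M) =
      coaction (b : AddMonoidAlgebra C.K M) * .single 0 (a : AddMonoidAlgebra C.K M)

/-- The element `a` of `A[C, 𝔇]` is homogeneous of degree `m`. -/
def IsHomogeneousElem (m : M) (a : D.algebra) : Prop :=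
  ∀ m' ≠ m, (a : AddMonoidAlgebra C.K M).coeff m' = 0

end PolyhedralDivisor

/-! ### Iterative higher derivations -/

/-- An iterative higher derivation on the `k`-algebra `B`. -/
structure IterativeHigherDerivation (k B : Type*) [CommRing k] [CommRing B] [Algebra k B] where
  /-- The operators `∂^(i)`. -/
  op : ℕ → B →ₗ[k] B
  op_zero : op 0 = LinearMap.id
  leibniz : ∀ (i : ℕ) (b₁ b₂ : B),
    op i (b₁ * b₂) = ∑ ij ∈ Finset.HasAntidiagonal.antidiagonal i, op ij.1 b₁ * op ij.2 b₂
  iterative : ∀ u v : ℕ, op u ∘ₗ op v = (u + v).choose u • op (u + v)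

/-- A locally finite iterative higher derivation (LFIHD) on the `k`-algebra `B`. -/
structure LFIHD (k B : Type*) [CommRing k] [CommRing B] [Algebra k B] extends
    IterativeHigherDerivation k B where
  locally_finite : ∀ b : B, ∃ n : ℕ, ∀ j ≥ n, op j b = 0

namespace LFIHD

/-- The kernel `⋂_{i ≥ 1} ker ∂^(i)`. -/
def kernel {k B : Type*} [CommRing k] [CommRing B] [Algebra k B] (d : LFIHD k B) :
    Submodule k B :=
  ⨅ i ≥ 1, LinearMap.ker (d.op i)

variable {k : Type u} [Field k] {C : RegularCurve k} {M : Type} [AddCommGroup M]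
  {D : PolyhedralDivisor C M}

/-- The LFIHD on `A[C, 𝔇]` is homogeneous of degree `e`: `∂^(j)` sends homogeneous elements of
degree `m` to homogeneous elements of degree `m + j e`. -/
def IsHomogeneousOfDegree (d : LFIHD k D.algebra) (e : M) : Prop :=
  ∀ (j : ℕ) (m : M) (a : D.algebra), D.IsHomogeneousElem m a →
    D.IsHomogeneousElem (m + j • e) (d.op j a)

/-- The LFIHD on `A[C, 𝔇]` is horizontal: its (unique) extension to an iterative higher derivation
of `k(X)` does not annihilate the field of torus-invariant rational functions. -/
def IsHorizontal (d : LFIHD k D.algebra) : Prop :=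
  ∃ d' : IterativeHigherDerivation k D.functionField,
    (∀ (j : ℕ) (a : D.algebra), d'.op j (algebraMap D.algebra D.functionField a) =
      algebraMap D.algebra D.functionField (d.op j a)) ∧
    ∃ j > 0, ∃ f : D.functionField, D.IsInvariant f ∧ d'.op j f ≠ 0

end LFIHD

end

/-! ### Homogeneous iterative exponentials on the graded pieces -/

open Polynomial in
/-- Graded pieces `A m` of a graded subalgebra of `K[M]`, with a homogeneous iterative exponential
`ψ m : A m → K[t]`, written after the substitution `χ^m ↦ 1`. The values of `ψ m` outside `A m`
play no role. -/
structure HomogeneousExp (k K M : Type*) [Field k] [Field K] [Algebra k K] [AddCommGroup M] where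
  A : M → Submodule k K
  e : M
  ψ : M → K → K[X]
  one_mem : (1 : K) ∈ A 0
  mul_mem : ∀ {m m' : M} {f g : K}, f ∈ A m → g ∈ A m' → f * g ∈ A (m + m')
  coeff_zero : ∀ {m : M} {f : K}, f ∈ A m → (ψ m f).coeff 0 = f
  map_mul : ∀ {m m' : M} {f g : K}, f ∈ A m → g ∈ A m' → ψ (m + m') (f * g) = ψ m f * ψ m' g
  map_add : ∀ {m : M} {f g : K}, f ∈ A m → g ∈ A m → ψ m (f + g) = ψ m f + ψ m g
  map_smul : ∀ {m : M} {f : K} (c : k), f ∈ A m → ψ m (c • f) = c • ψ m f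
  coeff_mem : ∀ {m : M} {f : K} (j : ℕ), f ∈ A m → (ψ m f).coeff j ∈ A (m + j • e)
  iterative : ∀ {m : M} {f : K} (i j : ℕ), f ∈ A m →
    (ψ (m + j • e) ((ψ m f).coeff j)).coeff i = ((i + j).choose j : K) * (ψ m f).coeff (i + j)

namespace HomogeneousExp

open Polynomial

section

variable {k K M : Type*} [Field k] [Field K] [Algebra k K] [AddCommGroup M]
  (E : HomogeneousExp k K M)

/-- The homogeneous element `f χ^m` belongs to the algebra and to the kernel. -/
def IsConst (m : M) (f : K) : Prop := f ∈ E.A m ∧ E.ψ m f = C f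

variable {E} {m m' : M} {f g : K}

lemma map_one : E.ψ 0 1 = 1 := by
  have h := E.map_mul E.one_mem E.one_mem
  have h0 : E.ψ 0 1 ≠ 0 := fun h => by simpa [h] using E.coeff_zero E.one_mem
  rw [add_zero, mul_one] at h
  exact (mul_right_cancel₀ h0 (by rw [one_mul, ← h])).symm

lemma ψ_zero : E.ψ m 0 = 0 := by
  simpa using E.map_smul (m := m) (0 : k) (zero_mem _)

lemma ψ_ne_zero (hf : f ∈ E.A m) (h0 : f ≠ 0) : E.ψ m f ≠ 0 := fun h => by
  have := E.coeff_zero hf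
  rw [h, Polynomial.coeff_zero] at this
  exact h0 this.symm

lemma IsConst.one : E.IsConst 0 1 := ⟨E.one_mem, by simp [map_one]⟩

lemma IsConst.zero : E.IsConst m 0 := ⟨zero_mem _, by simp [ψ_zero]⟩

lemma IsConst.mul (hf : E.IsConst m f) (hg : E.IsConst m' g) : E.IsConst (m + m') (f * g) :=
  ⟨E.mul_mem hf.1 hg.1, by rw [E.map_mul hf.1 hg.1, hf.2, hg.2, C_mul]⟩

lemma IsConst.add (hf : E.IsConst m f) (hg : E.IsConst m g) : E.IsConst m (f + g) :=
  ⟨add_mem hf.1 hg.1, by rw [E.map_add hf.1 hg.1, hf.2, hg.2, C_add]⟩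

lemma IsConst.smul (c : k) (hf : E.IsConst m f) : E.IsConst m (c • f) :=
  ⟨Submodule.smul_mem _ c hf.1, by rw [E.map_smul c hf.1, hf.2, Polynomial.smul_C]⟩

lemma pow_mem (hf : f ∈ E.A m) (n : ℕ) : f ^ n ∈ E.A (n • m) ∧ E.ψ (n • m) (f ^ n) = E.ψ m f ^ n := by
  induction n with
  | zero => simpa using ⟨E.one_mem, map_one⟩
  | succ n ih =>
    rw [pow_succ, pow_succ, succ_nsmul]
    exact ⟨E.mul_mem ih.1 hf, by rw [E.map_mul ih.1 hf, ih.2]⟩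

lemma IsConst.pow (hf : E.IsConst m f) (n : ℕ) : E.IsConst (n • m) (f ^ n) :=
  ⟨(pow_mem hf.1 n).1, by rw [(pow_mem hf.1 n).2, hf.2, C_pow]⟩

lemma IsConst.sum {ι : Type*} (s : Finset ι) {F : ι → K} (h : ∀ i ∈ s, E.IsConst m (F i)) :
    E.IsConst m (∑ i ∈ s, F i) := by
  classical
  induction s using Finset.induction_on with
  | empty => simpa using IsConst.zero
  | insert a s ha ih =>
    rw [Finset.sum_insert ha]
    exact (h a (Finset.mem_insert_self a s)).add
      (ih fun i hi => h i (Finset.mem_insert_of_mem hi))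

lemma ψ_sum {ι : Type*} (s : Finset ι) {F : ι → K} (h : ∀ i ∈ s, F i ∈ E.A m) :
    E.ψ m (∑ i ∈ s, F i) = ∑ i ∈ s, E.ψ m (F i) := by
  classical
  induction s using Finset.induction_on with
  | empty => simpa using ψ_zero
  | insert a s ha ih =>
    have h2 : ∀ i ∈ s, F i ∈ E.A m := fun i hi => h i (Finset.mem_insert_of_mem hi)
    rw [Finset.sum_insert ha, Finset.sum_insert ha,
      E.map_add (h a (Finset.mem_insert_self a s)) (sum_mem h2), ih h2]

lemma isConst_of_natDegree_eq_zero (hf : f ∈ E.A m) (h : (E.ψ m f).natDegree = 0) :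
    E.IsConst m f :=
  ⟨hf, by rw [eq_C_of_natDegree_eq_zero h, E.coeff_zero hf]⟩

lemma IsConst.natDegree_eq_zero (hf : E.IsConst m f) : (E.ψ m f).natDegree = 0 := by
  rw [hf.2, natDegree_C]

/-- The kernel is factorially closed. -/
lemma IsConst.of_mul (hf : f ∈ E.A m) (hg : g ∈ E.A m') (hfg : E.IsConst (m + m') (f * g))
    (h0 : f * g ≠ 0) : E.IsConst m f := by
  refine isConst_of_natDegree_eq_zero hf ?_
  have h := hfg.natDegree_eq_zero
  rw [E.map_mul hf hg, natDegree_mul (ψ_ne_zero hf (left_ne_zero_of_mul h0))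
    (ψ_ne_zero hg (right_ne_zero_of_mul h0))] at h
  omega

lemma coeff_ψ_coeff_eq_zero (hf : f ∈ E.A m) {i j : ℕ} (h : (E.ψ m f).natDegree < i + j) :
    (E.ψ (m + j • E.e) ((E.ψ m f).coeff j)).coeff i = 0 := by
  rw [E.iterative i j hf, coeff_eq_zero_of_natDegree_lt h, mul_zero]

lemma natDegree_ψ_coeff_le (hf : f ∈ E.A m) (j : ℕ) :
    (E.ψ (m + j • E.e) ((E.ψ m f).coeff j)).natDegree ≤ (E.ψ m f).natDegree - j :=
  natDegree_le_iff_coeff_eq_zero.2 fun i hi => coeff_ψ_coeff_eq_zero hf (by omega)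

lemma isConst_leadingCoeff (hf : f ∈ E.A m) :
    E.IsConst (m + (E.ψ m f).natDegree • E.e) ((E.ψ m f).coeff (E.ψ m f).natDegree) := by
  refine isConst_of_natDegree_eq_zero (E.coeff_mem _ hf) ?_
  have := natDegree_ψ_coeff_le hf (E.ψ m f).natDegree
  omega

variable (E) in
/-- `x χ^mx` is a homogeneous local slice: its exponential has the least positive degree `n`. -/
structure IsSlice (mx : M) (x : K) (n : ℕ) : Prop where
  mem : x ∈ E.A mx
  natDegree : (E.ψ mx x).natDegree = n
  pos : 0 < n
  le : ∀ {m f}, f ∈ E.A m → (E.ψ m f).natDegree ≠ 0 → n ≤ (E.ψ m f).natDegree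

variable (E) in
lemma exists_isSlice (h : ∃ m f, f ∈ E.A m ∧ (E.ψ m f).natDegree ≠ 0) :
    ∃ mx x n, E.IsSlice mx x n := by
  classical
  have h' : ∃ n : ℕ, 0 < n ∧ ∃ m f, f ∈ E.A m ∧ (E.ψ m f).natDegree = n := by
    obtain ⟨m, f, hf, h0⟩ := h
    exact ⟨_, Nat.pos_of_ne_zero h0, m, f, hf, rfl⟩
  obtain ⟨hpos, mx, x, hx, hn⟩ := Nat.find_spec h'
  exact ⟨mx, x, Nat.find h', hx, hn, hpos, fun {m f} hf h0 =>
    Nat.find_min' h' ⟨Nat.pos_of_ne_zero h0, m, f, hf, rfl⟩⟩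

namespace IsSlice

variable {mx : M} {x : K} {n : ℕ} (hx : E.IsSlice mx x n)

include hx

lemma natDegree_eq_zero (hf : f ∈ E.A m) (h : (E.ψ m f).natDegree < n) :
    (E.ψ m f).natDegree = 0 := by
  by_contra h0
  exact absurd (hx.le hf h0) (not_le.2 h)

lemma ne_zero : x ≠ 0 := by
  rintro rfl
  have := hx.natDegree
  rw [ψ_zero, natDegree_zero] at this
  exact hx.pos.ne this

lemma coeff_ne_zero : (E.ψ mx x).coeff n ≠ 0 := by
  have h := leadingCoeff_ne_zero.2 (ψ_ne_zero hx.mem hx.ne_zero)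
  rwa [leadingCoeff, hx.natDegree] at h

lemma isConst_coeff : E.IsConst (mx + n • E.e) ((E.ψ mx x).coeff n) := by
  have := isConst_leadingCoeff hx.mem
  rwa [hx.natDegree] at this

lemma choose_eq_zero {j : ℕ} (h0 : 0 < j) (hj : j < n) : (n.choose j : K) = 0 := by
  have h1 := natDegree_ψ_coeff_le hx.mem j
  rw [hx.natDegree] at h1
  have h2 := hx.natDegree_eq_zero (E.coeff_mem j hx.mem) (by omega)
  have h3 := E.iterative (n - j) j hx.mem
  rw [coeff_eq_zero_of_natDegree_lt (by omega), Nat.sub_add_cancel hj.le] at h3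
  exact (mul_eq_zero.1 h3.symm).resolve_right hx.coeff_ne_zero

lemma one_add_X_pow : (1 + X : K[X]) ^ n = 1 + X ^ n := by
  ext j
  rw [coeff_one_add_X_pow, coeff_add, coeff_one, coeff_X_pow]
  rcases Nat.eq_zero_or_pos j with rfl | hj
  · simp [hx.pos.ne]
  rcases lt_trichotomy j n with h | rfl | h
  · rw [hx.choose_eq_zero hj h, if_neg hj.ne', if_neg h.ne, add_zero]
  · simp [hj.ne']
  · simp [Nat.choose_eq_zero_of_lt h, hj.ne', h.ne']

lemma choose_eq_one (q : ℕ) {s : ℕ} (hs : s < n) : ((q * n + s).choose s : K) = 1 := by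
  have h : (1 + X : K[X]) ^ (q * n + s) = (1 + X ^ n) ^ q * (1 + X) ^ s := by
    rw [pow_add, mul_comm q, pow_mul, hx.one_add_X_pow]
  have h1 : ∃ R : K[X], (1 + X ^ n) ^ q = 1 + X ^ n * R := by
    obtain ⟨R, hR⟩ := sub_one_dvd_pow_sub_one (1 + X ^ n : K[X]) q
    exact ⟨R, by rw [← sub_eq_iff_eq_add', hR]; ring⟩
  obtain ⟨R, hR⟩ := h1
  rw [← coeff_one_add_X_pow K, h, hR, add_mul, one_mul, coeff_add, coeff_one_add_X_pow, mul_assoc,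
    coeff_X_pow_mul', if_neg (by omega)]
  simp

lemma dvd_natDegree (hf : f ∈ E.A m) : n ∣ (E.ψ m f).natDegree := by
  set N := (E.ψ m f).natDegree with hN
  have hs : N % n < n := Nat.mod_lt _ hx.pos
  have hNq : N / n * n + N % n = N := Nat.div_add_mod' N n
  by_contra hdvd
  have hs0 : N % n ≠ 0 := fun h => hdvd (Nat.dvd_of_mod_eq_zero h)
  have h1 := natDegree_ψ_coeff_le hf (N / n * n)
  have h2 := hx.natDegree_eq_zero (E.coeff_mem (N / n * n) hf) (by omega)
  have h3 := E.iterative (N % n) (N / n * n) hf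
  rw [coeff_eq_zero_of_natDegree_lt (by omega), add_comm (N % n), hNq,
    Nat.choose_symm_of_eq_add (a := N / n * n) (b := N % n) (n := N) (by omega)] at h3
  have h4 := hx.choose_eq_one (N / n) hs
  rw [hNq] at h4
  rw [h4, one_mul] at h3
  have h5 : E.ψ m f = 0 := leadingCoeff_eq_zero.1 h3.symm
  rw [hN, h5, natDegree_zero] at hs0
  simp at hs0

/-- Every homogeneous element is, up to a power of the leading coefficient of the slice, a
polynomial in the slice with coefficients in the kernel. -/
lemma exists_polynomial (hf : f ∈ E.A m) : ∃ (Q : ℕ) (P : K[X]),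
    (∀ i, E.IsConst (m + Q • (mx + n • E.e) - i • mx) (P.coeff i)) ∧
      ((E.ψ mx x).coeff n) ^ Q * f = P.eval x := by
  set b := (E.ψ mx x).coeff n with hb
  induction hN : (E.ψ m f).natDegree using Nat.strong_induction_on generalizing m f with
  | _ N ih =>
  by_cases hN0 : N = 0
  · refine ⟨0, C f, fun i => ?_, by simp⟩
    rw [coeff_C]
    split_ifs with hi
    · simpa [hi] using isConst_of_natDegree_eq_zero hf (hN.trans hN0)
    · exact IsConst.zero
  obtain ⟨q, hq⟩ := hx.dvd_natDegree hf
  set c := (E.ψ m f).coeff N with hc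
  have hcB : E.IsConst (m + N • E.e) c := by
    have := isConst_leadingCoeff hf
    rwa [hN] at this
  have hbB : E.IsConst (mx + n • E.e) b := hx.isConst_coeff
  have hdeg : m + N • E.e + q • mx = q • (mx + n • E.e) + m := by
    rw [← hN, hq, smul_add, ← mul_smul, mul_comm q n]
    abel
  have hbf := E.mul_mem (hbB.pow q).1 hf
  have hcx := E.mul_mem hcB.1 (pow_mem hx.mem q).1
  rw [hdeg] at hcx
  have hgA : b ^ q * f - c * x ^ q ∈ E.A (q • (mx + n • E.e) + m) := sub_mem hbf hcx
  have hψ : E.ψ (q • (mx + n • E.e) + m) (b ^ q * f - c * x ^ q) =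
      C b ^ q * E.ψ m f - C c * E.ψ mx x ^ q := by
    have h1 : b ^ q * f - c * x ^ q = b ^ q * f + (-1 : k) • (c * x ^ q) := by
      rw [neg_one_smul, sub_eq_add_neg]
    rw [h1, E.map_add hbf (Submodule.smul_mem _ _ hcx), E.map_smul _ hcx,
      E.map_mul (hbB.pow q).1 hf, (hbB.pow q).2, ← hdeg, E.map_mul hcB.1 (pow_mem hx.mem q).1,
      hcB.2, (pow_mem hx.mem q).2, neg_one_smul, ← sub_eq_add_neg, C_pow]
  have hlt : (E.ψ (q • (mx + n • E.e) + m) (b ^ q * f - c * x ^ q)).natDegree < N := by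
    have hle : (C b ^ q * E.ψ m f - C c * E.ψ mx x ^ q).natDegree ≤ N := by
      refine (natDegree_sub_le _ _).trans (max_le ?_ ?_)
      · rw [← C_pow]
        exact (natDegree_C_mul_le _ _).trans hN.le
      · refine (natDegree_C_mul_le _ _).trans (natDegree_pow_le.trans ?_)
        rw [hx.natDegree, mul_comm, ← hq, hN]
    rw [hψ]
    refine lt_of_le_of_ne hle fun h => ?_
    have hcoeff : (C b ^ q * E.ψ m f - C c * E.ψ mx x ^ q).coeff N = 0 := by
      have h2 : (E.ψ mx x ^ q).coeff N = b ^ q := by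
        rw [← hN, hq, mul_comm, ← hx.natDegree, coeff_pow_mul_natDegree, leadingCoeff,
          hx.natDegree]
      rw [coeff_sub, ← C_pow, coeff_C_mul, coeff_C_mul, h2, ← hc]
      ring
    rw [← h] at hcoeff
    have h3 := leadingCoeff_eq_zero.1 hcoeff
    rw [h3, natDegree_zero] at h
    exact hN0 h.symm
  obtain ⟨Q, P, hP, hPe⟩ := ih _ hlt hgA rfl
  refine ⟨Q + q, P + C (b ^ Q * c) * X ^ q, fun i => ?_, ?_⟩
  · have hd : m + (Q + q) • (mx + n • E.e) - i • mx =
        q • (mx + n • E.e) + m + Q • (mx + n • E.e) - i • mx := by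
      rw [add_smul]; abel
    rw [coeff_add, coeff_C_mul_X_pow, hd]
    refine (hP i).add ?_
    split_ifs with hi
    · rw [hi]
      have := (hbB.pow Q).mul hcB
      have hd2 : q • (mx + n • E.e) + m + Q • (mx + n • E.e) - q • mx =
          Q • (mx + n • E.e) + (m + N • E.e) := by
        rw [← hdeg]; abel
      rw [hd2]
      exact this
    · exact IsConst.zero
  · rw [eval_add, ← hPe]
    simp only [eval_mul, eval_C, eval_pow, eval_X]
    ring

end IsSlice

end

end HomogeneousExp

/-- A field is algebraically closed in its ring of power series. -/
lemma PowerSeries.eq_C_constantCoeff_of_isAlgebraic {K : Type*} [Field K] {z : PowerSeries K}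
    (hz : IsAlgebraic K z) : z = PowerSeries.C (PowerSeries.constantCoeff z) := by
  set w := z - PowerSeries.C (PowerSeries.constantCoeff z) with hw
  have hwa : IsAlgebraic K w := hz.sub (isAlgebraic_algebraMap (PowerSeries.constantCoeff z))
  rw [← sub_eq_zero, ← hw]
  by_contra h0
  refine minpoly.coeff_zero_ne_zero hwa.isIntegral h0 ?_
  have h1 := congrArg PowerSeries.constantCoeff (minpoly.aeval K w)
  rw [map_zero, Polynomial.aeval_def, Polynomial.hom_eval₂] at h1
  have h2 : PowerSeries.constantCoeff w = 0 := by simp [hw]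
  have h3 : (PowerSeries.constantCoeff (R := K)).comp (algebraMap K (PowerSeries K)) =
      RingHom.id K := by
    ext a; simp
  rw [h2, h3, Polynomial.eval₂_id, ← Polynomial.coeff_zero_eq_eval_zero] at h1
  exact h1

namespace HomogeneousExp

open Polynomial

section

variable {k K M : Type*} [Field k] [Field K] [Algebra k K] [AddCommGroup M]
  {E : HomogeneousExp k K M} {m m' : M} {f g : K}

/-- If the quotient of two exponentials is algebraic over the constants, then it is constant. -/
lemma mul_C_coeff_eq_of_homogeneous_relation {α β : K[X]} (hβ : β.coeff 0 ≠ 0) {q : K[X]}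
    (hq : q ≠ 0)
    (h : ∑ i ∈ Finset.range (q.natDegree + 1), C (q.coeff i) * α ^ i * β ^ (q.natDegree - i) = 0) :
    α * C (β.coeff 0) = β * C (α.coeff 0) := by
  have hβc : PowerSeries.constantCoeff (β : PowerSeries K) ≠ 0 := by simpa using hβ
  have hβ' : (β : PowerSeries K) * (β : PowerSeries K)⁻¹ = 1 := PowerSeries.mul_inv_cancel _ hβc
  obtain ⟨z, hα⟩ : ∃ z : PowerSeries K, (α : PowerSeries K) = z * β :=
    ⟨α * (β : PowerSeries K)⁻¹, by rw [mul_assoc, mul_comm _ (β : PowerSeries K), hβ', mul_one]⟩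
  have hzalg : IsAlgebraic K z := by
    refine ⟨q, hq, ?_⟩
    have h1 : (∑ i ∈ Finset.range (q.natDegree + 1),
        PowerSeries.C (q.coeff i) * (α : PowerSeries K) ^ i * (β : PowerSeries K) ^ (q.natDegree - i)) = 0 := by
      have := congrArg (Polynomial.coeToPowerSeries.ringHom) h
      simpa [_root_.map_sum] using this
    have h2 : aeval z q * (β : PowerSeries K) ^ q.natDegree = 0 := by
      rw [← h1, aeval_eq_sum_range, Finset.sum_mul]
      refine Finset.sum_congr rfl fun i hi => ?_
      have hi' : i ≤ q.natDegree := by simpa [Nat.lt_succ_iff] using hi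
      rw [hα, mul_pow, Algebra.smul_def, PowerSeries.algebraMap_apply, Algebra.algebraMap_self,
        RingHom.id_apply]
      rw [mul_assoc, mul_assoc, mul_assoc, ← pow_add, Nat.add_sub_cancel' hi']
    refine (mul_eq_zero.1 h2).resolve_right (pow_ne_zero _ ?_)
    intro h0
    rw [h0, zero_mul] at hβ'
    exact zero_ne_one hβ'
  have hzc := PowerSeries.eq_C_constantCoeff_of_isAlgebraic hzalg
  have h3 : PowerSeries.constantCoeff z * β.coeff 0 = α.coeff 0 := by
    have := congrArg PowerSeries.constantCoeff hα
    simpa using this.symm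
  apply Polynomial.coe_injective K
  rw [Polynomial.coe_mul, Polynomial.coe_mul, Polynomial.coe_C, Polynomial.coe_C, ← h3,
    _root_.map_mul, ← hzc, hα]
  ring

/-- The value at `f / g` of a polynomial over `k`, times a power of `g`, is in the kernel. -/
lemma IsConst.aeval_div_mul_pow (hf : E.IsConst m f) (hg : E.IsConst m g) (hg0 : g ≠ 0)
    (p : k[X]) {J : ℕ} (hJ : p.natDegree ≤ J) : E.IsConst (J • m) (aeval (f / g) p * g ^ J) := by
  rw [aeval_eq_sum_range' (Nat.lt_succ_of_le hJ), Finset.sum_mul]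
  refine IsConst.sum _ fun i hi => ?_
  have hi' : i ≤ J := by simpa [Nat.lt_succ_iff] using hi
  have h1 : p.coeff i • (f / g) ^ i * g ^ J = p.coeff i • (f ^ i * g ^ (J - i)) := by
    rw [smul_mul_assoc, div_pow, ← Nat.sub_add_cancel hi', pow_add]
    congr 1
    simp only [Nat.add_sub_cancel]
    field_simp
  rw [h1]
  refine IsConst.smul _ ?_
  have h2 := (hf.pow i).mul (hg.pow (J - i))
  rwa [← add_smul, Nat.add_sub_cancel' hi'] at h2

variable (E) in
/-- The higher derivation does not annihilate the field of homogeneous fractions of degree zero. -/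
def IsHorizontal : Prop :=
  ∃ m a b, a ∈ E.A m ∧ b ∈ E.A m ∧ E.ψ m a * C b ≠ E.ψ m b * C a

/-- The homogeneous pieces of the kernel have dimension at most one. -/
lemma IsConst.exists_smul_eq (hk : ∀ h : K, IsAlgebraic k h → h ∈ (algebraMap k K).range)
    (htr : ∀ h : K, Transcendental k h → ∀ w : K, ∃ P : k[X][X], P ≠ 0 ∧
      (P.map (aeval h : k[X] →ₐ[k] K).toRingHom).eval w = 0)
    (hhor : E.IsHorizontal) (hf : E.IsConst m f) (hg : E.IsConst m g) (hg0 : g ≠ 0) :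
    ∃ c : k, f = c • g := by
  by_cases halg : IsAlgebraic k (f / g)
  · obtain ⟨c, hc⟩ := hk _ halg
    exact ⟨c, by rw [Algebra.smul_def, hc]; field_simp⟩
  exfalso
  obtain ⟨m₀, a, b, ha, hb, hab⟩ := hhor
  have hb0 : b ≠ 0 := by
    rintro rfl
    simp [ψ_zero] at hab
  obtain ⟨P, hP0, hP⟩ := htr _ halg (a / b)
  set h := f / g with hh
  have hinj : Function.Injective (aeval h : k[X] →ₐ[k] K).toRingHom :=
    transcendental_iff_injective.1 halg
  set q : K[X] := P.map (aeval h : k[X] →ₐ[k] K).toRingHom with hq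
  have hq0 : q ≠ 0 := (Polynomial.map_ne_zero_iff hinj).2 hP0
  set J : ℕ := (Finset.range (q.natDegree + 1)).sup fun i => (P.coeff i).natDegree with hJ
  have hF : ∀ i ∈ Finset.range (q.natDegree + 1), E.IsConst (J • m) (q.coeff i * g ^ J) := by
    intro i hi
    rw [hq, coeff_map]
    exact hf.aeval_div_mul_pow hg hg0 _ (Finset.le_sup (f := fun i => (P.coeff i).natDegree) hi)
  set I := q.natDegree with hI
  have hmem : ∀ i ∈ Finset.range (I + 1),
      q.coeff i * g ^ J * (a ^ i * b ^ (I - i)) ∈ E.A (J • m + I • m₀) ∧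
      E.ψ (J • m + I • m₀) (q.coeff i * g ^ J * (a ^ i * b ^ (I - i))) =
        C (g ^ J) * (C (q.coeff i) * E.ψ m₀ a ^ i * E.ψ m₀ b ^ (I - i)) := by
    intro i hi
    have hi' : i ≤ I := by simpa [Nat.lt_succ_iff] using hi
    have hd : I • m₀ = i • m₀ + (I - i) • m₀ := by rw [← add_smul, Nat.add_sub_cancel' hi']
    have h1 := pow_mem ha i
    have h2 := pow_mem hb (I - i)
    rw [hd]
    refine ⟨E.mul_mem (hF i hi).1 (E.mul_mem h1.1 h2.1), ?_⟩
    rw [E.map_mul (hF i hi).1 (E.mul_mem h1.1 h2.1), E.map_mul h1.1 h2.1, (hF i hi).2, h1.2, h2.2,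
      C_mul]
    ring
  have hsum : ∑ i ∈ Finset.range (I + 1), q.coeff i * g ^ J * (a ^ i * b ^ (I - i)) = 0 := by
    have h1 : q.eval (a / b) * (g ^ J * b ^ I) = 0 := by rw [hP, zero_mul]
    rw [← h1, eval_eq_sum_range, Finset.sum_mul]
    refine Finset.sum_congr rfl fun i hi => ?_
    have hi' : i ≤ I := by simpa [Nat.lt_succ_iff] using hi
    have hbI : b ^ I = b ^ i * b ^ (I - i) := by rw [← pow_add, Nat.add_sub_cancel' hi']
    rw [div_pow, hbI]
    field_simp
  have h3 := ψ_sum _ fun i hi => (hmem i hi).1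
  rw [hsum, ψ_zero, Finset.sum_congr rfl fun i hi => (hmem i hi).2, ← Finset.mul_sum] at h3
  have h4 := (mul_eq_zero.1 h3.symm).resolve_left (by simp [hg0])
  have h5 := mul_C_coeff_eq_of_homogeneous_relation (by rwa [E.coeff_zero hb]) hq0 h4
  rw [E.coeff_zero ha, E.coeff_zero hb] at h5
  exact hab h5

end

end HomogeneousExp

namespace HomogeneousExp

open Polynomial

section

variable {k K M : Type*} [Field k] [Field K] [Algebra k K] [AddCommGroup M]
  (E : HomogeneousExp k K M)

/-- `z χ^m` is a quotient of non-zero homogeneous elements of the kernel. -/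
def IsConstQuot (m : M) (z : K) : Prop :=
  ∃ s s' f f', E.IsConst s f ∧ E.IsConst s' f' ∧ f ≠ 0 ∧ f' ≠ 0 ∧ m = s - s' ∧ z * f' = f

variable {E} {m m' : M} {z z' f g : K}

lemma IsConstQuot.one : E.IsConstQuot 0 1 :=
  ⟨0, 0, 1, 1, IsConst.one, IsConst.one, one_ne_zero, one_ne_zero, by simp, by simp⟩

lemma IsConstQuot.ne_zero (h : E.IsConstQuot m z) : z ≠ 0 := by
  obtain ⟨s, s', f, f', -, -, h0, -, -, h⟩ := h
  rintro rfl
  rw [zero_mul] at h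
  exact h0 h.symm

lemma IsConstQuot.mul (h : E.IsConstQuot m z) (h' : E.IsConstQuot m' z') :
    E.IsConstQuot (m + m') (z * z') := by
  obtain ⟨s, s', f, f', hf, hf', h0, h0', hm, hz⟩ := h
  obtain ⟨t, t', g, g', hg, hg', h1, h1', hm', hz'⟩ := h'
  exact ⟨s + t, s' + t', f * g, f' * g', hf.mul hg, hf'.mul hg', mul_ne_zero h0 h1,
    mul_ne_zero h0' h1', by rw [hm, hm']; abel, by rw [← hz, ← hz']; ring⟩

lemma IsConstQuot.inv (h : E.IsConstQuot m z) : E.IsConstQuot (-m) z⁻¹ := by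
  have hz0 := h.ne_zero
  obtain ⟨s, s', f, f', hf, hf', h0, h0', hm, hz⟩ := h
  exact ⟨s', s, f', f, hf', hf, h0', h0, by rw [hm]; abel, by rw [← hz]; field_simp⟩

lemma IsConst.isConstQuot (hf : E.IsConst m f) (h0 : f ≠ 0) : E.IsConstQuot m f :=
  ⟨m, 0, f, 1, hf, IsConst.one, h0, one_ne_zero, by simp, by simp⟩

lemma IsConstQuot.isConst (h : E.IsConstQuot m z) (hz : z ∈ E.A m) : E.IsConst m z := by
  obtain ⟨s, s', f, f', hf, hf', h0, h0', hm, hzf⟩ := h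
  refine IsConst.of_mul hz hf'.1 ?_ (hzf ▸ h0)
  rwa [hzf, hm, sub_add_cancel]

variable (E) in
/-- The lattice generated by the weights of the kernel. -/
def weightLattice : AddSubgroup M where
  carrier := {m | ∃ z, E.IsConstQuot m z}
  zero_mem' := ⟨1, IsConstQuot.one⟩
  add_mem' := fun ⟨z, h⟩ ⟨z', h'⟩ => ⟨z * z', h.mul h'⟩
  neg_mem' := fun ⟨z, h⟩ => ⟨z⁻¹, h.inv⟩

lemma IsConst.mem_weightLattice (hf : E.IsConst m f) (h0 : f ≠ 0) : m ∈ E.weightLattice :=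
  ⟨f, hf.isConstQuot h0⟩

variable (E) in
/-- A multiplicative choice of quotients of elements of the kernel. -/
structure IsCharacter (φ : M → Kˣ) : Prop where
  isConstQuot : ∀ m ∈ E.weightLattice, E.IsConstQuot m (φ m)
  map_add : ∀ m ∈ E.weightLattice, ∀ m' ∈ E.weightLattice, φ (m + m') = φ m * φ m'

variable (E) in
lemma exists_isCharacter [Module.Free ℤ M] [Module.Finite ℤ M] : ∃ φ, E.IsCharacter φ := by
  classical
  let L : Submodule ℤ M := E.weightLattice.toIntSubmodule
  have hL : ∀ m, m ∈ L ↔ m ∈ E.weightLattice := fun m => Iff.rfl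
  obtain ⟨n, ⟨b⟩⟩ := Submodule.nonempty_basis_of_pid (Module.Free.chooseBasis ℤ M) L
  have hch : ∀ i, ∃ z : Kˣ, E.IsConstQuot (b i : M) z := fun i => by
    obtain ⟨z, hz⟩ := (hL _).1 (b i).2
    exact ⟨Units.mk0 z hz.ne_zero, hz⟩
  choose z hz using hch
  let Φ : L →ₗ[ℤ] Additive Kˣ := b.constr ℤ fun i => Additive.ofMul (z i)
  have hΦ : ∀ l : L, E.IsConstQuot (l : M) (((Φ l).toMul : Kˣ) : K) := by
    intro l
    have hl : l ∈ Submodule.span ℤ (Set.range b) := by rw [b.span_eq]; trivial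
    induction hl using Submodule.span_induction with
    | mem x hx =>
      obtain ⟨i, rfl⟩ := hx
      have : Φ (b i) = Additive.ofMul (z i) := b.constr_basis ℤ _ i
      rw [this]
      exact hz i
    | zero => simpa using IsConstQuot.one
    | add x y _ _ hx hy =>
      rw [_root_.map_add]
      simpa using hx.mul hy
    | smul a x _ hx =>
      rw [_root_.map_smul]
      have hn : ∀ n : ℕ, E.IsConstQuot (((n : ℤ) • x : L) : M)
          ((((n : ℤ) • Φ x).toMul : Kˣ) : K) := by
        intro n
        induction n with
        | zero => simpa using IsConstQuot.one
        | succ n ih =>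
          have := ih.mul hx
          rw [Nat.cast_succ, add_smul, one_smul, add_one_zsmul]
          simpa using this
      rcases Int.eq_nat_or_neg a with ⟨n, rfl | rfl⟩
      · exact hn n
      · have := (hn n).inv
        rw [neg_smul, neg_smul]
        simpa using this
  refine ⟨fun m => if h : m ∈ L then (Φ ⟨m, h⟩).toMul else 1, fun m hm => ?_, fun m hm m' hm' => ?_⟩
  · have h : m ∈ L := hm
    simp only [dif_pos h]
    exact hΦ ⟨m, h⟩
  · have h : m ∈ L := hm
    have h' : m' ∈ L := hm'
    have h'' : m + m' ∈ L := add_mem h h'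
    simp only [dif_pos h, dif_pos h', dif_pos h'']
    rw [← toMul_add, ← _root_.map_add]
    rfl

namespace IsCharacter

variable {φ : M → Kˣ} (hφ : E.IsCharacter φ)

include hφ

lemma map_zero : φ 0 = 1 := by
  have := hφ.map_add 0 (zero_mem _) 0 (zero_mem _)
  rw [add_zero] at this
  exact (mul_eq_left.1 this.symm)

lemma map_neg (hm : m ∈ E.weightLattice) : φ (-m) = (φ m)⁻¹ := by
  have := hφ.map_add _ (neg_mem hm) m hm
  rw [neg_add_cancel, hφ.map_zero] at this
  exact eq_inv_of_mul_eq_one_left this.symm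

lemma map_sub (hm : m ∈ E.weightLattice) (hm' : m' ∈ E.weightLattice) :
    φ (m - m') = φ m * (φ m')⁻¹ := by
  rw [sub_eq_add_neg, hφ.map_add _ hm _ (neg_mem hm'), hφ.map_neg hm']

lemma map_nsmul (hm : m ∈ E.weightLattice) (n : ℕ) : φ (n • m) = φ m ^ n := by
  induction n with
  | zero => simp [hφ.map_zero]
  | succ n ih => rw [succ_nsmul, hφ.map_add _ (nsmul_mem hm n) _ hm, ih, pow_succ]

end IsCharacter

variable (E) in
/-- The data describing the kernel and the graded pieces. -/
structure IsKernelData (L : AddSubgroup M) (φ : M → Kˣ) (u : K) (r : ℕ) : Prop where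
  r_pos : 0 < r
  map_add : ∀ m ∈ L, ∀ m' ∈ L, φ (m + m') = φ m * φ m'
  transcendental : Transcendental k u
  const_eq : ∀ m f, E.IsConst m f → f ≠ 0 → m ∈ L ∧ ∃ c : k, f = c • (φ m : K)
  isConst : ∀ m ∈ L, (φ m : K) ∈ E.A m → E.IsConst m (φ m)
  mem_eq : ∀ m ∈ L, ∀ a ∈ E.A m, ∃ p : k[X], a = φ m * aeval u p
  smul_mem : ∀ m, ∀ a ∈ E.A m, a ≠ 0 → r • m ∈ L
  exists_mem : ∃ s ∈ L, (φ s : K) ∈ E.A s ∧ u * φ s ∈ E.A s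
  exists_sub : ∀ m ∈ L, ∃ s ∈ L, ∃ s' ∈ L, (φ s : K) ∈ E.A s ∧ (φ s' : K) ∈ E.A s' ∧ m = s - s'

theorem exists_isKernelData [Module.Free ℤ M] [Module.Finite ℤ M]
    (hk : ∀ h : K, IsAlgebraic k h → h ∈ (algebraMap k K).range)
    (htr : ∀ h : K, Transcendental k h → ∀ w : K, ∃ P : k[X][X], P ≠ 0 ∧
      (P.map (aeval h : k[X] →ₐ[k] K).toRingHom).eval w = 0)
    (hhor : E.IsHorizontal) : ∃ L φ u r, E.IsKernelData L φ u r := by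
  classical
  obtain ⟨φ, hφ⟩ := E.exists_isCharacter
  have hquot : ∀ {m : M} {z z' : K}, E.IsConstQuot m z → E.IsConstQuot m z' →
      ∃ c : k, z = c • z' := by
    intro m z z' h h'
    obtain ⟨s, s', f, f', hf, hf', h0, h0', hm, hz⟩ := h
    obtain ⟨t, t', g, g', hg, hg', h1, h1', hm', hz'⟩ := h'
    have hd : t + s' = s + t' := by
      rw [hm, sub_eq_sub_iff_add_eq_add] at hm'
      rw [hm', add_comm]
    obtain ⟨c, hc⟩ := (hf.mul hg').exists_smul_eq hk htr hhor (hd ▸ hg.mul hf')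
      (mul_ne_zero h1 h0')
    refine ⟨c, ?_⟩
    have h2 : z * (f' * g') = (c • z') * (f' * g') := by
      rw [← hz, ← hz'] at hc
      rw [Algebra.smul_def] at hc ⊢
      linear_combination hc
    exact mul_right_cancel₀ (mul_ne_zero h0' h1') h2
  have hconst : ∀ m f, E.IsConst m f → f ≠ 0 →
      m ∈ E.weightLattice ∧ ∃ c : k, f = c • (φ m : K) := fun m f hf h0 =>
    ⟨hf.mem_weightLattice h0, hquot (hf.isConstQuot h0) (hφ.isConstQuot m (hf.mem_weightLattice h0))⟩
  have hsub : ∀ m ∈ E.weightLattice, ∃ s ∈ E.weightLattice, ∃ s' ∈ E.weightLattice,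
      (φ s : K) ∈ E.A s ∧ (φ s' : K) ∈ E.A s' ∧ m = s - s' := by
    have key : ∀ s f, E.IsConst s f → f ≠ 0 → (φ s : K) ∈ E.A s := by
      intro s f hf h0
      obtain ⟨c, hc⟩ := (hconst s f hf h0).2
      have hc0 : c ≠ 0 := by rintro rfl; simp at hc; exact h0 hc
      rw [← inv_smul_eq_iff₀ hc0] at hc
      rw [← hc]
      exact Submodule.smul_mem _ _ hf.1
    rintro m ⟨z, s, s', f, f', hf, hf', h0, h0', hm, hz⟩
    exact ⟨s, hf.mem_weightLattice h0, s', hf'.mem_weightLattice h0', key s f hf h0,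
      key s' f' hf' h0', hm⟩
  -- a local slice
  obtain ⟨mx, x, n, hx⟩ := E.exists_isSlice (by
    by_contra! hcon
    obtain ⟨m, a, b, ha, hb, hab⟩ := hhor
    rw [(isConst_of_natDegree_eq_zero ha (hcon m a ha)).2,
      (isConst_of_natDegree_eq_zero hb (hcon m b hb)).2] at hab
    exact hab (mul_comm _ _))
  have hx0 := hx.ne_zero
  set b := (E.ψ mx x).coeff n with hb
  have hb0 : b ≠ 0 := hx.coeff_ne_zero
  have hbB : E.IsConst (mx + n • E.e) b := hx.isConst_coeff
  set mb := mx + n • E.e with hmb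
  have hmbL : mb ∈ E.weightLattice := hbB.mem_weightLattice hb0
  -- exponents occurring in the expansion of a homogeneous element
  have hexp : ∀ {m : M} {Q i : ℕ} {c : K}, E.IsConst (m + Q • mb - i • mx) c → c ≠ 0 →
      m - i • mx ∈ E.weightLattice := by
    intro m Q i c hc h0
    have h1 := sub_mem (hc.mem_weightLattice h0) (nsmul_mem hmbL Q)
    convert h1 using 1
    abel
  have hmemA : ∀ {m m' : M} {f : K}, f ∈ E.A m → m = m' → f ∈ E.A m' := fun h e => e ▸ h
  have hr : ∃ r : ℕ, 0 < r ∧ r • mx ∈ E.weightLattice := by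
    by_contra! hcon
    have huniq : ∀ i j : ℕ, ∀ m : M, m - i • mx ∈ E.weightLattice → m - j • mx ∈ E.weightLattice →
        i = j := by
      have haux : ∀ i j : ℕ, ∀ m : M, i < j → m - i • mx ∈ E.weightLattice →
          m - j • mx ∈ E.weightLattice → False := by
        intro i j m hij hi hj
        refine hcon (j - i) (by omega) ?_
        have h1 := sub_mem hi hj
        have h2 : m - i • mx - (m - j • mx) = (j - i) • mx := by
          rw [sub_sub_sub_cancel_left, sub_nsmul _ hij.le, ← sub_eq_add_neg]
        rwa [h2] at h1
      intro i j m hi hj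
      rcases lt_trichotomy i j with h | h | h
      · exact (haux i j m h hi hj).elim
      · exact h
      · exact (haux j i m h hj hi).elim
    have hmono : ∀ {m : M} {a : K}, a ∈ E.A m → a ≠ 0 → ∃ i : ℕ, m - i • mx ∈ E.weightLattice ∧
        E.ψ m a * C (x ^ i) = C a * E.ψ mx x ^ i := by
      intro m a ha ha0
      obtain ⟨Q, P, hP, hPe⟩ := hx.exists_polynomial ha
      have hP0 : P ≠ 0 := by
        rintro rfl
        rw [eval_zero] at hPe
        exact mul_ne_zero (pow_ne_zero _ hb0) ha0 hPe
      set i := P.natDegree with hi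
      have hci : P.coeff i ≠ 0 := leadingCoeff_ne_zero.2 hP0
      have hiL := hexp (hP i) hci
      have hPC : P = C (P.coeff i) * X ^ i := by
        ext j
        rw [coeff_C_mul_X_pow]
        split_ifs with hj
        · rw [hj]
        · by_contra h0
          exact hj (huniq j i m (hexp (hP j) h0) hiL)
      rw [hPC] at hPe
      simp only [eval_mul, eval_C, eval_pow, eval_X] at hPe
      refine ⟨i, hiL, ?_⟩
      have h1 : E.ψ (Q • mb + m) (b ^ Q * a) = C (b ^ Q) * E.ψ m a := by
        rw [E.map_mul (hbB.pow Q).1 ha, (hbB.pow Q).2]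
      have hd : Q • mb + m = (m + Q • mb - i • mx) + i • mx := by abel
      rw [hPe, hd, E.map_mul (hP i).1 (pow_mem hx.mem i).1, (hP i).2, (pow_mem hx.mem i).2] at h1
      have h2 : C (b ^ Q) * (E.ψ m a * C (x ^ i)) = C (b ^ Q) * (C a * E.ψ mx x ^ i) := by
        rw [← mul_assoc, ← h1, ← mul_assoc, ← C_mul, hPe, C_mul]
        ring
      exact mul_left_cancel₀ (by simpa using pow_ne_zero Q hb0) h2
    obtain ⟨m, a, a', ha, ha', hab⟩ := hhor
    have ha0 : a ≠ 0 := by rintro rfl; simp [ψ_zero] at hab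
    have ha0' : a' ≠ 0 := by rintro rfl; simp [ψ_zero] at hab
    obtain ⟨i, hi, h1⟩ := hmono ha ha0
    obtain ⟨j, hj, h2⟩ := hmono ha' ha0'
    obtain rfl := huniq i j m hi hj
    refine hab (mul_right_cancel₀ (b := C (x ^ i)) (by simpa using pow_ne_zero i hx0) ?_)
    linear_combination C a' * h1 - C a * h2
  set r := Nat.find hr with hrdef
  obtain ⟨hr0, hrL⟩ : 0 < r ∧ r • mx ∈ E.weightLattice := Nat.find_spec hr
  have hdvd : ∀ i : ℕ, i • mx ∈ E.weightLattice → r ∣ i := by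
    intro i hi
    by_contra hnd
    have h1 : (i % r) • mx ∈ E.weightLattice := by
      have h2 : i • mx - (i / r) • r • mx = (i % r) • mx := by
        rw [← mul_smul, sub_eq_iff_eq_add', ← add_smul, mul_comm, Nat.div_add_mod]
      rw [← h2]
      exact sub_mem hi (nsmul_mem hrL _)
    exact Nat.find_min hr (Nat.mod_lt i hr0)
      ⟨Nat.pos_of_ne_zero fun h => hnd (Nat.dvd_of_mod_eq_zero h), h1⟩
  set u : K := x ^ r * ((φ (r • mx))⁻¹ : Kˣ) with hu
  have hus : ∃ s f, E.IsConst s f ∧ f ≠ 0 ∧ u * f ∈ E.A s ∧ ((∃ c : k, u = algebraMap k K c) → False) := by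
    obtain ⟨s, s', f, f', hf, hf', h0, h0', hm, hz⟩ := hφ.isConstQuot _ hrL
    have hmem : x ^ r * f' ∈ E.A s :=
      hmemA (E.mul_mem (pow_mem hx.mem r).1 hf'.1) (by rw [hm, sub_add_cancel])
    have huf : u * f = x ^ r * f' := by
      rw [hu, ← hz, Units.val_inv_eq_inv_val]
      field_simp
    refine ⟨s, f, hf, h0, by rwa [huf], fun ⟨c, hc⟩ => ?_⟩
    rw [hc, ← Algebra.smul_def] at huf
    have h1 : E.IsConst (r • mx + s') (x ^ r * f') := by
      rw [hm, sub_add_cancel, ← huf]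
      exact hf.smul c
    have h2 := IsConst.of_mul (pow_mem hx.mem r).1 hf'.1 h1 (mul_ne_zero (pow_ne_zero _ hx0) h0')
    have h3 := h2.natDegree_eq_zero
    rw [(pow_mem hx.mem r).2, natDegree_pow, hx.natDegree] at h3
    have := Nat.mul_pos hr0 hx.pos
    omega
  have hmem_eq : ∀ m ∈ E.weightLattice, ∀ a ∈ E.A m, ∃ p : k[X], a = φ m * aeval u p := by
    intro m hm a ha
    obtain ⟨Q, P, hP, hPe⟩ := hx.exists_polynomial ha
    obtain ⟨-, γ, hγ⟩ := hconst _ _ hbB hb0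
    have hγ0 : γ ≠ 0 := by rintro rfl; simp at hγ; exact hb0 hγ
    have hterm : ∀ i, ∃ p : k[X], P.coeff i * x ^ i = (b ^ Q * φ m) * aeval u p := by
      intro i
      by_cases h0 : P.coeff i = 0
      · exact ⟨0, by simp [h0]⟩
      have h1 : i • mx ∈ E.weightLattice := by
        have := sub_mem hm (hexp (hP i) h0)
        rwa [sub_sub_cancel] at this
      obtain ⟨j, rfl⟩ := hdvd i h1
      obtain ⟨-, c, hc⟩ := hconst _ _ (hP _) h0
      refine ⟨C (c * (γ ^ Q)⁻¹) * X ^ j, ?_⟩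
      have h2 : φ (m + Q • mb - (r * j) • mx) = φ m * φ mb ^ Q * ((φ (r • mx)) ^ j)⁻¹ := by
        rw [hφ.map_sub (add_mem hm (nsmul_mem hmbL Q)) h1, hφ.map_add _ hm _ (nsmul_mem hmbL Q),
          hφ.map_nsmul hmbL, mul_comm r j, mul_smul, hφ.map_nsmul hrL]
      rw [hc, h2, hγ, hu]
      simp only [_root_.map_mul, aeval_C, aeval_X, map_pow, Algebra.smul_def, map_inv₀,
        Units.val_mul, Units.val_pow_eq_pow_val, Units.val_inv_eq_inv_val]
      have hγ' : algebraMap k K γ ≠ 0 := by simpa using hγ0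
      rw [pow_mul]
      field_simp
      rw [div_pow, mul_pow]
      field_simp
    choose p hp using hterm
    refine ⟨∑ i ∈ Finset.range (P.natDegree + 1), p i, ?_⟩
    have hbQ := pow_ne_zero Q hb0
    refine mul_left_cancel₀ hbQ ?_
    rw [hPe, eval_eq_sum_range, Finset.sum_congr rfl fun i _ => hp i, ← Finset.mul_sum,
      _root_.map_sum]
    ring
  refine ⟨E.weightLattice, φ, u, r, hr0, hφ.map_add, ?_, hconst,
    fun m hm h => (hφ.isConstQuot m hm).isConst h, hmem_eq, ?_, ?_, hsub⟩
  · intro halg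
    obtain ⟨c, hc⟩ := hk u halg
    obtain ⟨s, f, -, -, -, h⟩ := hus
    exact h ⟨c, hc.symm⟩
  · intro m a ha ha0
    obtain ⟨Q, P, hP, hPe⟩ := hx.exists_polynomial ha
    have hP0 : P ≠ 0 := by
      rintro rfl
      rw [eval_zero] at hPe
      exact mul_ne_zero (pow_ne_zero _ hb0) ha0 hPe
    have h1 := hexp (hP P.natDegree) (leadingCoeff_ne_zero.2 hP0)
    have h2 := add_mem (nsmul_mem h1 r) (nsmul_mem hrL P.natDegree)
    convert h2 using 1
    rw [smul_sub, smul_comm P.natDegree r mx, sub_add_cancel]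
  · obtain ⟨s, f, hf, h0, huf, -⟩ := hus
    obtain ⟨hs, c, hc⟩ := hconst s f hf h0
    have hc0 : c ≠ 0 := by rintro rfl; simp at hc; exact h0 hc
    have hc' : (φ s : K) = c⁻¹ • f := by rw [hc, inv_smul_smul₀ hc0]
    refine ⟨s, hs, ?_, ?_⟩
    · rw [hc']
      exact Submodule.smul_mem _ _ hf.1
    · rw [hc', mul_smul_comm]
      exact Submodule.smul_mem _ _ huf

end

end HomogeneousExp

lemma AddMonoidAlgebra.isDomain_of_free (R M : Type*) [CommRing R] [IsDomain R] [AddCommGroup M]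
    [Module.Free ℤ M] [Module.Finite ℤ M] : IsDomain (AddMonoidAlgebra R M) := by
  have : IsAddTorsionFree M := .of_isTorsionFree ℤ M
  have : AddMonoid.FG M :=
    AddGroup.fg_iff_addMonoid_fg.1 (Module.Finite.iff_addGroup_fg.1 inferInstance)
  infer_instance

namespace PolyhedralDivisor

open Polynomial

variable {k : Type u} [Field k] {C : RegularCurve k} {M : Type} [AddCommGroup M]
  (D : PolyhedralDivisor C M)

/-- The homogeneous element `f χ^m` of `A[C, 𝔇]`. -/
noncomputable def mono (m : M) (f : C.K) (hf : f ∈ D.piece m) : D.algebra :=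
  ⟨AddMonoidAlgebra.single m f, fun m' => by
    classical
    rw [AddMonoidAlgebra.coeff_single, Finsupp.single_apply]
    split_ifs with h
    · exact h ▸ hf
    · exact zero_mem _⟩

variable {D}

lemma coe_mono {m : M} {f : C.K} (hf : f ∈ D.piece m) :
    (D.mono m f hf : AddMonoidAlgebra C.K M) = AddMonoidAlgebra.single m f := rfl

lemma isHomogeneousElem_mono {m : M} {f : C.K} (hf : f ∈ D.piece m) :
    D.IsHomogeneousElem m (D.mono m f hf) := fun m' hm' => by
  classical
  rw [coe_mono, AddMonoidAlgebra.coeff_single, Finsupp.single_apply, if_neg hm'.symm]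

lemma IsHomogeneousElem.eq_mono {m : M} {a : D.algebra} (h : D.IsHomogeneousElem m a) :
    a = D.mono m ((a : AddMonoidAlgebra C.K M).coeff m) (a.2 m) := by
  classical
  apply Subtype.ext
  apply AddMonoidAlgebra.ext
  ext m'
  rw [coe_mono, AddMonoidAlgebra.coeff_single, Finsupp.single_apply]
  split_ifs with hm
  · rw [hm]
  · exact h m' (Ne.symm hm)

/-- The augmentation `χ^m ↦ 1`. -/
noncomputable def augmentation (C : RegularCurve k) (M : Type) [AddCommGroup M] :
    AddMonoidAlgebra C.K M →ₐ[C.K] C.K :=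
  AddMonoidAlgebra.lift C.K C.K M 1

lemma augmentation_single (m : M) (f : C.K) :
    augmentation C M (AddMonoidAlgebra.single m f) = f := by
  simp [augmentation, AddMonoidAlgebra.lift_single]

lemma IsHomogeneousElem.augmentation_eq {m : M} {a : D.algebra} (h : D.IsHomogeneousElem m a) :
    augmentation C M a = (a : AddMonoidAlgebra C.K M).coeff m := by
  conv_lhs => rw [h.eq_mono, coe_mono, augmentation_single]

lemma IsHomogeneousElem.ext {m : M} {a b : D.algebra} (ha : D.IsHomogeneousElem m a)
    (hb : D.IsHomogeneousElem m b) (h : augmentation C M a = augmentation C M b) : a = b := by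
  rw [ha.augmentation_eq, hb.augmentation_eq] at h
  rw [ha.eq_mono, hb.eq_mono]
  apply Subtype.ext
  rw [coe_mono, coe_mono, h]

lemma IsHomogeneousElem.mul {m m' : M} {a b : D.algebra} (ha : D.IsHomogeneousElem m a)
    (hb : D.IsHomogeneousElem m' b) : D.IsHomogeneousElem (m + m') (a * b) := by
  have h : a * b = D.mono (m + m') _ (D.mul_mem_piece (a.2 m) (b.2 m')) := by
    apply Subtype.ext
    rw [coe_mono, ← AddMonoidAlgebra.single_mul_single]
    conv_lhs => rw [ha.eq_mono, hb.eq_mono]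
    rfl
  rw [h]
  exact isHomogeneousElem_mono _

end PolyhedralDivisor

namespace LFIHD

open Polynomial PolyhedralDivisor

variable {k : Type u} [Field k] {C : RegularCurve k} {M : Type} [AddCommGroup M]
  {D : PolyhedralDivisor C M} (d : LFIHD k D.algebra)

/-- The exponential `∑ ∂^(j)(a) t^j`, with `χ^m` replaced by `1`. -/
noncomputable def augExp (a : D.algebra) : C.K[X] :=
  ∑ j ∈ Finset.range (d.locally_finite a).choose,
    Polynomial.C (augmentation C M (d.op j a)) * X ^ j

lemma coeff_augExp (a : D.algebra) (j : ℕ) :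
    (d.augExp a).coeff j = augmentation C M (d.op j a) := by
  rw [augExp, finsetSum_coeff]
  simp only [coeff_C_mul_X_pow]
  rw [Finset.sum_ite_eq]
  split_ifs with h
  · rfl
  · rw [(d.locally_finite a).choose_spec j (by simpa using h)]
    simp

lemma augExp_mul (a b : D.algebra) : d.augExp (a * b) = d.augExp a * d.augExp b := by
  ext j
  rw [coeff_augExp, d.leibniz, coeff_mul, AddSubmonoidClass.coe_finsetSum, map_sum]
  refine Finset.sum_congr rfl fun ij _ => ?_
  rw [coeff_augExp, coeff_augExp]
  exact map_mul _ _ _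

lemma augExp_add (a b : D.algebra) : d.augExp (a + b) = d.augExp a + d.augExp b := by
  ext j
  rw [coeff_add, coeff_augExp, coeff_augExp, coeff_augExp, map_add]
  exact map_add _ _ _

lemma augExp_smul (c : k) (a : D.algebra) : d.augExp (c • a) = c • d.augExp a := by
  ext j
  rw [coeff_smul, coeff_augExp, coeff_augExp, map_smul]
  exact map_smul ((augmentation C M).restrictScalars k) c _

variable {d} {e : M} (hde : d.IsHomogeneousOfDegree e)

open Classical in
/-- The homogeneous exponential attached to a homogeneous LFIHD on `A[C, 𝔇]`. -/
noncomputable def toHomogeneousExp (hde : d.IsHomogeneousOfDegree e) :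
    HomogeneousExp k C.K M where
  A := D.piece
  e := e
  ψ m f := if hf : f ∈ D.piece m then d.augExp (D.mono m f hf) else 0
  one_mem := D.one_mem_piece
  mul_mem := D.mul_mem_piece
  coeff_zero := fun {m f} hf => by
    rw [dif_pos hf, coeff_augExp, d.op_zero]
    exact augmentation_single m f
  map_mul := fun {m m' f g} hf hg => by
    rw [dif_pos hf, dif_pos hg, dif_pos (D.mul_mem_piece hf hg), ← augExp_mul]
    congr 1
    apply Subtype.ext
    exact (AddMonoidAlgebra.single_mul_single _ _ _ _).symm
  map_add := fun {m f g} hf hg => by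
    rw [dif_pos hf, dif_pos hg, dif_pos (add_mem hf hg), ← augExp_add]
    congr 1
    apply Subtype.ext
    exact AddMonoidAlgebra.single_add _ _ _
  map_smul := fun {m f} c hf => by
    rw [dif_pos hf, dif_pos (Submodule.smul_mem _ c hf), ← augExp_smul]
    congr 1
    apply Subtype.ext
    exact (AddMonoidAlgebra.smul_single c m f).symm
  coeff_mem := fun {m f} j hf => by
    rw [dif_pos hf, coeff_augExp, (hde j m _ (isHomogeneousElem_mono hf)).augmentation_eq]
    exact (d.op j (D.mono m f hf)).2 _
  iterative := fun {m f} i j hf => by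
    have hh := hde j m _ (isHomogeneousElem_mono hf)
    have hmem : (d.augExp (D.mono m f hf)).coeff j ∈ D.piece (m + j • e) := by
      rw [coeff_augExp, hh.augmentation_eq]
      exact (d.op j (D.mono m f hf)).2 _
    have hmono : D.mono (m + j • e) ((d.augExp (D.mono m f hf)).coeff j) hmem =
        d.op j (D.mono m f hf) := by
      refine (isHomogeneousElem_mono hmem).ext hh ?_
      rw [coe_mono, augmentation_single, coeff_augExp]
    rw [dif_pos hf, dif_pos hmem, coeff_augExp, hmono, coeff_augExp]
    have := LinearMap.congr_fun (d.iterative i j) (D.mono m f hf)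
    rw [LinearMap.comp_apply] at this
    rw [this, Nat.choose_symm_add, LinearMap.smul_apply, ← nsmul_eq_mul]
    exact map_nsmul (augmentation C M) _ _

lemma toHomogeneousExp_ψ {m : M} {f : C.K} (hf : f ∈ D.piece m) :
    (toHomogeneousExp hde).ψ m f = d.augExp (D.mono m f hf) := dif_pos hf

include hde in
lemma op_mono_eq_zero_iff {m : M} {f : C.K} (hf : f ∈ D.piece m) (j : ℕ) :
    d.op j (D.mono m f hf) = 0 ↔ (d.augExp (D.mono m f hf)).coeff j = 0 := by
  rw [coeff_augExp]
  refine ⟨fun h => by rw [h]; simp, fun h => ?_⟩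
  refine (hde j m _ (isHomogeneousElem_mono hf)).ext (b := 0) (fun m' _ => rfl) ?_
  rw [h]; simp

lemma isConst_iff {m : M} {f : C.K} (hf : f ∈ D.piece m) :
    (toHomogeneousExp hde).IsConst m f ↔ ∀ i ≥ 1, d.op i (D.mono m f hf) = 0 := by
  have h0 := (toHomogeneousExp hde).coeff_zero (m := m) hf
  rw [HomogeneousExp.IsConst, toHomogeneousExp_ψ hde hf]
  rw [toHomogeneousExp_ψ hde hf] at h0
  constructor
  · rintro ⟨-, h⟩ i hi
    rw [op_mono_eq_zero_iff hde hf, h, coeff_C, if_neg (by omega)]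
  · intro h
    refine ⟨hf, ?_⟩
    ext i
    rw [coeff_C]
    split_ifs with hi
    · rw [hi, h0]
    · exact (op_mono_eq_zero_iff hde hf i).1 (h i (by omega))

lemma mem_kernel_iff (a : D.algebra) : a ∈ d.kernel ↔
    ∀ m, (toHomogeneousExp hde).IsConst m ((a : AddMonoidAlgebra C.K M).coeff m) := by
  classical
  have hsum : a = ∑ m ∈ (a : AddMonoidAlgebra C.K M).coeff.support,
      D.mono m ((a : AddMonoidAlgebra C.K M).coeff m) (a.2 m) := by
    apply Subtype.ext
    rw [AddSubmonoidClass.coe_finsetSum]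
    exact (AddMonoidAlgebra.sum_coeff_single (a : AddMonoidAlgebra C.K M)).symm
  have hk : a ∈ d.kernel ↔ ∀ i ≥ 1, d.op i a = 0 := by
    simp [kernel, Submodule.mem_iInf]
  rw [hk]
  constructor
  · intro h m
    rw [isConst_iff hde (a.2 m)]
    intro i hi
    refine (hde i m _ (isHomogeneousElem_mono (a.2 m))).ext (b := 0) (fun m' _ => rfl) ?_
    rw [(hde i m _ (isHomogeneousElem_mono (a.2 m))).augmentation_eq]
    have h1 := congrArg (fun b : D.algebra => (b : AddMonoidAlgebra C.K M).coeff (m + i • e)) (h i hi)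
    simp only [ZeroMemClass.coe_zero, AddMonoidAlgebra.coeff_zero, Finsupp.coe_zero, Pi.zero_apply] at h1 ⊢
    rw [hsum, map_sum, AddSubmonoidClass.coe_finsetSum, AddMonoidAlgebra.coeff_sum,
      Finsupp.finsetSum_apply] at h1
    rw [map_zero]
    by_cases hm : m ∈ (a : AddMonoidAlgebra C.K M).coeff.support
    · rwa [Finset.sum_eq_single_of_mem m hm] at h1
      intro m' _ hm'
      exact hde i m' _ (isHomogeneousElem_mono (a.2 m')) _ (by simpa using hm'.symm)
    · have h2 : (a : AddMonoidAlgebra C.K M).coeff m = 0 := by simpa using hm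
      have h3 : D.mono m ((a : AddMonoidAlgebra C.K M).coeff m) (a.2 m) = 0 := by
        apply Subtype.ext
        rw [coe_mono, h2]
        exact AddMonoidAlgebra.single_zero _
      rw [h3, map_zero]
      rfl
  · intro h i hi
    rw [hsum, map_sum]
    exact Finset.sum_eq_zero fun m _ => (isConst_iff hde (a.2 m)).1 (h m) i hi

lemma map_kernel_eq_span :
    d.kernel.map D.algebra.val.toLinearMap = Submodule.span k
      {a | ∃ m f, (toHomogeneousExp hde).IsConst m f ∧ a = AddMonoidAlgebra.single m f} := by
  classical
  apply le_antisymm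
  · rintro _ ⟨a, ha, rfl⟩
    have ha' := (mem_kernel_iff hde a).1 ha
    rw [AlgHom.toLinearMap_apply, Subalgebra.coe_val,
      ← AddMonoidAlgebra.sum_coeff_single (a : AddMonoidAlgebra C.K M)]
    exact Submodule.sum_mem _ fun m _ => Submodule.subset_span ⟨m, _, ha' m, rfl⟩
  · rw [Submodule.span_le]
    rintro _ ⟨m, f, hf, rfl⟩
    refine ⟨D.mono m f hf.1, (mem_kernel_iff hde _).2 fun m' => ?_, rfl⟩
    change (toHomogeneousExp hde).IsConst m' ((AddMonoidAlgebra.single m f).coeff m')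
    rw [AddMonoidAlgebra.coeff_single, Finsupp.single_apply]
    split_ifs with h
    · exact h ▸ hf
    · exact HomogeneousExp.IsConst.zero

end LFIHD

namespace PolyhedralDivisor

variable {k : Type u} [Field k] {C : RegularCurve k} {M : Type} [AddCommGroup M]
  {D : PolyhedralDivisor C M}

lemma coeff_coaction (a : AddMonoidAlgebra C.K M) (m : M) :
    (coaction a).coeff m = AddMonoidAlgebra.single m (a.coeff m) := by
  classical
  induction a using AddMonoidAlgebra.induction_linear with
  | zero => simp
  | add a b ha hb =>
    rw [map_add, AddMonoidAlgebra.coeff_add, AddMonoidAlgebra.coeff_add, Finsupp.add_apply,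
      Finsupp.add_apply, ha, hb, AddMonoidAlgebra.single_add]
  | single n f =>
    rw [coaction, AddMonoidAlgebra.lift_single, AddMonoidAlgebra.coeff_single,
      Finsupp.single_apply]
    change (f • AddMonoidAlgebra.single n (AddMonoidAlgebra.single n (1 : C.K))).coeff m = _
    rw [AddMonoidAlgebra.smul_single, AddMonoidAlgebra.smul_single, AddMonoidAlgebra.coeff_single,
      Finsupp.single_apply]
    split_ifs with h
    · rw [h]; simp
    · simp

/-- An invariant rational function is a quotient of homogeneous elements of the same degree. -/
lemma IsInvariant.exists_mono [IsDomain D.algebra] {f : D.functionField} (hf : D.IsInvariant f) :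
    ∃ (m : M) (a b : C.K) (ha : a ∈ D.piece m) (hb : b ∈ D.piece m), b ≠ 0 ∧
      f * algebraMap D.algebra D.functionField (D.mono m b hb) =
        algebraMap D.algebra D.functionField (D.mono m a ha) := by
  classical
  obtain ⟨a, b, hb0, hfab, hco⟩ := hf
  have hb1 : (b : AddMonoidAlgebra C.K M).coeff ≠ 0 := by
    intro h
    exact hb0 (Subtype.ext (AddMonoidAlgebra.ext h))
  obtain ⟨m, hm⟩ := Finsupp.ne_iff.1 hb1
  refine ⟨m, _, _, a.2 m, b.2 m, by simpa using hm, ?_⟩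
  have h1 := congrArg (fun c => AddMonoidAlgebra.coeff c m) hco
  simp only [AddMonoidAlgebra.coeff_mul_single_zero, coeff_coaction] at h1
  have h2 : D.mono m _ (a.2 m) * b = D.mono m _ (b.2 m) * a := Subtype.ext h1
  have hb2 : algebraMap D.algebra D.functionField b ≠ 0 := fun h =>
    hb0 (IsFractionRing.injective D.algebra D.functionField (h.trans (map_zero _).symm))
  refine mul_right_cancel₀ hb2 ?_
  rw [← map_mul, h2, map_mul, ← hfab]
  ring

end PolyhedralDivisor

namespace LFIHD

open Polynomial PolyhedralDivisor

variable {k : Type u} [Field k] {C : RegularCurve k} {M : Type} [AddCommGroup M]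
  {D : PolyhedralDivisor C M} {d : LFIHD k D.algebra}
  {e : M} (hde : d.IsHomogeneousOfDegree e)

lemma IsHorizontal.toHomogeneousExp [IsDomain D.algebra] (hd : d.IsHorizontal) :
    (toHomogeneousExp hde).IsHorizontal := by
  obtain ⟨d', hd', j, hj, f, hf, hjf⟩ := hd
  obtain ⟨m, a, b, ha, hb, hb0, hfab⟩ := hf.exists_mono
  by_contra hcon
  simp only [HomogeneousExp.IsHorizontal, not_exists, not_and, not_not] at hcon
  have h1 := hcon m a b ha hb
  rw [toHomogeneousExp_ψ hde ha, toHomogeneousExp_ψ hde hb] at h1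
  have h2 : ∀ i, d.op i (D.mono m a ha) * D.mono m b hb =
      d.op i (D.mono m b hb) * D.mono m a ha := by
    intro i
    refine ((hde i m _ (isHomogeneousElem_mono ha)).mul (isHomogeneousElem_mono hb)).ext
      ((hde i m _ (isHomogeneousElem_mono hb)).mul (isHomogeneousElem_mono ha)) ?_
    have h3 := congrArg (fun P => P.coeff i) h1
    simp only [coeff_mul_C, coeff_augExp] at h3
    rw [MulMemClass.coe_mul, MulMemClass.coe_mul, map_mul, map_mul, coe_mono hb, coe_mono ha,
      augmentation_single, augmentation_single]
    exact h3
  have hbne : algebraMap D.algebra D.functionField (D.mono m b hb) ≠ 0 := by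
    have h4 : D.mono m b hb ≠ 0 := by
      intro h
      have h5 := congrArg (fun c : D.algebra => augmentation C M c) h
      simp only [coe_mono, augmentation_single] at h5
      exact hb0 (by simpa using h5)
    exact fun h => h4 (IsFractionRing.injective D.algebra D.functionField (h.trans (map_zero _).symm))
  have h3 : ∀ i, algebraMap D.algebra D.functionField (d.op i (D.mono m a ha)) =
      algebraMap D.algebra D.functionField (d.op i (D.mono m b hb)) * f := by
    intro i
    refine mul_right_cancel₀ hbne ?_
    rw [← map_mul, h2, map_mul, ← hfab]
    ring
  have h4 : ∀ i > 0, d'.op i f = 0 := by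
    intro i
    induction i using Nat.strong_induction_on with
    | _ i ih =>
      intro hi
      have h5 := congrArg (d'.op i) hfab
      rw [d'.leibniz, hd', h3] at h5
      obtain ⟨i, rfl⟩ : ∃ i', i = i' + 1 := ⟨i - 1, by omega⟩
      rw [Finset.Nat.sum_antidiagonal_eq_sum_range_succ_mk, Finset.sum_range_succ,
        Finset.sum_range_succ'] at h5
      rw [Finset.sum_eq_zero] at h5
      · simp only [d'.op_zero, LinearMap.id_coe, id_eq, Nat.sub_self, hd', tsub_zero, zero_add] at h5
        have h6 : d'.op (i + 1) f * algebraMap D.algebra D.functionField (D.mono m b hb) = 0 := by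
          linear_combination h5
        exact (mul_eq_zero.1 h6).resolve_right hbne
      · intro l hl
        rw [Finset.mem_range] at hl
        rw [ih (l + 1) (by omega) (by omega), zero_mul]
  exact hjf (h4 j hj)

end LFIHD

namespace RegularCurve

variable {k : Type u} [Field k] (C : RegularCurve k)

lemma krullDim_eq_one : Order.krullDim C.X = 1 := by
  rw [← C.dim_eq_one]
  exact (Order.krullDim_eq_of_orderIso irreducibleSetEquivPoints).symm

lemma coheight_le_one (x : C.X) : Order.coheight x ≤ 1 := by
  have h := Order.coheight_le_krullDim x
  rw [C.krullDim_eq_one] at h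
  exact_mod_cast h

lemma genericPoint_specializes (x : C.X) : genericPoint C.X ⤳ x :=
  _root_.genericPoint_specializes x

lemma le_genericPoint (x : C.X) : x ≤ genericPoint C.X := C.genericPoint_specializes x

lemma genericPoint_not_isClosed : ¬ IsClosed ({genericPoint C.X} : Set C.X) := by
  intro h
  have hx : ∀ x : C.X, x = genericPoint C.X := fun x =>
    (C.genericPoint_specializes x).mem_closed h rfl
  have : Subsingleton C.X := ⟨fun a b => (hx a).trans (hx b).symm⟩
  have h0 : Order.krullDim C.X ≤ 0 := Order.krullDim_nonpos_iff_forall_isMax.2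
    fun x y _ => (Subsingleton.elim y x).le
  rw [C.krullDim_eq_one] at h0
  exact absurd h0 (by decide)

lemma coheight_eq_one_of_ne {x : C.X} (hx : x ≠ genericPoint C.X) : Order.coheight x = 1 := by
  refine le_antisymm (C.coheight_le_one x) (Order.one_le_iff_pos.2 (Order.coheight_pos.2 ?_))
  intro hmax
  exact hx (Specializes.antisymm (hmax (C.le_genericPoint x)) (C.genericPoint_specializes x)).eq

lemma isClosed_of_ne {x : C.X} (hx : x ≠ genericPoint C.X) : IsClosed ({x} : Set C.X) := by
  rw [← closure_subset_iff_isClosed]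
  intro z hz
  have hzx : z ≤ x := specializes_iff_mem_closure.2 hz
  by_contra hne
  have hlt : z < x := lt_of_le_not_ge hzx fun h => hne (Specializes.antisymm h hzx).eq
  have h1 := Order.coheight_add_one_le hlt
  rw [C.coheight_eq_one_of_ne hx] at h1
  have h2 := h1.trans (C.coheight_le_one z)
  exact absurd h2 (by decide)

lemma ClosedPoint.ne_genericPoint {C : RegularCurve k} (y : C.ClosedPoint) :
    y.1 ≠ genericPoint C.X :=
  fun h => C.genericPoint_not_isClosed (h ▸ y.2)

lemma ClosedPoint.coheight {C : RegularCurve k} (y : C.ClosedPoint) : Order.coheight y.1 = 1 :=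
  C.coheight_eq_one_of_ne y.ne_genericPoint

lemma isDiscreteValuationRing_stalk {x : C.X} (hx : Order.coheight x = 1) :
    IsDiscreteValuationRing (C.X.presheaf.stalk x) := by
  have hreg := C.regular x
  have hdim : ringKrullDim (C.X.presheaf.stalk x) = 1 := by
    rw [ringKrullDim_stalk_eq_coheight, hx]; rfl
  have hnf : ¬ IsField (C.X.presheaf.stalk x) := fun h => by
    rw [ringKrullDim_eq_zero_of_isField h] at hdim
    exact zero_ne_one hdim
  refine ((IsDiscreteValuationRing.TFAE _ hnf).out 0 5).2 ?_
  have h := (IsRegularLocalRing.iff_finrank_cotangentSpace _).1 hreg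
  rw [hdim] at h
  exact_mod_cast h

instance (y : C.ClosedPoint) : IsDiscreteValuationRing (C.X.presheaf.stalk y.1) :=
  C.isDiscreteValuationRing_stalk y.coheight

instance (x : C.X) : ValuationRing (C.X.presheaf.stalk x) := by
  by_cases hx : x = genericPoint C.X
  · subst hx
    exact inferInstanceAs (ValuationRing C.K)
  · have := C.isDiscreteValuationRing_stalk (C.coheight_eq_one_of_ne hx)
    infer_instance

lemma ord_algebraMap_nonneg (y : C.ClosedPoint) {f : C.X.presheaf.stalk y.1} (hf : f ≠ 0) :
    0 ≤ C.ord (algebraMap _ C.K f) y := by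
  have hf' : algebraMap _ C.K f ≠ 0 := by
    simpa using (IsFractionRing.injective (C.X.presheaf.stalk y.1) C.K).ne hf
  rw [ord, Scheme.le_ord_iff y.coheight hf']
  have : Ring.KrullDimLE 1 (C.X.presheaf.stalk y.1) := inferInstance
  exact Ring.ordFrac_ge_one_of_ne_zero (K := C.K) hf

lemma ord_algebraMap_eq_zero_iff (y : C.ClosedPoint) {f : C.X.presheaf.stalk y.1} (hf : f ≠ 0) :
    C.ord (algebraMap _ C.K f) y = 0 ↔ IsUnit f := by
  have hf' : algebraMap _ C.K f ≠ 0 := by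
    simpa using (IsFractionRing.injective (C.X.presheaf.stalk y.1) C.K).ne hf
  rw [ord, Scheme.ord_eq_iff y.coheight hf',
    Ring.isUnit_iff_ordFrac_one_of_isDiscreteValuationRing (K := C.K)]
  rfl

lemma ord_algebraMap_pos_iff (y : C.ClosedPoint) {f : C.X.presheaf.stalk y.1} (hf : f ≠ 0) :
    0 < C.ord (algebraMap _ C.K f) y ↔ ¬ IsUnit f := by
  rw [← C.ord_algebraMap_eq_zero_iff y hf]
  have := C.ord_algebraMap_nonneg y hf
  omega

lemma ord_inv {f : C.K} (hf : f ≠ 0) (y : C.ClosedPoint) : C.ord f⁻¹ y = - C.ord f y := by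
  have h := C.ord_mul hf (inv_ne_zero hf) y
  rw [mul_inv_cancel₀ hf, ord_one] at h
  omega

lemma ord_pow {f : C.K} (hf : f ≠ 0) (n : ℕ) (y : C.ClosedPoint) :
    C.ord (f ^ n) y = n * C.ord f y := by
  induction n with
  | zero => simp [ord_one]
  | succ n ih => rw [pow_succ, C.ord_mul (pow_ne_zero _ hf) hf, ih]; push_cast; ring

lemma ord_nonneg_iff (y : C.ClosedPoint) {f : C.K} (hf : f ≠ 0) :
    0 ≤ C.ord f y ↔ f ∈ (algebraMap (C.X.presheaf.stalk y.1) C.K).range := by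
  constructor
  · intro h
    rcases ValuationRing.isInteger_or_isInteger (C.X.presheaf.stalk y.1) f with ⟨a, ha⟩ | ⟨a, ha⟩
    · exact ⟨a, ha⟩
    · have ha0 : a ≠ 0 := by
        rintro rfl
        rw [map_zero] at ha
        exact hf (inv_eq_zero.1 ha.symm)
      have h2 := C.ord_algebraMap_nonneg y ha0
      have h4 := h2
      rw [ha, C.ord_inv hf] at h2
      have h3 : C.ord (algebraMap _ C.K a) y = 0 := by
        rw [ha, C.ord_inv hf]; omega
      obtain ⟨b, hb⟩ := (C.ord_algebraMap_eq_zero_iff y ha0).1 h3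
      refine ⟨(b⁻¹ : _ˣ), ?_⟩
      rw [← inv_inv f, ← ha, ← hb]
      refine eq_inv_of_mul_eq_one_left ?_
      rw [← map_mul, Units.inv_mul, map_one]
  · rintro ⟨a, rfl⟩
    exact C.ord_algebraMap_nonneg y (by rintro rfl; simp at hf)

lemma exists_ord_pos (y : C.ClosedPoint) : ∃ f : C.K, f ≠ 0 ∧ 0 < C.ord f y := by
  obtain ⟨p, hp⟩ := IsDiscreteValuationRing.exists_irreducible (C.X.presheaf.stalk y.1)
  refine ⟨algebraMap _ C.K p, ?_, (C.ord_algebraMap_pos_iff y hp.ne_zero).2 hp.not_isUnit⟩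
  simpa using (IsFractionRing.injective (C.X.presheaf.stalk y.1) C.K).ne hp.ne_zero

lemma ord_smul_eq {a : k} (ha : a ≠ 0) (f : C.K) (y : C.ClosedPoint) :
    C.ord (a • f) y = C.ord f y := by
  refine le_antisymm ?_ (C.ord_smul a ha y)
  have h := C.ord_smul a⁻¹ (f := a • f) (inv_ne_zero ha) y
  rwa [inv_smul_smul₀ ha] at h

lemma ord_const {a : k} (ha : a ≠ 0) (y : C.ClosedPoint) : C.ord (algebraMap k C.K a) y = 0 := by
  rw [Algebra.algebraMap_eq_smul_one, C.ord_smul_eq ha, ord_one]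

lemma ord_germ_nonneg {U : C.X.Opens} [Nonempty U] {f : Γ(C.X, U)} (hf : f ≠ 0)
    (y : C.ClosedPoint) (hy : y.1 ∈ U) : 0 ≤ C.ord (C.X.germToFunctionField U f) y := by
  rw [← Scheme.algebraMap_germ_eq_germToFunctionField _ hy]
  refine C.ord_algebraMap_nonneg y ?_
  simpa using (germ_injective_of_isIntegral C.X y.1 hy).ne hf

instance : CompactSpace C.X := by
  have := C.quasiCompact
  exact QuasiCompact.compactSpace_of_compactSpace C.s

instance : IsNoetherian C.X where

lemma finite_of_isClosed {Z : Set C.X} (hZ : IsClosed Z) (hη : genericPoint C.X ∉ Z) :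
    Z.Finite := by
  obtain ⟨S, hS, hSc, hSirr, rfl⟩ :=
    TopologicalSpace.NoetherianSpace.exists_finite_set_isClosed_irreducible hZ
  refine Set.Finite.sUnion hS fun t ht => ?_
  obtain ⟨x, hx⟩ := QuasiSober.sober (hSirr t ht) (hSc t ht)
  have hxt : x ∈ t := hx.mem
  have hxη : x ≠ genericPoint C.X := fun h => hη ⟨t, ht, h ▸ hxt⟩
  rw [← hx.def, (C.isClosed_of_ne hxη).closure_eq]
  exact Set.finite_singleton x

lemma finite_ord_ne_zero {f : C.K} (hf : f ≠ 0) : {y | C.ord f y ≠ 0}.Finite := by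
  obtain ⟨U, -, f', hU, rfl, hf'⟩ := exists_isUnit_germ_eq C.X f hf
  have hη : genericPoint C.X ∈ U :=
    ((genericPoint_spec C.X).mem_open_set_iff U.isOpen).mpr (by simpa using hU)
  have hfin := C.finite_of_isClosed (Z := (U : Set C.X)ᶜ) U.isOpen.isClosed_compl
    (fun h => h hη)
  refine Set.Finite.of_finite_image (hfin.subset ?_) Subtype.val_injective.injOn
  rintro _ ⟨y, hy, rfl⟩ hyU
  exact hy (Scheme.ord_of_isUnit hf' hyU)

end RegularCurve

open Algebra in
/-- The fraction field of an affine domain of dimension at most one over a field has transcendence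
degree at most one. -/
lemma Algebra.trdeg_le_one_of_krullDimLE_one {k : Type*} {R K : Type u} [Field k] [CommRing R]
    [IsDomain R] [Algebra k R] [Algebra.FiniteType k R] [Ring.KrullDimLE 1 R] [Field K]
    [Algebra k K] [Algebra R K] [IsScalarTower k R K] [IsFractionRing R K] :
    Algebra.trdeg k K ≤ 1 := by
  obtain ⟨s, g, hg, hgi⟩ := exists_integral_inj_algHom_of_fg k R
  let : Algebra (MvPolynomial (Fin s) k) R := g.toRingHom.toAlgebra
  let : Algebra (MvPolynomial (Fin s) k) K := ((algebraMap R K).comp g.toRingHom).toAlgebra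
  have : IsScalarTower (MvPolynomial (Fin s) k) R K := .of_algebraMap_eq fun _ => rfl
  have : IsScalarTower k (MvPolynomial (Fin s) k) R :=
    .of_algebraMap_eq fun x => (g.commutes x).symm
  have : IsScalarTower k (MvPolynomial (Fin s) k) K := .of_algebraMap_eq fun x => by
    change _ = algebraMap R K (g _)
    rw [g.commutes, ← IsScalarTower.algebraMap_apply]
  have : Algebra.IsIntegral (MvPolynomial (Fin s) k) R := ⟨hgi⟩
  have hinj : Function.Injective (algebraMap (MvPolynomial (Fin s) k) R) := hg
  have : FaithfulSMul (MvPolynomial (Fin s) k) R :=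
    (faithfulSMul_iff_algebraMap_injective _ _).2 hg
  have : FaithfulSMul (MvPolynomial (Fin s) k) K :=
    (faithfulSMul_iff_algebraMap_injective _ _).2 ((IsFractionRing.injective R K).comp hg)
  have hs : s ≤ 1 := by
    have hdim : Ring.KrullDimLE 1 (MvPolynomial (Fin s) k) := by
      rw [Ring.krullDimLE_one_iff_of_noZeroDivisors]
      intro I hI hIp
      obtain ⟨Q, -, hQp, hQ⟩ := Ideal.exists_ideal_over_prime_of_isIntegral I (⊥ : Ideal R) (by
        rw [← RingHom.ker_eq_comap_bot, (RingHom.injective_iff_ker_eq_bot _).1 hinj]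
        exact bot_le)
      have hQ0 : Q ≠ ⊥ := by
        rintro rfl
        rw [← RingHom.ker_eq_comap_bot, (RingHom.injective_iff_ker_eq_bot _).1 hinj] at hQ
        exact hI hQ.symm
      have hQm := Ring.krullDimLE_one_iff_of_noZeroDivisors.1 ‹Ring.KrullDimLE 1 R› Q hQ0 hQp
      rw [← hQ]
      exact Ideal.isMaximal_comap_of_isIntegral_of_isMaximal Q
    have h1 := (Ring.krullDimLE_iff (n := 1) (R := MvPolynomial (Fin s) k)).1 hdim
    rw [MvPolynomial.ringKrullDim_of_isNoetherianRing, ringKrullDim_eq_zero_of_field, zero_add,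
      Nat.card_eq_fintype_card, Fintype.card_fin] at h1
    exact_mod_cast h1
  have : Algebra.IsAlgebraic R K := (IsFractionRing.comap_isAlgebraic_iff (K := K)).2 inferInstance
  have : Algebra.IsAlgebraic (MvPolynomial (Fin s) k) K :=
    Algebra.IsAlgebraic.trans (MvPolynomial (Fin s) k) R K
  have h2 := lift_trdeg_add_eq k (MvPolynomial (Fin s) k) K
  rw [MvPolynomial.trdeg_of_isDomain, trdeg_eq_zero (R := MvPolynomial (Fin s) k)] at h2
  simp only [Cardinal.mk_fin, Cardinal.lift_natCast, Cardinal.lift_zero, add_zero] at h2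
  have h3 : Cardinal.lift (Algebra.trdeg k K) ≤ 1 := by
    rw [← h2]
    exact_mod_cast hs
  exact Cardinal.lift_le_one_iff.1 h3

open Polynomial in
lemma exists_bivariate_eval_eq_zero {k K : Type*} [Field k] [Field K] [Algebra k K]
    (htr : Algebra.trdeg k K ≤ 1) {h : K} (hh : Transcendental k h) (w : K) :
    ∃ P : k[X][X], P ≠ 0 ∧ (P.map (aeval h : k[X] →ₐ[k] K).toRingHom).eval w = 0 := by
  have hind : AlgebraicIndependent k (fun _ : Unit => h) :=
    algebraicIndependent_unique_type_iff.2 hh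
  have hb : IsTranscendenceBasis k (fun _ : Unit => h) :=
    hind.isTranscendenceBasis_of_lift_trdeg_le_of_finite (by simpa using htr)
  have halg := hb.isAlgebraic
  obtain ⟨p, hp0, hp⟩ := halg.isAlgebraic w
  have hmem : ∀ a : Algebra.adjoin k (Set.range fun _ : Unit => h), ∃ q : k[X],
      aeval h q = (a : K) := by
    rintro ⟨a, ha⟩
    rw [Set.range_const, Algebra.adjoin_singleton_eq_range_aeval] at ha
    exact ha
  let S := Algebra.adjoin k (Set.range fun _ : Unit => h)
  have hhS : h ∈ S := Algebra.subset_adjoin ⟨(), rfl⟩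
  let f : k[X] →ₐ[k] S := aeval ⟨h, hhS⟩
  have hf : ∀ q, ((f q : S) : K) = aeval h q := fun q => by
    simp only [f]
    exact (aeval_algHom_apply S.val ⟨h, hhS⟩ q).symm
  have hfs : Function.Surjective f := fun a => by
    obtain ⟨q, hq⟩ := hmem a
    exact ⟨q, Subtype.ext ((hf q).trans hq)⟩
  obtain ⟨P, rfl⟩ := Polynomial.map_surjective f.toRingHom hfs p
  refine ⟨P, by rintro rfl; simp at hp0, ?_⟩
  rw [← hp, aeval_def, eval₂_eq_eval_map, Polynomial.map_map]
  congr 2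
  ext q
  · exact (hf _).symm
  · exact (hf _).symm

namespace RegularCurve

variable {k : Type u} [Field k] (C : RegularCurve k)

lemma trdeg_le_one : Algebra.trdeg k C.K ≤ 1 := by
  obtain ⟨_, ⟨U, hU, rfl⟩, hηU, -⟩ := C.X.isBasis_affineOpens.exists_subset_of_mem_open
    (Set.mem_univ (genericPoint C.X)) isOpen_univ
  have : Nonempty U := ⟨⟨_, hηU⟩⟩
  have := functionField_isFractionRing_of_isAffineOpen C.X U hU
  let f : k →+* Γ(C.X, U) := (C.X.presheaf.map (homOfLE le_top : U ⟶ ⊤).op).hom.comp C.globalConst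
  let : Algebra k Γ(C.X, U) := f.toAlgebra
  have : IsScalarTower k Γ(C.X, U) C.K := .of_algebraMap_eq fun a =>
    (TopCat.Presheaf.germ_res_apply C.X.presheaf (homOfLE le_top : U ⟶ ⊤) _ hηU
      (C.globalConst a)).symm
  have : Algebra.FiniteType k Γ(C.X, U) := by
    have h1 := C.locallyOfFiniteType
    have h2 := C.s.finiteType_appLE (U := ⊤) (isAffineOpen_top _) hU le_top
    refine (h2.comp (RingHom.FiniteType.of_surjective (Scheme.ΓSpecIso (.of k)).inv.hom ?_) :)
    exact (ConcreteCategory.bijective_of_isIso (Scheme.ΓSpecIso (.of k)).inv).2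
  have : Ring.KrullDimLE 1 Γ(C.X, U) := by
    rw [Ring.krullDimLE_iff, ← PrimeSpectrum.topologicalKrullDim_eq_ringKrullDim, Nat.cast_one,
      ← C.dim_eq_one]
    have := hU.isOpenImmersion_fromSpec
    exact hU.fromSpec.isOpenEmbedding.isInducing.topologicalKrullDim_le
  exact Algebra.trdeg_le_one_of_krullDimLE_one (k := k) (R := Γ(C.X, U))

end RegularCurve

namespace RegularCurve

variable {k : Type u} [Field k] (C : RegularCurve k)

/-- The rational functions of order at least `c` at a closed point. -/
noncomputable def ordGE (y : C.ClosedPoint) (c : ℚ) : Submodule k C.K where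
  carrier := {f | f ≠ 0 → c ≤ C.ord f y}
  zero_mem' h := absurd rfl h
  add_mem' {f g} hf hg hfg := by
    by_cases hf0 : f = 0
    · subst hf0
      rw [zero_add] at hfg ⊢
      exact hg hfg
    by_cases hg0 : g = 0
    · subst hg0
      rw [add_zero] at hfg ⊢
      exact hf hfg
    have h3 : ((min (C.ord f y) (C.ord g y) : ℤ) : ℚ) ≤ C.ord (f + g) y := by
      exact_mod_cast C.ord_add hfg y
    refine le_trans ?_ h3
    rw [Int.cast_min]
    exact le_min (hf hf0) (hg hg0)
  smul_mem' a f hf haf := by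
    have ha : a ≠ 0 := by rintro rfl; simp at haf
    have hf0 : f ≠ 0 := by rintro rfl; simp at haf
    rw [C.ord_smul_eq ha]
    exact hf hf0

open Polynomial in
/-- A polynomial in `u` has poles at most `deg` times those of `u`. -/
lemma aeval_mem_ordGE {u : C.K} {y : C.ClosedPoint} {c : ℚ} (hc : 0 ≤ c)
    (hu : u ≠ 0 → 0 ≤ c + C.ord u y) (p : k[X]) {N : ℕ} (hN : p.natDegree ≤ N) :
    aeval u p ∈ C.ordGE y (-(N * c)) := by
  rw [aeval_eq_sum_range]
  refine Submodule.sum_mem _ fun i hi => Submodule.smul_mem _ _ fun h0 => ?_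
  have hiN : (i : ℚ) ≤ N := by
    have := Finset.mem_range.1 hi
    exact_mod_cast (by omega : i ≤ N)
  have hi0 : (0 : ℚ) ≤ i := by positivity
  by_cases hu0 : u = 0
  · have : i = 0 := by
      by_contra hne
      exact h0 (by rw [hu0, zero_pow hne])
    subst this
    rw [pow_zero, C.ord_one, Int.cast_zero]
    have : 0 ≤ (N : ℚ) * c := by positivity
    linarith
  rw [C.ord_pow hu0]
  push_cast
  nlinarith [hu hu0, mul_le_mul_of_nonneg_right hiN hc, mul_nonneg hi0 (hu hu0)]

open Polynomial in
lemma mem_ordGE_of_isIntegral {u z : C.K} (hz : ∃ P : k[X][X], P.Monic ∧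
    (P.map (aeval u : k[X] →ₐ[k] C.K).toRingHom).eval z = 0) :
    ∃ N : ℕ, ∀ y : C.ClosedPoint, ∀ c : ℚ, 0 ≤ c → (u ≠ 0 → 0 ≤ c + C.ord u y) →
      z ∈ C.ordGE y (-(N * c)) := by
  obtain ⟨P, hP, hPz⟩ := hz
  refine ⟨∑ i ∈ Finset.range P.natDegree, (P.coeff i).natDegree, fun y c hc hu hz0 => ?_⟩
  set N := ∑ i ∈ Finset.range P.natDegree, (P.coeff i).natDegree with hN
  by_contra! hlt
  have hNc : 0 ≤ (N : ℚ) * c := by positivity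
  have hneg : (C.ord z y : ℚ) < 0 := by linarith
  rw [Polynomial.eval_map, eval₂_eq_sum_range, Finset.sum_range_succ, hP.coeff_natDegree, map_one, one_mul]
    at hPz
  have hmem : ∑ i ∈ Finset.range P.natDegree,
      (aeval u : k[X] →ₐ[k] C.K).toRingHom (P.coeff i) * z ^ i ∈
        C.ordGE y (P.natDegree * C.ord z y + 1) := by
    refine Submodule.sum_mem _ fun i hi hne => ?_
    have ha0 := left_ne_zero_of_mul hne
    have hz0' := right_ne_zero_of_mul hne
    have h1 := C.aeval_mem_ordGE hc hu (P.coeff i) (N := N)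
      (Finset.single_le_sum (f := fun i => (P.coeff i).natDegree) (fun _ _ => Nat.zero_le _) hi) ha0
    rw [C.ord_mul ha0 hz0', C.ord_pow hz0]
    have h2 : (C.ord z y : ℚ) < C.ord (aeval u (P.coeff i)) y := hlt.trans_le h1
    have h3 : C.ord z y + 1 ≤ C.ord (aeval u (P.coeff i)) y := by exact_mod_cast h2
    have h4 : i + 1 ≤ P.natDegree := Finset.mem_range.1 hi
    have h5 : C.ord z y < 0 := by exact_mod_cast hneg
    have h6 : (P.natDegree : ℤ) * C.ord z y ≤ (i + 1) * C.ord z y :=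
      mul_le_mul_of_nonpos_right (by exact_mod_cast h4) h5.le
    have h7 : (P.natDegree : ℤ) * C.ord z y + 1 ≤
      C.ord (aeval u (P.coeff i)) y + i * C.ord z y := by linarith
    exact_mod_cast h7
  rw [add_eq_zero_iff_eq_neg] at hPz
  rw [hPz] at hmem
  have h8 := (Submodule.neg_mem_iff _).1 hmem (pow_ne_zero _ hz0)
  rw [C.ord_pow hz0] at h8
  push_cast at h8
  linarith

end RegularCurve

lemma latticeToQ_nsmul {M : Type} [AddCommGroup M] (n : ℕ) (m : M) : latticeToQ (n • m) = n • latticeToQ m :=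
  TensorProduct.tmul_smul n (1 : ℚ) m

lemma latticeToQ_add {M : Type} [AddCommGroup M] (m m' : M) : latticeToQ (m + m') = latticeToQ m + latticeToQ m' :=
  TensorProduct.tmul_add _ _ _

namespace PolyhedralDivisor

variable {k : Type u} [Field k] {C : RegularCurve k} {M : Type} [AddCommGroup M]
  (D : PolyhedralDivisor C M)

lemma mem_piece_iff {m : M} {f : C.K} (hf : f ≠ 0) : f ∈ D.piece m ↔
    latticeToQ m ∈ dualCone D.σ ∧ ∀ y, 0 ≤ (C.ord f y : ℚ) + D.eval (latticeToQ m) y := by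
  by_cases hm : latticeToQ m ∈ dualCone D.σ
  · rw [piece, if_pos hm]
    have h : ∀ y, 0 ≤ C.ord f y + ⌊D.eval (latticeToQ m) y⌋ ↔
        0 ≤ (C.ord f y : ℚ) + D.eval (latticeToQ m) y := fun y => by
      rw [← Int.floor_intCast_add, Int.floor_nonneg]
    exact ⟨fun hfm => ⟨hm, fun y => (h y).1 (hfm hf y)⟩, fun hfm _ y => (h y).2 (hfm.2 y)⟩
  · simp [piece, hm, hf]

lemma nsmul_eval_le {m : LatticeQ M} (hm : m ∈ dualCone D.σ) (n : ℕ) (y : C.ClosedPoint) :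
    n * D.eval m y ≤ D.eval (n • m) y := by
  induction n with
  | zero => simp [D.eval_zero]
  | succ n ih =>
    have h := D.eval_add_le (nsmul_mem hm n) hm y
    rw [succ_nsmul]
    push_cast
    linarith

lemma eval_eq_zero_of_coeff_eq {m : LatticeQ M} (hm : m ∈ dualCone D.σ) {y : C.ClosedPoint}
    (hy : D.coeff y = D.σ) : D.eval m y = 0 := by
  have h := D.isLeast_eval hm y
  rw [hy] at h
  refine le_antisymm (h.2 ⟨0, D.σ.zero_mem, rfl⟩) ?_
  obtain ⟨v, hv, hvm⟩ := h.1
  rw [← hvm]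
  exact hm hv

end PolyhedralDivisor

namespace HomogeneousExp.IsKernelData

open Polynomial

variable {k : Type u} [Field k] {C : RegularCurve k} {M : Type} [AddCommGroup M]
  {D : PolyhedralDivisor C M} {E : HomogeneousExp k C.K M} {L : AddSubgroup M} {φ : M → C.Kˣ}
  {u : C.K} {r : ℕ}

lemma map_zero (h : E.IsKernelData L φ u r) : φ 0 = 1 := by
  have h0 := h.map_add 0 L.zero_mem 0 L.zero_mem
  rw [add_zero] at h0
  exact left_eq_mul.1 h0

lemma map_nsmul (h : E.IsKernelData L φ u r) {m : M} (hm : m ∈ L) (n : ℕ) :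
    φ (n • m) = φ m ^ n := by
  induction n with
  | zero => simp [h.map_zero]
  | succ n ih => rw [succ_nsmul, h.map_add _ (L.nsmul_mem hm n) _ hm, ih, pow_succ]

/-- The bound on the poles of `u` given by a degree `s` with `φ_s, u φ_s` in the graded algebra. -/
structure IsPoleBound (D : PolyhedralDivisor C M) (L : AddSubgroup M) (φ : M → C.Kˣ) (u : C.K)
    (s : M) (b : C.ClosedPoint → ℚ) : Prop where
  mem : s ∈ L
  mem_dualCone : latticeToQ s ∈ dualCone D.σ
  eq : ∀ y, b y = C.ord (φ s : C.K) y + D.eval (latticeToQ s) y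
  nonneg : ∀ y, 0 ≤ b y
  nonneg_add : ∀ y, 0 ≤ b y + C.ord u y

lemma ne_zero (h : E.IsKernelData L φ u r) : u ≠ 0 := by
  rintro rfl
  exact h.transcendental isAlgebraic_zero

lemma exists_isPoleBound (h : E.IsKernelData L φ u r) (hA : ∀ m, E.A m = D.piece m) :
    ∃ s b, IsPoleBound D L φ u s b := by
  obtain ⟨s, hs, h1, h2⟩ := h.exists_mem
  rw [hA, D.mem_piece_iff (φ s).ne_zero] at h1
  rw [hA, D.mem_piece_iff (mul_ne_zero h.ne_zero (φ s).ne_zero)] at h2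
  refine ⟨s, _, hs, h1.1, fun y => rfl, h1.2, fun y => ?_⟩
  have := h2.2 y
  rw [C.ord_mul h.ne_zero (φ s).ne_zero] at this
  push_cast at this
  linarith

/-- A rational function whose poles are bounded by those of powers of `u` is a polynomial
in `u`. -/
lemma exists_eq_aeval_of_ordGE (h : E.IsKernelData L φ u r) (hA : ∀ m, E.A m = D.piece m) {s : M}
    {b : C.ClosedPoint → ℚ} (hb : IsPoleBound D L φ u s b) {z : C.K} {N : ℕ}
    (hz : ∀ y, z ∈ C.ordGE y (-(N * b y))) : ∃ p : k[X], z = aeval u p := by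
  by_cases hz0 : z = 0
  · exact ⟨0, by rw [hz0, _root_.map_zero]⟩
  have hmem : (φ (N • s) : C.K) * z ∈ E.A (N • s) := by
    rw [hA, D.mem_piece_iff (mul_ne_zero (φ _).ne_zero hz0), latticeToQ_nsmul]
    refine ⟨nsmul_mem hb.mem_dualCone N, fun y => ?_⟩
    have h1 := hz y hz0
    have h2 := D.nsmul_eval_le hb.mem_dualCone N y
    rw [C.ord_mul (φ _).ne_zero hz0, h.map_nsmul hb.mem, Units.val_pow_eq_pow_val,
      C.ord_pow (φ s).ne_zero]
    rw [hb.eq] at h1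
    push_cast
    linarith
  obtain ⟨p, hp⟩ := h.mem_eq _ (L.nsmul_mem hb.mem N) _ hmem
  exact ⟨p, mul_left_cancel₀ (φ (N • s)).ne_zero hp⟩

lemma exists_eq_aeval_of_isIntegral (h : E.IsKernelData L φ u r)
    (hA : ∀ m, E.A m = D.piece m) {z : C.K} (hz : ∃ P : k[X][X], P.Monic ∧
      (P.map (aeval u : k[X] →ₐ[k] C.K).toRingHom).eval z = 0) : ∃ p : k[X], z = aeval u p := by
  obtain ⟨s, b, hb⟩ := h.exists_isPoleBound hA
  obtain ⟨N, hN⟩ := C.mem_ordGE_of_isIntegral hz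
  exact h.exists_eq_aeval_of_ordGE hA hb fun y => hN y _ (hb.nonneg y) fun _ => hb.nonneg_add y

/-- The function field is generated by `u`. -/
lemma exists_mul_aeval_eq (h : E.IsKernelData L φ u r) (hA : ∀ m, E.A m = D.piece m) (w : C.K) :
    ∃ p q : k[X], q ≠ 0 ∧ w * aeval u q = aeval u p := by
  obtain ⟨P, hP0, hP⟩ := exists_bivariate_eval_eq_zero C.trdeg_le_one h.transcendental w
  let _ : Algebra k[X] C.K := (aeval u : k[X] →ₐ[k] C.K).toRingHom.toAlgebra
  have hint : IsIntegral k[X] (P.leadingCoeff • w) :=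
    isIntegral_leadingCoeff_smul P w (by rw [aeval_def, eval₂_eq_eval_map]; exact hP)
  obtain ⟨Q, hQ, hQz⟩ := hint
  obtain ⟨p, hp⟩ := h.exists_eq_aeval_of_isIntegral hA ⟨Q, hQ, by rw [Polynomial.eval_map]; exact hQz⟩
  refine ⟨p, P.leadingCoeff, leadingCoeff_ne_zero.2 hP0, ?_⟩
  rw [← hp, mul_comm, Algebra.smul_def]
  rfl

lemma aeval_ne_zero (h : E.IsKernelData L φ u r) {p : k[X]} (hp : p ≠ 0) : aeval u p ≠ 0 :=
  fun h0 => hp ((transcendental_iff.1 h.transcendental) p h0)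

lemma exists_polynomial_ord_ge (h : E.IsKernelData L φ u r) (hA : ∀ m, E.A m = D.piece m) {s : M}
    {b : C.ClosedPoint → ℚ} (hb : IsPoleBound D L φ u s b) (c : ℕ) (T : Finset C.ClosedPoint) :
    ∃ (G : k[X]) (n : ℕ), G ≠ 0 ∧ (∀ y, 0 ≤ C.ord (aeval u G) y + n * b y) ∧
      ∀ y ∈ T, c ≤ C.ord (aeval u G) y + n * b y := by
  have hpoly : ∀ (G : k[X]), G ≠ 0 → ∀ y, 0 ≤ C.ord (aeval u G) y + G.natDegree * b y :=
    fun G hG y => by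
      have := C.aeval_mem_ordGE (hb.nonneg y) (fun _ => hb.nonneg_add y) G le_rfl
        (h.aeval_ne_zero hG)
      linarith
  have hpt : ∀ y₀, ∃ (G : k[X]) (n : ℕ), G ≠ 0 ∧ (∀ y, 0 ≤ C.ord (aeval u G) y + n * b y) ∧
      c ≤ C.ord (aeval u G) y₀ + n * b y₀ := by
    intro y₀
    rcases (hb.nonneg y₀).eq_or_lt with h0 | hpos
    · obtain ⟨f, hf0, hf⟩ := C.exists_ord_pos y₀
      obtain ⟨p, q, hq, hpq⟩ := h.exists_mul_aeval_eq hA f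
      have hq0 := h.aeval_ne_zero hq
      have hp : p ≠ 0 := by
        rintro rfl
        rw [_root_.map_zero] at hpq
        exact mul_ne_zero hf0 hq0 hpq
      have h1 : 1 ≤ C.ord (aeval u p) y₀ := by
        have h2 := hpoly q hq y₀
        rw [← h0, mul_zero, add_zero] at h2
        have h3 : 0 ≤ C.ord (aeval u q) y₀ := by exact_mod_cast h2
        rw [← hpq, C.ord_mul hf0 hq0]
        omega
      refine ⟨p ^ c, (p ^ c).natDegree, pow_ne_zero _ hp, hpoly _ (pow_ne_zero _ hp), ?_⟩
      rw [← h0, mul_zero, add_zero, map_pow, C.ord_pow (h.aeval_ne_zero hp)]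
      have h4 : (c : ℤ) ≤ c * C.ord (aeval u p) y₀ := le_mul_of_one_le_right (by positivity) h1
      exact_mod_cast h4
    · obtain ⟨n, hn⟩ := exists_nat_ge (c / b y₀)
      refine ⟨1, n, one_ne_zero, fun y => ?_, ?_⟩
      · rw [_root_.map_one, C.ord_one, Int.cast_zero, zero_add]
        exact mul_nonneg (by positivity) (hb.nonneg y)
      · rw [_root_.map_one, C.ord_one, Int.cast_zero, zero_add]
        exact (div_le_iff₀ hpos).1 hn
  classical
  induction T using Finset.induction_on with
  | empty => exact ⟨1, 0, one_ne_zero, fun y => by simp [C.ord_one], fun y hy => by simp at hy⟩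
  | insert y₀ T _ ih =>
    obtain ⟨G, n, hG, hG1, hG2⟩ := ih
    obtain ⟨G', n', hG', hG1', hG2'⟩ := hpt y₀
    have hord : ∀ y, (C.ord (aeval u (G * G')) y : ℚ) + (n + n' : ℕ) * b y =
        (C.ord (aeval u G) y + n * b y) + (C.ord (aeval u G') y + n' * b y) := fun y => by
      rw [_root_.map_mul, C.ord_mul (h.aeval_ne_zero hG) (h.aeval_ne_zero hG')]
      push_cast
      ring
    refine ⟨G * G', n + n', mul_ne_zero hG hG', fun y => ?_, fun y hy => ?_⟩
    · rw [hord]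
      exact add_nonneg (hG1 y) (hG1' y)
    · rw [hord]
      rcases Finset.mem_insert.1 hy with rfl | hy
      · linarith [hG1 y]
      · linarith [hG2 y hy, hG1' y]

lemma smul_mem_of_mem_dualCone (h : E.IsKernelData L φ u r) (hA : ∀ m, E.A m = D.piece m) {m : M}
    (hm : latticeToQ m ∈ dualCone D.σ) : r • m ∈ L := by
  obtain ⟨s, b, hb⟩ := h.exists_isPoleBound hA
  obtain ⟨c, hc⟩ : ∃ c : ℕ, ∀ y ∈ D.finite_coeff_ne.toFinset, -D.eval (latticeToQ m) y ≤ c := by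
    obtain ⟨c, hc⟩ :=
      exists_nat_ge (∑ y ∈ D.finite_coeff_ne.toFinset, |D.eval (latticeToQ m) y|)
    refine ⟨c, fun y hy => (neg_le_abs _).trans (le_trans ?_ hc)⟩
    exact Finset.single_le_sum (f := fun y => |D.eval (latticeToQ m) y|)
      (fun _ _ => abs_nonneg _) hy
  obtain ⟨G, n, hG, hG1, hG2⟩ := h.exists_polynomial_ord_ge hA hb c D.finite_coeff_ne.toFinset
  have hne : aeval u G * (φ (n • s) : C.K) ≠ 0 :=
    mul_ne_zero (h.aeval_ne_zero hG) (φ _).ne_zero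
  have hmem : aeval u G * (φ (n • s) : C.K) ∈ E.A (n • s + m) := by
    rw [hA, D.mem_piece_iff hne, latticeToQ_add, latticeToQ_nsmul]
    have hns := nsmul_mem hb.mem_dualCone n
    refine ⟨add_mem hns hm, fun y => ?_⟩
    have h1 := D.eval_add_le hns hm y
    have h2 := D.nsmul_eval_le hb.mem_dualCone n y
    rw [C.ord_mul (h.aeval_ne_zero hG) (φ _).ne_zero, h.map_nsmul hb.mem,
      Units.val_pow_eq_pow_val, C.ord_pow (φ s).ne_zero]
    have h3 : 0 ≤ (C.ord (aeval u G) y : ℚ) + n * b y + D.eval (latticeToQ m) y := by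
      by_cases hy : D.coeff y = D.σ
      · rw [D.eval_eq_zero_of_coeff_eq hm hy, add_zero]
        exact hG1 y
      · have hyT : y ∈ D.finite_coeff_ne.toFinset := by simpa using hy
        linarith [hG2 y hyT, hc y hyT]
    rw [hb.eq] at h3
    push_cast
    linarith
  have h4 := h.smul_mem _ _ hmem hne
  rw [smul_add] at h4
  exact (L.add_mem_cancel_left (L.nsmul_mem (L.nsmul_mem hb.mem n) r)).1 h4

end HomogeneousExp.IsKernelData

namespace PointedCone

variable {V : Type*} [AddCommGroup V] [Module ℚ V]

lemma fg_top [Module.Finite ℚ V] : (⊤ : PointedCone ℚ V).FG := by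
  classical
  let B := Module.finBasis ℚ V
  refine ⟨Finset.univ.image B ∪ Finset.univ.image (fun i => -B i), eq_top_iff.2 fun x _ => ?_⟩
  rw [← B.sum_repr x]
  refine Submodule.sum_mem _ fun i _ => ?_
  rcases le_total 0 (B.repr x i) with h | h
  · exact Submodule.smul_mem _ (⟨_, h⟩ : {c : ℚ // 0 ≤ c}) (Submodule.subset_span (by simp))
  · have h1 := Submodule.smul_mem (PointedCone.hull ℚ
      ((Finset.univ.image B ∪ Finset.univ.image (fun i => -B i) : Finset V) : Set V))
      (⟨-(B.repr x i), neg_nonneg.2 h⟩ : {c : ℚ // 0 ≤ c})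
      (Submodule.subset_span (a := -B i) (by simp))
    have h2 : B.repr x i • B i = (⟨-(B.repr x i), neg_nonneg.2 h⟩ : {c : ℚ // 0 ≤ c}) • (-B i) := by
      change _ = (-(B.repr x i)) • (-B i)
      rw [neg_smul_neg]
    rw [h2]
    exact h1

/-- The intersection of a finitely generated cone with a half-space is finitely generated. -/
lemma exists_fg_inf_halfspace {c : PointedCone ℚ V} (hc : c.FG) (l : Module.Dual ℚ V) :
    ∃ d : PointedCone ℚ V, d.FG ∧ ∀ x, x ∈ d ↔ x ∈ c ∧ 0 ≤ l x := by
  classical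
  obtain ⟨S, rfl⟩ := hc
  let P := S.filter fun a => 0 ≤ l a
  let N := S.filter fun a => l a < 0
  let G : Finset V := P ∪ (P ×ˢ N).image fun ab => l ab.1 • ab.2 - l ab.2 • ab.1
  let d : PointedCone ℚ V := PointedCone.hull ℚ (G : Set V)
  have smul_mem : ∀ (e : PointedCone ℚ V) {q : ℚ} (_ : 0 ≤ q) {x : V}, x ∈ e → q • x ∈ e :=
    fun e q hq x hx => Submodule.smul_mem e (⟨q, hq⟩ : {c : ℚ // 0 ≤ c}) hx
  have hPd : ∀ a ∈ P, a ∈ d := fun a ha =>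
    Submodule.subset_span (Finset.mem_coe.2 (Finset.mem_union_left _ ha))
  have hle : ∀ x ∈ d, x ∈ PointedCone.hull ℚ (S : Set V) ∧ 0 ≤ l x := by
    intro x hx
    induction hx using Submodule.span_induction with
    | mem x hx =>
      rcases Finset.mem_union.1 (Finset.mem_coe.1 hx) with hx | hx
      · have := Finset.mem_filter.1 hx
        exact ⟨Submodule.subset_span this.1, this.2⟩
      · obtain ⟨⟨a, b⟩, hab, rfl⟩ := Finset.mem_image.1 hx
        obtain ⟨ha, hb⟩ := Finset.mem_product.1 hab
        have ha' := Finset.mem_filter.1 ha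
        have hb' := Finset.mem_filter.1 hb
        constructor
        · rw [sub_eq_add_neg, ← neg_smul]
          exact add_mem (smul_mem _ ha'.2 (Submodule.subset_span hb'.1))
            (smul_mem _ (neg_nonneg.2 hb'.2.le) (Submodule.subset_span ha'.1))
        · simp only [map_sub, map_smul, smul_eq_mul]
          linarith [mul_comm (l a) (l b)]
    | zero => exact ⟨zero_mem _, by simp⟩
    | add x y _ _ hx hy => exact ⟨add_mem hx.1 hy.1, by rw [map_add]; exact add_nonneg hx.2 hy.2⟩
    | smul q x _ hx =>
      refine ⟨Submodule.smul_mem _ q hx.1, ?_⟩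
      change 0 ≤ l ((q : ℚ) • x)
      rw [map_smul]
      exact mul_nonneg q.2 hx.2
  have hP : ∀ p ∈ PointedCone.hull ℚ (P : Set V), p ∈ d ∧ 0 ≤ l p := by
    intro p hp
    have : p ∈ d := (Submodule.span_le.2 fun a ha => hPd a ha : PointedCone.hull ℚ (P : Set V) ≤ d) hp
    exact ⟨this, (hle p this).2⟩
  have hN : ∀ n ∈ PointedCone.hull ℚ (N : Set V), n = 0 ∨ l n < 0 := by
    intro n hn
    induction hn using Submodule.span_induction with
    | mem x hx => exact Or.inr (Finset.mem_filter.1 hx).2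
    | zero => exact Or.inl rfl
    | add x y _ _ hx hy =>
      rcases hx with rfl | hx
      · simpa using hy
      · rcases hy with rfl | hy
        · simpa using Or.inr hx
        · exact Or.inr (by rw [map_add]; exact add_neg hx hy)
    | smul q x _ hx =>
      rcases hx with rfl | hx
      · simp
      · rcases (show (0 : ℚ) ≤ q from q.2).eq_or_lt with h0 | h0
        · left
          change (q : ℚ) • x = 0
          rw [← h0, zero_smul]
        · right
          change l ((q : ℚ) • x) < 0
          rw [map_smul]
          exact mul_neg_of_pos_of_neg h0 hx
  have hPN : ∀ p ∈ PointedCone.hull ℚ (P : Set V), ∀ n ∈ PointedCone.hull ℚ (N : Set V),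
      l p • n - l n • p ∈ d := by
    intro p hp n hn
    induction hp using Submodule.span_induction with
    | mem a ha =>
      induction hn using Submodule.span_induction with
      | mem b hb =>
        refine Submodule.subset_span (Finset.mem_coe.2 (Finset.mem_union_right _ ?_))
        exact Finset.mem_image.2 ⟨(a, b), Finset.mem_product.2 ⟨ha, hb⟩, rfl⟩
      | zero => simp
      | add x y _ _ hx hy =>
        have : l a • (x + y) - l (x + y) • a = (l a • x - l x • a) + (l a • y - l y • a) := by
          rw [map_add]; module
        rw [this]
        exact add_mem hx hy
      | smul q x _ hx =>
        have : l a • (q • x) - l (q • x) • a = q • (l a • x - l x • a) := by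
          change l a • ((q : ℚ) • x) - l ((q : ℚ) • x) • a = (q : ℚ) • (l a • x - l x • a)
          rw [map_smul, smul_eq_mul]; module
        rw [this]
        exact Submodule.smul_mem _ q hx
    | zero => simp
    | add x y _ _ hx hy =>
      have : l (x + y) • n - l n • (x + y) = (l x • n - l n • x) + (l y • n - l n • y) := by
        rw [map_add]; module
      rw [this]
      exact add_mem hx hy
    | smul q x _ hx =>
      have : l (q • x) • n - l n • (q • x) = q • (l x • n - l n • x) := by
        change l ((q : ℚ) • x) • n - l n • ((q : ℚ) • x) = (q : ℚ) • (l x • n - l n • x)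
        rw [map_smul, smul_eq_mul]; module
      rw [this]
      exact Submodule.smul_mem _ q hx
  refine ⟨d, ⟨G, rfl⟩, fun x => ⟨hle x, fun ⟨hx, hlx⟩ => ?_⟩⟩
  have hS : S = P ∪ N := by
    ext a
    simp only [P, N, Finset.mem_union, Finset.mem_filter]
    have := le_or_gt 0 (l a)
    tauto
  have hx' : x ∈ PointedCone.hull ℚ (P : Set V) ⊔ PointedCone.hull ℚ (N : Set V) := by
    have h1 : x ∈ Submodule.span _ (S : Set V) := hx
    rwa [hS, Finset.coe_union, Submodule.span_union] at h1
  obtain ⟨p, hp, n, hn, rfl⟩ := Submodule.mem_sup.1 hx'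
  obtain ⟨hpd, hlp⟩ := hP p hp
  rw [map_add] at hlx
  rcases hlp.eq_or_lt with h0 | h0
  · rcases hN n hn with rfl | hneg
    · simpa using hpd
    · linarith
  · have h1 : l p • (p + n) ∈ d := by
      have : l p • (p + n) = (l p • n - l n • p) + (l p + l n) • p := by module
      rw [this]
      exact add_mem (hPN p hp n hn) (smul_mem d hlx hpd)
    have h2 := smul_mem d (inv_nonneg.2 hlp) h1
    rwa [inv_smul_smul₀ h0.ne'] at h2

/-- A cone given by finitely many linear inequalities is finitely generated. -/
lemma exists_fg_forall_mem_iff [Module.Finite ℚ V] (s : Finset (Module.Dual ℚ V)) :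
    ∃ d : PointedCone ℚ V, d.FG ∧ ∀ x, x ∈ d ↔ ∀ l ∈ s, 0 ≤ l x := by
  classical
  induction s using Finset.induction_on with
  | empty => exact ⟨⊤, fg_top, by simp⟩
  | insert l s _ ih =>
    obtain ⟨c, hc, hcs⟩ := ih
    obtain ⟨d, hd, hds⟩ := exists_fg_inf_halfspace hc l
    refine ⟨d, hd, fun x => ?_⟩
    rw [hds, hcs, Finset.forall_mem_insert, and_comm]

end PointedCone

lemma latticeToQ_injective {M : Type} [AddCommGroup M] [Module.Free ℤ M] :
    Function.Injective (latticeToQ : M → LatticeQ M) := by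
  let B := Module.Free.chooseBasis ℤ M
  intro m m' h
  apply B.repr.injective
  ext i
  have h1 := congrArg ((B.baseChange ℚ).repr) h
  have h2 := DFunLike.congr_fun h1 i
  simpa using h2

lemma exists_nsmul_eq_latticeToQ {M : Type} [AddCommGroup M] (x : LatticeQ M) :
    ∃ n : ℕ, 0 < n ∧ ∃ m : M, n • x = latticeToQ m := by
  induction x using TensorProduct.induction_on with
  | zero => exact ⟨1, one_pos, 0, by simp⟩
  | tmul q m =>
    refine ⟨q.den, q.den_pos, q.num • m, ?_⟩
    have h1 : latticeToQ (q.num • m) = (q.num • (1 : ℚ)) ⊗ₜ[ℤ] m :=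
      (TensorProduct.smul_tmul q.num (1 : ℚ) m).symm
    rw [h1, TensorProduct.smul_tmul', nsmul_eq_mul, Rat.den_mul_eq_num, zsmul_eq_mul, mul_one]
  | add x y hx hy =>
    obtain ⟨a, ha, m, hm⟩ := hx
    obtain ⟨b, hb, m', hm'⟩ := hy
    refine ⟨a * b, Nat.mul_pos ha hb, b • m + a • m', ?_⟩
    rw [latticeToQ_add, latticeToQ_nsmul, latticeToQ_nsmul, ← hm, ← hm']
    module

lemma LinearMap.nonneg_of_mem_convexHull_add {V : Type*} [AddCommGroup V] [Module ℚ V]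
    {P : Set V} {σ : Set V} {l : V →ₗ[ℚ] ℚ} {c : ℚ} (hP : ∀ v ∈ P, 0 ≤ c + l v)
    (hσ : ∀ v ∈ σ, 0 ≤ l v) {v : V} (hv : v ∈ convexHull ℚ P + σ) : 0 ≤ c + l v := by
  obtain ⟨a, ha, b, hb, rfl⟩ := hv
  have h1 : -c ≤ l a := by
    have hsub : convexHull ℚ P ⊆ {w | -c ≤ l w} :=
      convexHull_min (fun w hw => by have := hP w hw; simp only [Set.mem_ofPred_eq]; linarith)
        (convex_halfSpace_ge l.isLinear _)
    exact hsub ha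
  have h2 := hσ b hb
  rw [map_add]
  linarith

namespace HomogeneousExp.IsKernelData

open Polynomial

variable {k : Type u} [Field k] {C : RegularCurve k} {M : Type} [AddCommGroup M]
  {D : PolyhedralDivisor C M} {E : HomogeneousExp k C.K M} {L : AddSubgroup M} {φ : M → C.Kˣ}
  {u : C.K} {r : ℕ}

lemma exists_nsmul_mem [Module.Free ℤ M] (h : E.IsKernelData L φ u r)
    (hA : ∀ m, E.A m = D.piece m) (m : M) : ∃ n : ℕ, 0 < n ∧ n • m ∈ L := by
  have key : ∀ x : LatticeQ M, x ∈ Submodule.span ℚ (dualCone D.σ : Set (LatticeQ M)) →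
      ∃ n : ℕ, 0 < n ∧ ∃ l ∈ L, n • x = latticeToQ l := by
    intro x hx
    induction hx using Submodule.span_induction with
    | mem x hx =>
      obtain ⟨n, hn, m, hm⟩ := exists_nsmul_eq_latticeToQ x
      have hmc : latticeToQ m ∈ dualCone D.σ := hm ▸ nsmul_mem hx n
      refine ⟨r * n, Nat.mul_pos h.r_pos hn, r • m, h.smul_mem_of_mem_dualCone hA hmc, ?_⟩
      rw [latticeToQ_nsmul, ← hm, mul_smul]
    | zero => exact ⟨1, one_pos, 0, L.zero_mem, by simp⟩
    | add x y _ _ hx hy =>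
      obtain ⟨a, ha, m, hmL, hm⟩ := hx
      obtain ⟨b, hb, m', hmL', hm'⟩ := hy
      refine ⟨a * b, Nat.mul_pos ha hb, b • m + a • m',
        L.add_mem (L.nsmul_mem hmL b) (L.nsmul_mem hmL' a), ?_⟩
      rw [latticeToQ_add, latticeToQ_nsmul, latticeToQ_nsmul, ← hm, ← hm']
      module
    | smul q x _ hx =>
      obtain ⟨a, ha, m, hmL, hm⟩ := hx
      refine ⟨q.den * a, Nat.mul_pos q.den_pos ha, q.num • m, L.zsmul_mem hmL _, ?_⟩
      have h1 : latticeToQ (q.num • m) = (q.num : ℤ) • latticeToQ m :=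
        TensorProduct.tmul_smul q.num (1 : ℚ) m
      rw [h1, ← hm, ← Nat.cast_smul_eq_nsmul ℚ, ← Nat.cast_smul_eq_nsmul ℚ,
        ← Int.cast_smul_eq_zsmul ℚ, smul_smul, smul_smul]
      congr 1
      push_cast
      rw [mul_right_comm, Rat.den_mul_eq_num]
  obtain ⟨n, hn, l, hl, hnl⟩ := key (latticeToQ m) (by rw [D.dual_full]; trivial)
  refine ⟨n, hn, ?_⟩
  rw [← latticeToQ_nsmul] at hnl
  rwa [latticeToQ_injective hnl]

lemma finiteIndex [Module.Free ℤ M] [Module.Finite ℤ M] (h : E.IsKernelData L φ u r)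
    (hA : ∀ m, E.A m = D.piece m) : L.FiniteIndex := by
  have hfin : Finite (M ⧸ AddSubgroup.toIntSubmodule L) := by
    refine Module.finite_of_fg_torsion _ fun x => ?_
    obtain ⟨m, rfl⟩ := Submodule.Quotient.mk_surjective (AddSubgroup.toIntSubmodule L) x
    obtain ⟨n, hn, hm⟩ := h.exists_nsmul_mem hA m
    refine ⟨⟨(n : ℤ), mem_nonZeroDivisors_of_ne_zero (by exact_mod_cast hn.ne')⟩, ?_⟩
    change (n : ℤ) • Submodule.Quotient.mk (p := AddSubgroup.toIntSubmodule L) m = _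
    rw [← Submodule.Quotient.mk_smul, Submodule.Quotient.mk_eq_zero, natCast_zsmul]
    exact hm
  have : Finite (M ⧸ L) := hfin
  exact AddSubgroup.finiteIndex_of_finite_quotient

/-- The degrees in `L` at which `φ` is a regular function are the lattice points of a polyhedral
cone. -/
lemma exists_cone [Module.Free ℤ M] [Module.Finite ℤ M] (h : E.IsKernelData L φ u r)
    (hA : ∀ m, E.A m = D.piece m) : ∃ ω : PointedCone ℚ (LatticeQ M), ω.FG ∧
      ∀ m ∈ L, latticeToQ m ∈ ω ↔ (φ m : C.K) ∈ E.A m := by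
  classical
  have hL := h.finiteIndex hA
  set t := L.index with ht
  have ht0 : (t : ℚ) ≠ 0 := by exact_mod_cast hL.index_ne_zero
  have htL : ∀ m, t • m ∈ L := fun m => L.nsmul_index_mem m
  let ord' : C.ClosedPoint → M →ₗ[ℤ] ℚ := fun y =>
    (AddMonoidHom.mk' (fun m => (C.ord (φ (t • m) : C.K) y : ℚ) / t) fun a b => by
      rw [smul_add, h.map_add _ (htL a) _ (htL b), Units.val_mul,
        C.ord_mul (φ _).ne_zero (φ _).ne_zero]
      push_cast
      ring).toIntLinearMap
  let lam : C.ClosedPoint → DualLatticeQ M := fun y => (ord' y).liftBaseChange ℚ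
  have hlam : ∀ y, ∀ m ∈ L, lam y (latticeToQ m) = C.ord (φ m : C.K) y := fun y m hm => by
    simp only [lam, LinearMap.liftBaseChange_tmul, one_smul]
    change (C.ord (φ (t • m) : C.K) y : ℚ) / t = _
    rw [h.map_nsmul hm, Units.val_pow_eq_pow_val, C.ord_pow (φ m).ne_zero]
    push_cast
    rw [mul_div_cancel_left₀ _ ht0]
  let B := Module.Free.chooseBasis ℤ M
  have hfin : {y | lam y ≠ 0}.Finite := by
    refine (Set.finite_iUnion fun i => C.finite_ord_ne_zero (φ (t • B i)).ne_zero).subset ?_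
    intro y hy
    by_contra hne
    simp only [Set.mem_iUnion, Set.mem_ofPred_eq, not_exists, not_not] at hne
    apply hy
    have h0 : ord' y = 0 := B.ext fun i => by
      change (C.ord (φ (t • B i) : C.K) y : ℚ) / t = 0
      rw [hne i, Int.cast_zero, zero_div]
    simp [lam, h0]
  choose P hPne hP using D.coeff_eq
  obtain ⟨S, hS⟩ := D.σ_fg
  let T := D.finite_coeff_ne.toFinset ∪ hfin.toFinset
  let s : Finset (DualLatticeQ M) := S ∪ T.biUnion fun y => (P y).image fun v => lam y + v
  obtain ⟨ω, hω, hmem⟩ := PointedCone.exists_fg_forall_mem_iff s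
  refine ⟨ω, hω, fun m hm => ?_⟩
  rw [hmem, hA, D.mem_piece_iff (φ m).ne_zero]
  have hSσ : ∀ x : LatticeQ M, (∀ l ∈ S, 0 ≤ l x) ↔ x ∈ dualCone D.σ := fun x => by
    rw [← hS]
    change _ ↔ x ∈ PointedCone.dual _ ((PointedCone.hull ℚ (S : Set (DualLatticeQ M)) :
      PointedCone ℚ _) : Set (DualLatticeQ M))
    rw [PointedCone.dual_hull]
    rfl
  have hcond : ∀ x ∈ dualCone D.σ, ∀ y, x = latticeToQ m →
      ((∀ v ∈ P y, 0 ≤ lam y x + v x) ↔ 0 ≤ (C.ord (φ m : C.K) y : ℚ) + D.eval x y) := by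
    intro x hx y hxm
    have hl := D.isLeast_eval hx y
    rw [← hlam y m hm, ← hxm]
    constructor
    · intro hv
      obtain ⟨v, hvc, hvx⟩ := hl.1
      rw [← hvx]
      rw [hP y] at hvc
      exact LinearMap.nonneg_of_mem_convexHull_add (l := LinearMap.applyₗ x) hv (fun w hw => hx hw) hvc
    · intro h0 v hv
      have hvc : v ∈ D.coeff y := by
        rw [hP y]
        exact ⟨v, subset_convexHull ℚ _ hv, 0, D.σ.zero_mem, add_zero _⟩
      have := hl.2 ⟨v, hvc, rfl⟩
      simp only at this
      linarith
  constructor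
  · intro hs
    have hσ : latticeToQ m ∈ dualCone D.σ :=
      (hSσ _).1 fun l hl => hs l (Finset.mem_union_left _ hl)
    refine ⟨hσ, fun y => ?_⟩
    by_cases hy : y ∈ T
    · refine (hcond _ hσ y rfl).1 fun v hv => ?_
      exact hs (lam y + v) (Finset.mem_union_right _
        (Finset.mem_biUnion.2 ⟨y, hy, Finset.mem_image_of_mem _ hv⟩))
    · simp only [T, Finset.mem_union, Set.Finite.mem_toFinset, Set.mem_ofPred_eq, not_or,
        not_not] at hy
      rw [← hlam y m hm, hy.2, D.eval_eq_zero_of_coeff_eq hσ hy.1]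
      simp
  · rintro ⟨hσ, hord⟩ l hl
    rcases Finset.mem_union.1 hl with hl | hl
    · exact (hSσ _).2 hσ l hl
    · obtain ⟨y, -, hl⟩ := Finset.mem_biUnion.1 hl
      obtain ⟨v, hv, rfl⟩ := Finset.mem_image.1 hl
      exact (hcond _ hσ y rfl).2 (hord y) v hv

lemma span_eq_top [Module.Free ℤ M] (h : E.IsKernelData L φ u r)
    (hA : ∀ m, E.A m = D.piece m) {ω : PointedCone ℚ (LatticeQ M)}
    (hω : ∀ m ∈ L, latticeToQ m ∈ ω ↔ (φ m : C.K) ∈ E.A m) :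
    Submodule.span ℚ (ω : Set (LatticeQ M)) = ⊤ := by
  rw [eq_top_iff]
  intro x _
  obtain ⟨n, hn, m, hm⟩ := exists_nsmul_eq_latticeToQ x
  obtain ⟨n', hn', hm'⟩ := h.exists_nsmul_mem hA m
  obtain ⟨s, hs, s', hs', hsA, hsA', hss⟩ := h.exists_sub _ hm'
  have h1 : latticeToQ (n' • m) ∈ Submodule.span ℚ (ω : Set (LatticeQ M)) := by
    have h2 : latticeToQ (n' • m) = latticeToQ s - latticeToQ s' := by
      rw [hss]; exact TensorProduct.tmul_sub _ _ _
    rw [h2]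
    exact sub_mem (Submodule.subset_span ((hω s hs).2 hsA))
      (Submodule.subset_span ((hω s' hs').2 hsA'))
  rw [latticeToQ_nsmul, ← hm, ← mul_smul, ← Nat.cast_smul_eq_nsmul ℚ] at h1
  exact (Submodule.smul_mem_iff _ (by positivity)).1 h1

lemma span_isConst_eq (h : E.IsKernelData L φ u r) {ω : PointedCone ℚ (LatticeQ M)}
    (hω : ∀ m ∈ L, latticeToQ m ∈ ω ↔ (φ m : C.K) ∈ E.A m) :
    Submodule.span k {a : AddMonoidAlgebra C.K M | ∃ m f, E.IsConst m f ∧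
        a = AddMonoidAlgebra.single m f} =
      Submodule.span k {a | ∃ m ∈ L, latticeToQ m ∈ ω ∧
        a = AddMonoidAlgebra.single m (φ m : C.K)} := by
  apply le_antisymm
  · rw [Submodule.span_le]
    rintro _ ⟨m, f, hf, rfl⟩
    by_cases hf0 : f = 0
    · rw [hf0, AddMonoidAlgebra.single_zero]
      exact zero_mem _
    obtain ⟨hm, c, rfl⟩ := h.const_eq m f hf hf0
    have hc : c ≠ 0 := by rintro rfl; simp at hf0
    have hmA : (φ m : C.K) ∈ E.A m := (Submodule.smul_mem_iff _ hc).1 hf.1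
    rw [SetLike.mem_coe, ← AddMonoidAlgebra.smul_single]
    exact Submodule.smul_mem _ _ (Submodule.subset_span ⟨m, hm, (hω m hm).2 hmA, rfl⟩)
  · refine Submodule.span_mono ?_
    rintro _ ⟨m, hm, hmω, rfl⟩
    exact ⟨m, _, h.isConst m hm ((hω m hm).1 hmω), rfl⟩

end HomogeneousExp.IsKernelData

open Polynomial in
/-- A purely transcendental extension `k(u)` of `k` is geometrically integral. -/
lemma isDomain_tensorProduct_of_transcendental {k K K' : Type*} [Field k] [Field K] [Algebra k K]
    [Field K'] [Algebra k K'] {u : K} (hu : Transcendental k u)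
    (hK : ∀ w : K, ∃ p q : k[X], q ≠ 0 ∧ w * aeval u q = aeval u p) : IsDomain (K' ⊗[k] K) := by
  let f : K' ⊗[k] k[X] →ₐ[k] K' ⊗[k] K :=
    Algebra.TensorProduct.map (AlgHom.id k K') (aeval u)
  have hinj : Function.Injective f :=
    Module.Flat.lTensor_preserves_injective_linearMap (M := K') (aeval u : k[X] →ₐ[k] K).toLinearMap
      (transcendental_iff_injective.1 hu)
  have hdom : IsDomain (K' ⊗[k] k[X]) := (polyEquivTensor k K').symm.toMulEquiv.isDomain _
  have key : ∀ x : K' ⊗[k] K, ∃ q : k[X], q ≠ 0 ∧ ∃ z, x * (1 ⊗ₜ aeval u q) = f z := by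
    intro x
    induction x using TensorProduct.induction_on with
    | zero => exact ⟨1, one_ne_zero, 0, by simp⟩
    | tmul a w =>
      obtain ⟨p, q, hq, hpq⟩ := hK w
      exact ⟨q, hq, a ⊗ₜ p, by simp [f, hpq]⟩
    | add x y hx hy =>
      obtain ⟨q, hq, z, hz⟩ := hx
      obtain ⟨q', hq', z', hz'⟩ := hy
      refine ⟨q * q', mul_ne_zero hq hq', z * (1 ⊗ₜ q') + z' * (1 ⊗ₜ q), ?_⟩
      rw [map_add, map_mul f, map_mul f, ← hz, ← hz', map_mul]
      simp only [f, Algebra.TensorProduct.map_tmul, map_one]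
      have : (1 : K') ⊗ₜ[k] (aeval u q * aeval u q') = 1 ⊗ₜ aeval u q * 1 ⊗ₜ aeval u q' := by
        simp
      rw [this]
      ring
  have hunit : ∀ q : k[X], q ≠ 0 → IsUnit ((1 : K') ⊗ₜ[k] aeval u q) := fun q hq =>
    (IsUnit.mk0 _ fun h => hq (transcendental_iff.1 hu q h)).map
      (Algebra.TensorProduct.includeRight : K →ₐ[k] K' ⊗[k] K)
  have : NoZeroDivisors (K' ⊗[k] K) := ⟨fun {x y} hxy => by
    obtain ⟨q, hq, z, hz⟩ := key x
    obtain ⟨q', hq', z', hz'⟩ := key y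
    have h0 : z * z' = 0 := hinj (by rw [map_mul, ← hz, ← hz', map_zero, mul_mul_mul_comm, hxy,
      zero_mul])
    rcases mul_eq_zero.1 h0 with rfl | rfl
    · left
      rw [map_zero] at hz
      exact (hunit q hq).mul_left_eq_zero.1 hz
    · right
      rw [map_zero] at hz'
      exact (hunit q' hq').mul_left_eq_zero.1 hz'⟩
  have : Nontrivial (K' ⊗[k] K) := hinj.nontrivial
  exact NoZeroDivisors.to_isDomain _

lemma AlgebraicGeometry.geometricallyIntegral_of_isDomain {k B : Type u} [Field k] [CommRing B]
    [Algebra k B] (h : ∀ (K' : Type u) [Field K'] [Algebra k K'], IsDomain (K' ⊗[k] B)) :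
    GeometricallyIntegral (Spec.map (CommRingCat.ofHom (algebraMap k B))) := by
  refine ⟨geometrically_iff_of_commRing.2 fun K' _ _ Y fst snd hY => ?_⟩
  have h1 := h K'
  have h2 : IsDomain (B ⊗[k] K') := (Algebra.TensorProduct.comm k B K').toMulEquiv.isDomain _
  have h3 : IsIntegral (Spec (.of (B ⊗[k] K'))) := inferInstance
  have : Nonempty Y := Nonempty.map (hY.isoPullback ≪≫ pullbackSpecIso k B K').inv inferInstance
  exact isIntegral_of_isOpenImmersion (hY.isoPullback ≪≫ pullbackSpecIso k B K').hom

lemma PolyhedralDivisor.geometricallyIntegral_toSpec {k : Type u} [Field k] {C : RegularCurve k}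
    {M : Type} [AddCommGroup M] [Module.Free ℤ M] [Module.Finite ℤ M] (D : PolyhedralDivisor C M)
    (hK : ∀ (K' : Type u) [Field K'] [Algebra k K'], IsDomain (K' ⊗[k] C.K)) :
    GeometricallyIntegral D.toSpec := by
  refine geometricallyIntegral_of_isDomain fun K' _ _ => ?_
  have h1 := hK K'
  have h2 := AddMonoidAlgebra.isDomain_of_free (K' ⊗[k] C.K) M
  have h3 : IsDomain (K' ⊗[k] AddMonoidAlgebra C.K M) :=
    (AddMonoidAlgebra.rTensorEquivAlgEquiv (M := M) k k K' C.K).toMulEquiv.isDomain _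
  let f : K' ⊗[k] D.algebra →ₐ[k] K' ⊗[k] AddMonoidAlgebra C.K M :=
    Algebra.TensorProduct.map (AlgHom.id k K') D.algebra.val
  have hinj : Function.Injective f :=
    Module.Flat.lTensor_preserves_injective_linearMap (M := K') D.algebra.val.toLinearMap
      Subtype.val_injective
  exact hinj.isDomain f.toRingHom

namespace RegularCurve

open Polynomial

variable {k : Type u} [Field k] (C : RegularCurve k)

lemma ord_nonneg_of_aeval {u : C.K} {y : C.ClosedPoint} {p : k[X]} (hp : 0 < p.natDegree)
    (h : aeval u p ∈ C.ordGE y 0) : u ∈ C.ordGE y 0 := by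
  intro hu
  by_contra! hlt
  have hp0 : p.leadingCoeff ≠ 0 := leadingCoeff_ne_zero.2 (by rintro rfl; simp at hp)
  have hd : (0 : ℚ) ≤ (p.natDegree : ℚ) - 1 := by
    have : (1 : ℚ) ≤ p.natDegree := by exact_mod_cast hp
    linarith
  have h1 : p.leadingCoeff • u ^ p.natDegree = aeval u p -
      ∑ i ∈ Finset.range p.natDegree, p.coeff i • u ^ i := by
    rw [aeval_eq_sum_range, Finset.sum_range_succ, add_sub_cancel_left, leadingCoeff]
  have h2 : p.leadingCoeff • u ^ p.natDegree ∈
      C.ordGE y (((p.natDegree : ℚ) - 1) * C.ord u y) := by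
    rw [h1]
    refine Submodule.sub_mem _ (fun h0 => ?_) (Submodule.sum_mem _ fun i hi =>
      Submodule.smul_mem _ _ fun _ => ?_)
    · nlinarith [h h0]
    · rw [C.ord_pow hu]
      have hi' : (i : ℚ) ≤ p.natDegree - 1 := by
        have : (i : ℚ) + 1 ≤ p.natDegree := by exact_mod_cast Finset.mem_range.1 hi
        linarith
      push_cast
      nlinarith
  have h3 := (Submodule.smul_mem_iff _ hp0).1 h2 (pow_ne_zero _ hu)
  rw [C.ord_pow hu] at h3
  push_cast at h3
  linarith

lemma aeval_mem_ordGE_zero {u : C.K} {y : C.ClosedPoint} (hu : u ∈ C.ordGE y 0) (p : k[X]) :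
    aeval u p ∈ C.ordGE y 0 := by
  have := C.aeval_mem_ordGE (u := u) (y := y) le_rfl (fun h => by rw [zero_add]; exact hu h) p le_rfl
  rwa [mul_zero, neg_zero] at this

lemma algebraMap_mem_ordGE (f : Γ(C.X, ⊤)) (y : C.ClosedPoint) :
    algebraMap Γ(C.X, ⊤) C.K f ∈ C.ordGE y 0 := fun h => by
  have hf : f ≠ 0 := by rintro rfl; simp at h
  exact_mod_cast C.ord_germ_nonneg (U := ⊤) hf y trivial

section Affine

variable [IsAffine C.X]

instance : IsFractionRing Γ(C.X, ⊤) C.K :=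
  functionField_isFractionRing_of_isAffineOpen C.X ⊤ (isAffineOpen_top _)

/-- A rational function without poles on an affine curve is regular. -/
lemma mem_range_of_forall_ordGE {f : C.K} (hf : ∀ y, f ∈ C.ordGE y 0) :
    f ∈ (algebraMap Γ(C.X, ⊤) C.K).range := by
  let I : Ideal Γ(C.X, ⊤) :=
    { carrier := {a | algebraMap _ C.K a * f ∈ (algebraMap Γ(C.X, ⊤) C.K).range}
      zero_mem' := by simp
      add_mem' := fun {a b} ha hb => by
        simp only [Set.mem_ofPred_eq, map_add, add_mul] at ha hb ⊢
        exact add_mem ha hb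
      smul_mem' := fun a b hb => by
        simp only [Set.mem_ofPred_eq, smul_eq_mul, map_mul, mul_assoc] at hb ⊢
        exact mul_mem ⟨a, rfl⟩ hb }
  by_cases hI : I = ⊤
  · have h1 : (1 : Γ(C.X, ⊤)) ∈ I := hI ▸ Submodule.mem_top
    simpa [I] using h1
  · exfalso
    obtain ⟨p, hp, hIp⟩ := Ideal.exists_le_maximal I hI
    let hU := isAffineOpen_top C.X
    let x : C.X := hU.fromSpec ⟨p, hp.isPrime⟩
    have hx : x ∈ (⊤ : C.X.Opens) := trivial
    have hstalk : f ∈ (algebraMap (C.X.presheaf.stalk x) C.K).range := by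
      by_cases hxη : x = genericPoint C.X
      · rw [hxη]
        refine ⟨f, ?_⟩
        change (C.X.presheaf.stalkSpecializes _).hom f = f
        rw [TopCat.Presheaf.stalkSpecializes_refl]
        rfl
      · by_cases hf0 : f = 0
        · rw [hf0]; exact zero_mem _
        have := hf ⟨x, C.isClosed_of_ne hxη⟩ hf0
        exact (C.ord_nonneg_iff ⟨x, C.isClosed_of_ne hxη⟩ hf0).1 (by exact_mod_cast this)
    obtain ⟨g, hg⟩ := hstalk
    let _ := TopCat.Presheaf.algebra_section_stalk C.X.presheaf (⟨x, hx⟩ : (⊤ : C.X.Opens))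
    have hloc : IsLocalization.AtPrime (C.X.presheaf.stalk x) p :=
      hU.isLocalization_stalk' ⟨p, hp.isPrime⟩ hx
    have htower : IsScalarTower Γ(C.X, ⊤) (C.X.presheaf.stalk x) C.K :=
      functionField_isScalarTower C.X ⊤ ⟨x, hx⟩
    obtain ⟨⟨b, c⟩, hbc⟩ := IsLocalization.surj p.primeCompl g
    refine c.2 (hIp ⟨b, ?_⟩)
    have h1 := congrArg (algebraMap _ C.K) hbc
    rw [map_mul, ← IsScalarTower.algebraMap_apply, ← IsScalarTower.algebraMap_apply, hg] at h1
    rw [← h1, mul_comm]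

lemma exists_separating {y₀ y : C.ClosedPoint} (hy : y ≠ y₀) : ∃ f : Γ(C.X, ⊤),
    algebraMap _ C.K f ≠ 0 ∧ 0 < C.ord (algebraMap _ C.K f) y₀ ∧
      C.ord (algebraMap _ C.K f) y = 0 := by
  obtain ⟨_, ⟨_, ⟨f, rfl⟩, rfl⟩, hyf, hf⟩ := (isBasis_basicOpen C.X).exists_subset_of_mem_open
    (show y.1 ∈ ({y₀.1}ᶜ : Set C.X) from fun h => hy (Subtype.ext h)) y₀.2.isOpen_compl
  have hgerm : ∀ z : C.X, IsUnit (C.X.presheaf.germ ⊤ z trivial f) ↔ z ∈ C.X.basicOpen f :=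
    fun z => (Scheme.mem_basicOpen C.X f z trivial).symm
  have hy₀ : y₀.1 ∉ C.X.basicOpen f := fun h => hf h rfl
  have hf0 : f ≠ 0 := by
    rintro rfl
    simp at hyf
  have hg0 : ∀ z : C.X, C.X.presheaf.germ ⊤ z trivial f ≠ 0 := fun z => by
    simpa using (germ_injective_of_isIntegral C.X (U := ⊤) z trivial).ne hf0
  have halg : ∀ z : C.X, algebraMap _ C.K f =
      algebraMap (C.X.presheaf.stalk z) C.K (C.X.presheaf.germ ⊤ z trivial f) := fun z =>
    (Scheme.algebraMap_germ_eq_germToFunctionField C.X (U := ⊤) trivial f).symm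
  refine ⟨f, ?_, ?_, ?_⟩
  · simpa using (IsFractionRing.injective Γ(C.X, ⊤) C.K).ne hf0
  · rw [halg y₀.1, C.ord_algebraMap_pos_iff y₀ (hg0 _), hgerm]
    exact hy₀
  · rw [halg y.1, C.ord_algebraMap_eq_zero_iff y (hg0 _), hgerm]
    exact hyf

/-- An affine curve whose rational functions without poles are the polynomials in `u` is the
affine line. -/
lemma isAffineLine_of_bijective {u : C.K} (hu : Transcendental k u)
    (hΓ : ∀ f : Γ(C.X, ⊤), ∃ p : k[X], algebraMap _ C.K f = aeval u p)
    (hu' : ∀ y, u ∈ C.ordGE y 0) : C.IsAffineLine := by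
  obtain ⟨v, hv⟩ := C.mem_range_of_forall_ordGE hu'
  let f : k[X] →+* Γ(C.X, ⊤) := eval₂RingHom C.globalConst v
  have hf : ∀ p, algebraMap Γ(C.X, ⊤) C.K (f p) = aeval u p := fun p => by
    rw [← hv, aeval_def]
    exact hom_eval₂ p C.globalConst (algebraMap Γ(C.X, ⊤) C.K) v
  have hbij : Function.Bijective f := by
    constructor
    · intro p q hpq
      apply transcendental_iff_injective.1 hu
      rw [← hf, ← hf, hpq]
    · intro g
      obtain ⟨p, hp⟩ := hΓ g
      exact ⟨p, IsFractionRing.injective Γ(C.X, ⊤) C.K ((hf p).trans hp.symm)⟩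
  let e : CommRingCat.of k[X] ≅ Γ(C.X, ⊤) := (RingEquiv.ofBijective f hbij).toCommRingCatIso
  have hefac : CommRingCat.ofHom (algebraMap k k[X]) ≫ e.hom =
      (Scheme.ΓSpecIso (.of k)).inv ≫ C.s.appTop := by
    ext a
    change f (algebraMap k k[X] a) = C.globalConst a
    simp [f]
  refine ⟨Over.isoMk (C.X.isoSpec ≪≫ Scheme.Spec.mapIso e.op) ?_⟩
  change (C.X.toSpecΓ ≫ Spec.map e.hom) ≫ Spec.map (CommRingCat.ofHom (algebraMap k k[X])) = C.s
  rw [Category.assoc, ← Spec.map_comp, hefac, Spec.map_comp, ← Scheme.toSpecΓ_naturality_assoc,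
    toSpecΓ_SpecMap_ΓSpecIso_inv, Category.comp_id]

end Affine

end RegularCurve

namespace HomogeneousExp.IsKernelData

open Polynomial

variable {k : Type u} [Field k] {C : RegularCurve k} {M : Type} [AddCommGroup M]
  {D : PolyhedralDivisor C M} {E : HomogeneousExp k C.K M} {L : AddSubgroup M} {φ : M → C.Kˣ}
  {u : C.K} {r : ℕ}

lemma exists_eq_aeval_of_ordGE_zero (h : E.IsKernelData L φ u r) (hA : ∀ m, E.A m = D.piece m)
    {z : C.K} (hz : ∀ y, z ∈ C.ordGE y 0) : ∃ p : k[X], z = aeval u p := by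
  obtain ⟨s, b, hb⟩ := h.exists_isPoleBound hA
  exact h.exists_eq_aeval_of_ordGE hA hb (N := 0) fun y => by simpa using hz y

variable [IsAffine C.X]

lemma mem_ordGE_zero (h : E.IsKernelData L φ u r) (hA : ∀ m, E.A m = D.piece m)
    (y : C.ClosedPoint) : u ∈ C.ordGE y 0 := by
  obtain ⟨f, p, hp, hfp⟩ : ∃ (f : Γ(C.X, ⊤)) (p : k[X]), 0 < p.natDegree ∧
      algebraMap _ C.K f = aeval u p := by
    by_contra! hcon
    have hk : ∀ f : Γ(C.X, ⊤), IsAlgebraic k (algebraMap _ C.K f) := fun f => by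
      obtain ⟨p, hp⟩ := h.exists_eq_aeval_of_ordGE_zero hA (C.algebraMap_mem_ordGE f)
      have h0 : p.natDegree = 0 := by
        by_contra hne
        exact hcon f p (Nat.pos_of_ne_zero hne) hp
      rw [hp, eq_C_of_natDegree_eq_zero h0, aeval_C]
      exact isAlgebraic_algebraMap _
    obtain ⟨a, b, hb, hab⟩ := IsFractionRing.div_surjective (A := Γ(C.X, ⊤)) u
    refine h.transcendental ?_
    rw [← hab, div_eq_mul_inv]
    exact (hk a).mul (hk b).inv
  exact C.ord_nonneg_of_aeval hp (hfp ▸ C.algebraMap_mem_ordGE f y)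

lemma isAffineLine (h : E.IsKernelData L φ u r) (hA : ∀ m, E.A m = D.piece m) :
    C.IsAffineLine :=
  C.isAffineLine_of_bijective h.transcendental
    (fun f => h.exists_eq_aeval_of_ordGE_zero hA (C.algebraMap_mem_ordGE f)) (h.mem_ordGE_zero hA)

/-- On an affine curve every closed point is the only zero of some polynomial in `u`. -/
lemma exists_polynomial_ord_pos_iff (h : E.IsKernelData L φ u r) (hA : ∀ m, E.A m = D.piece m)
    (y₀ : C.ClosedPoint) : ∃ p : k[X], p ≠ 0 ∧ 0 < C.ord (aeval u p) y₀ ∧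
      ∀ y ≠ y₀, C.ord (aeval u p) y = 0 := by
  classical
  have hnn : ∀ (p : k[X]) (y), p ≠ 0 → 0 ≤ C.ord (aeval u p) y := fun p y hp => by
    exact_mod_cast C.aeval_mem_ordGE_zero (h.mem_ordGE_zero hA y) p (h.aeval_ne_zero hp)
  have hex : ∃ n, ∃ p : k[X], p ≠ 0 ∧ 0 < C.ord (aeval u p) y₀ ∧ p.natDegree = n := by
    obtain ⟨f, hf0, hf⟩ := C.exists_ord_pos y₀
    obtain ⟨p, q, hq, hpq⟩ := h.exists_mul_aeval_eq hA f
    have hq0 := h.aeval_ne_zero hq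
    refine ⟨_, p, ?_, ?_, rfl⟩
    · rintro rfl
      rw [_root_.map_zero] at hpq
      exact mul_ne_zero hf0 hq0 hpq
    · rw [← hpq, C.ord_mul hf0 hq0]
      have := hnn q y₀ hq
      omega
  obtain ⟨p, hp, hpy, hdeg⟩ := Nat.find_spec hex
  have hmin : ∀ q : k[X], q ≠ 0 → 0 < C.ord (aeval u q) y₀ → p.natDegree ≤ q.natDegree :=
    fun q hq hqy => hdeg ▸ Nat.find_min' hex ⟨q, hq, hqy, rfl⟩
  refine ⟨p, hp, hpy, fun y hy => ?_⟩
  by_contra hne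
  obtain ⟨f, hf0, hfy₀, hfy⟩ := C.exists_separating hy
  obtain ⟨q, hq⟩ := h.exists_eq_aeval_of_ordGE_zero hA (C.algebraMap_mem_ordGE f)
  rw [hq] at hf0 hfy₀ hfy
  have hdiv : p ∣ q := by
    rw [← EuclideanDomain.mod_eq_zero]
    by_contra hr
    have hmem : aeval u (q % p) ∈ C.ordGE y₀ 1 := by
      have h1 : aeval u (q % p) = aeval u q - aeval u p * aeval u (q / p) := by
        rw [← _root_.map_mul, ← map_sub]
        congr 1
        rw [eq_sub_iff_add_eq]
        exact EuclideanDomain.mod_add_div q p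
      rw [h1]
      refine Submodule.sub_mem _ (fun _ => by exact_mod_cast hfy₀) (fun hne0 => ?_)
      rw [C.ord_mul (left_ne_zero_of_mul hne0) (right_ne_zero_of_mul hne0)]
      have h2 := hnn (q / p) y₀ (by
        rintro h0
        rw [h0, _root_.map_zero, mul_zero] at hne0
        exact hne0 rfl)
      exact_mod_cast (by omega : (1 : ℤ) ≤ C.ord (aeval u p) y₀ + C.ord (aeval u (q / p)) y₀)
    have h3 := hmem (h.aeval_ne_zero hr)
    have h4 : 1 ≤ C.ord (aeval u (q % p)) y₀ := by exact_mod_cast h3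
    have h5 := hmin _ hr (by omega)
    have h6 : p.natDegree ≠ 0 := by
      intro h0
      rw [eq_C_of_natDegree_eq_zero h0, aeval_C, C.ord_const] at hpy
      · exact lt_irrefl _ hpy
      · intro h00
        apply hp
        rw [eq_C_of_natDegree_eq_zero h0, h00, C_0]
    have h7 := natDegree_mod_lt q h6
    omega
  obtain ⟨w, rfl⟩ := hdiv
  have hw : w ≠ 0 := by rintro rfl; simp at hf0
  rw [_root_.map_mul, C.ord_mul (h.aeval_ne_zero hp) (h.aeval_ne_zero hw)] at hfy
  have := hnn p y hp
  have := hnn w y hw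
  omega

lemma ord_add_eval_eq_zero (h : E.IsKernelData L φ u r) (hA : ∀ m, E.A m = D.piece m) {m : M}
    (hm : m ∈ L) (hmA : (φ m : C.K) ∈ E.A m) (y₀ : C.ClosedPoint) :
    (C.ord (φ m : C.K) y₀ : ℚ) + D.eval (latticeToQ m) y₀ = 0 := by
  rw [hA, D.mem_piece_iff (φ m).ne_zero] at hmA
  obtain ⟨hσ, hord⟩ := hmA
  by_contra hne
  have hpos : 0 < (C.ord (φ m : C.K) y₀ : ℚ) + D.eval (latticeToQ m) y₀ :=
    lt_of_le_of_ne (hord y₀) (Ne.symm hne)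
  obtain ⟨p, hp, hpy₀, hpy⟩ := h.exists_polynomial_ord_pos_iff hA y₀
  have hp0 := h.aeval_ne_zero hp
  obtain ⟨N, hN⟩ := exists_nat_ge ((C.ord (aeval u p) y₀ : ℚ) /
    ((C.ord (φ m : C.K) y₀ : ℚ) + D.eval (latticeToQ m) y₀))
  rw [div_le_iff₀ hpos] at hN
  have hmem : (φ (N • m) : C.K) * (aeval u p)⁻¹ ∈ E.A (N • m) := by
    rw [hA, D.mem_piece_iff (mul_ne_zero (φ _).ne_zero (inv_ne_zero hp0)), latticeToQ_nsmul]
    refine ⟨nsmul_mem hσ N, fun y => ?_⟩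
    have h2 := D.nsmul_eval_le hσ N y
    rw [C.ord_mul (φ _).ne_zero (inv_ne_zero hp0), h.map_nsmul hm, Units.val_pow_eq_pow_val,
      C.ord_pow (φ m).ne_zero, C.ord_inv hp0]
    push_cast
    by_cases hy : y = y₀
    · subst hy
      linarith
    · rw [hpy y hy, Int.cast_zero]
      have := mul_nonneg (Nat.cast_nonneg (α := ℚ) N) (hord y)
      linarith
  obtain ⟨q, hq⟩ := h.mem_eq _ (L.nsmul_mem hm N) _ hmem
  have hq' := mul_left_cancel₀ (φ (N • m)).ne_zero hq
  have h3 := C.aeval_mem_ordGE_zero (h.mem_ordGE_zero hA y₀) q (hq' ▸ inv_ne_zero hp0)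
  rw [← hq', C.ord_inv hp0] at h3
  have h4 : 0 ≤ -C.ord (aeval u p) y₀ := by exact_mod_cast h3
  omega

end HomogeneousExp.IsKernelData

namespace AlgebraicGeometry

instance Scheme.isDominant_fromSpecStalk_genericPoint (X : Scheme.{u}) [IrreducibleSpace X] :
    IsDominant (X.fromSpecStalk (genericPoint X)) := by
  refine ⟨fun x => ?_⟩
  have h : genericPoint X ∈ Set.range (X.fromSpecStalk (genericPoint X)) :=
    ⟨_, Scheme.fromSpecStalk_closedPoint⟩
  exact closure_mono (Set.singleton_subset_iff.2 h) (genericPoint_specializes x).mem_closure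

lemma Scheme.PartialMap.specMap_stalkSpecializes_fromSpecStalkOfMem {X Y : Scheme.{u}}
    (g : X.PartialMap Y) {x y : X} (h : x ⤳ y) (hx : x ∈ g.domain) (hy : y ∈ g.domain) :
    Spec.map (X.presheaf.stalkSpecializes h) ≫ g.fromSpecStalkOfMem hy =
      g.fromSpecStalkOfMem hx := by
  rw [fromSpecStalkOfMem, fromSpecStalkOfMem, ← Category.assoc]
  congr 1
  rw [← cancel_mono g.domain.ι, Category.assoc, Opens.fromSpecStalkOfMem_ι,
    Opens.fromSpecStalkOfMem_ι, Scheme.SpecMap_stalkSpecializes_fromSpecStalk]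

/-- A morphism from the generic point of an integral scheme all of whose local rings are valuation
rings to a proper scheme extends to the whole scheme. -/
theorem exists_extension_of_isProper {X Y S : Scheme.{u}} [IsIntegral X] [S.IsSeparated]
    [∀ x : X, ValuationRing (X.presheaf.stalk x)] (sX : X ⟶ S) (sY : Y ⟶ S) [IsProper sY]
    (f : Spec X.functionField ⟶ Y) (h : f ≫ sY = X.fromSpecStalk (genericPoint X) ≫ sX) :
    ∃ F : X ⟶ Y, F ≫ sY = sX ∧ X.fromSpecStalk (genericPoint X) ≫ F = f := by
  have hYsep : Y.IsSeparated := by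
    have : IsSeparated (sY ≫ Limits.terminal.from S) := by
      have : IsSeparated (Limits.terminal.from S) := Scheme.IsSeparated.isSeparated_terminal_from
      infer_instance
    refine ⟨?_⟩
    convert! this
    exact Subsingleton.elim _ _
  let r := Scheme.RationalMap.ofFunctionField sX sY f h
  have hr : r.fromFunctionField = f :=
    Scheme.RationalMap.fromFunctionField_ofFunctionField sX sY f h
  have hdom : ∀ x : X, x ∈ r.domain := by
    intro x
    have hval : ValuativeCriterion sY := by
      have : IsProper sY := inferInstance
      rw [IsProper.eq_valuativeCriterion] at this
      exact this.1.1.1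
    let Q : ValuativeCommSq sY :=
      { R := X.presheaf.stalk x
        commRing := (X.presheaf.stalk x).commRing
        domain := inferInstanceAs (IsDomain (X.presheaf.stalk x))
        K := X.functionField
        i₁ := f
        i₂ := X.fromSpecStalk x ≫ sX
        commSq := ⟨h.trans (by
          rw [← Scheme.SpecMap_stalkSpecializes_fromSpecStalk (genericPoint_specializes x),
            Category.assoc]
          rfl)⟩ }
    obtain ⟨⟨l', hl₁', hl₂'⟩⟩ := (hval.existence Q).exists_lift
    obtain ⟨l, hl₁, hl₂⟩ : ∃ l : Spec (X.presheaf.stalk x) ⟶ Y,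
        Spec.map (X.presheaf.stalkSpecializes (genericPoint_specializes x)) ≫ l = f ∧
          l ≫ sY = X.fromSpecStalk x ≫ sX := ⟨l', hl₁', hl₂'⟩
    let g := Scheme.PartialMap.ofFromSpecStalk sX sY (x := x) l hl₂
    have hxg : x ∈ g.domain := Scheme.PartialMap.mem_domain_ofFromSpecStalk sX sY l hl₂
    refine Scheme.RationalMap.mem_domain.2 ⟨g, hxg, ?_⟩
    refine Scheme.RationalMap.eq_of_fromFunctionField_eq _ _ ?_
    rw [hr, Scheme.RationalMap.fromFunctionField_toRationalMap, Scheme.PartialMap.fromFunctionField,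
      ← g.specMap_stalkSpecializes_fromSpecStalkOfMem (genericPoint_specializes x) _ hxg,
      Scheme.PartialMap.fromSpecStalkOfMem_ofFromSpecStalk]
    exact hl₁
  obtain ⟨g, hg, htop⟩ : ∃ g : X.PartialMap Y, g.toRationalMap = r ∧ g.domain = ⊤ :=
    ⟨r.toPartialMap, Scheme.RationalMap.toRationalMap_toPartialMap r,
      top_le_iff.1 fun x _ => hdom x⟩
  have : IsIso g.domain.ι := by
    rw [htop]
    exact X.topIso.isIso_hom
  have hηF : X.fromSpecStalk (genericPoint X) ≫ inv g.domain.ι ≫ g.hom = f := by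
    rw [← hr, ← hg, Scheme.RationalMap.fromFunctionField_toRationalMap,
      Scheme.PartialMap.fromFunctionField, Scheme.PartialMap.fromSpecStalkOfMem, ← Category.assoc]
    congr 1
    rw [IsIso.comp_inv_eq, Scheme.Opens.fromSpecStalkOfMem_ι]
  refine ⟨inv g.domain.ι ≫ g.hom, ?_, hηF⟩
  refine ext_of_isDominant (X.fromSpecStalk (genericPoint X)) ?_
  rw [← h, ← Category.assoc, hηF]

/-- Two integral schemes, proper over a separated base, whose local rings are valuation rings are
isomorphic as soon as their generic points are. -/
theorem nonempty_iso_of_isProper {X Y S : Scheme.{u}} [IsIntegral X] [IsIntegral Y] [S.IsSeparated]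
    [∀ x : X, ValuationRing (X.presheaf.stalk x)] [∀ y : Y, ValuationRing (Y.presheaf.stalk y)]
    (sX : X ⟶ S) (sY : Y ⟶ S) [IsProper sX] [IsProper sY]
    (e : Spec X.functionField ≅ Spec Y.functionField)
    (h : e.hom ≫ Y.fromSpecStalk (genericPoint Y) ≫ sY =
      X.fromSpecStalk (genericPoint X) ≫ sX) :
    Nonempty (Over.mk sX ≅ Over.mk sY) := by
  obtain ⟨F, hF, hF'⟩ := exists_extension_of_isProper sX sY
    (e.hom ≫ Y.fromSpecStalk (genericPoint Y)) (by rw [Category.assoc, h])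
  obtain ⟨G, hG, hG'⟩ := exists_extension_of_isProper sY sX
    (e.inv ≫ X.fromSpecStalk (genericPoint X)) (by rw [Category.assoc, ← h, e.inv_hom_id_assoc])
  have hFG : F ≫ G = 𝟙 X := by
    refine ext_of_isDominant_of_isSeparated sX ?_ (X.fromSpecStalk (genericPoint X)) ?_
    · rw [Category.assoc, hG, hF, Category.id_comp]
    · rw [← Category.assoc, hF', Category.assoc, hG', e.hom_inv_id_assoc, Category.comp_id]
  have hGF : G ≫ F = 𝟙 Y := by
    refine ext_of_isDominant_of_isSeparated sY ?_ (Y.fromSpecStalk (genericPoint Y)) ?_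
    · rw [Category.assoc, hF, hG, Category.id_comp]
    · rw [← Category.assoc, hG', Category.assoc, hF', e.inv_hom_id_assoc, Category.comp_id]
  exact ⟨Over.isoMk ⟨F, G, hFG, hGF⟩ hF⟩

/-- The generic point of an integral scheme, seen in an affine open. -/
lemma exists_iso_functionField_of_isOpenImmersion {X : Scheme.{u}} [IsIntegral X]
    {B : CommRingCat.{u}} [IsDomain B] (j : Spec B ⟶ X) [IsOpenImmersion j]
    (K : Type u) [Field K] [Algebra B K] [IsFractionRing B K] :
    ∃ e : Spec (.of K) ≅ Spec X.functionField,
      e.hom ≫ X.fromSpecStalk (genericPoint X) =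
        Spec.map (CommRingCat.ofHom (algebraMap B K)) ≫ j := by
  have hη : j (genericPoint (Spec B)) = genericPoint X := genericPoint_eq_of_isOpenImmersion j
  let a : X.presheaf.stalk (j (genericPoint (Spec B))) ≅ (Spec B).functionField :=
    asIso (j.stalkMap (genericPoint (Spec B)))
  let b : X.presheaf.stalk (j (genericPoint (Spec B))) ≅ X.functionField :=
    X.presheaf.stalkCongr (.of_eq hη)
  let c : (Spec B).functionField ≅ CommRingCat.of K :=
    (IsLocalization.algEquiv (nonZeroDivisors B) (Spec B).functionField K).toRingEquiv.toCommRingCatIso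
  have hb : Spec.map b.inv ≫ X.fromSpecStalk (genericPoint X) =
      X.fromSpecStalk (j (genericPoint (Spec B))) :=
    Scheme.SpecMap_stalkSpecializes_fromSpecStalk (Specializes.of_eq hη)
  have hc : CommRingCat.ofHom (algebraMap B (Spec B).functionField) ≫ c.hom =
      CommRingCat.ofHom (algebraMap B K) := by
    ext x
    exact (IsLocalization.algEquiv (nonZeroDivisors B) (Spec B).functionField K).commutes x
  refine ⟨Scheme.Spec.mapIso (b.symm ≪≫ a ≪≫ c).op, ?_⟩
  change Spec.map (b.inv ≫ a.hom ≫ c.hom) ≫ X.fromSpecStalk (genericPoint X) = _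
  rw [Spec.map_comp, Spec.map_comp, Category.assoc, Category.assoc, hb]
  change _ ≫ Spec.map (j.stalkMap (genericPoint (Spec B))) ≫ _ = _
  rw [Scheme.SpecMap_stalkMap_fromSpecStalk, Spec.fromSpecStalk_eq', ← hc,
    Spec.map_comp, Category.assoc]
  rfl

end AlgebraicGeometry

lemma IsLocalization.AtPrime.valuationRing {R S : Type*} [CommRing R] [IsPrincipalIdealRing R]
    [CommRing S] [IsDomain S] [Algebra R S] (p : Ideal R) [p.IsPrime]
    [IsLocalization.AtPrime S p] : ValuationRing S := by
  have : IsPrincipalIdealRing S := by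
    refine ⟨fun J => ⟨?_⟩⟩
    obtain ⟨a, ha⟩ := (IsPrincipalIdealRing.principal (J.under R)).principal
    refine ⟨algebraMap R S a, ?_⟩
    rw [← IsLocalization.map_under p.primeCompl S J, ha]
    change Ideal.map _ (Ideal.span {a}) = Ideal.span _
    rw [Ideal.map_span, Set.image_singleton]
  exact ValuationRing.iff_local_bezout_domain.2
    ⟨IsLocalization.AtPrime.isLocalRing S p, inferInstance⟩

lemma AlgebraicGeometry.valuationRing_stalk_Spec (R : Type u) [CommRing R] [IsDomain R]
    [IsPrincipalIdealRing R] (x : Spec (.of R)) :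
    ValuationRing ((Spec (.of R)).presheaf.stalk x) := by
  let y : PrimeSpectrum R := x
  have : IsDomain ((Spec.structureSheaf R).presheaf.stalk y) :=
    inferInstanceAs (IsDomain ((Spec (.of R)).presheaf.stalk x))
  have h := StructureSheaf.IsLocalization.to_stalk R y
  exact IsLocalization.AtPrime.valuationRing (S := (Spec.structureSheaf R).presheaf.stalk y)
    y.asIdeal

namespace ProjectiveLine

open MvPolynomial HomogeneousLocalization

variable (k : Type u) [Field k]

/-- The grading of `k[x₀, x₁]` by the degree. -/
abbrev grading : ℕ → Submodule k (MvPolynomial (Fin 2) k) := homogeneousSubmodule (Fin 2) k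

lemma X_mem_grading (i : Fin 2) : (X i : MvPolynomial (Fin 2) k) ∈ grading k 1 :=
  isHomogeneous_X k i

lemma X_mem_grading_one_smul (i : Fin 2) : (X i : MvPolynomial (Fin 2) k) ∈ grading k (1 • 1) :=
  isHomogeneous_X k i

/-- The coordinate ring of the chart `x_i ≠ 0`. -/
abbrev Chart (i : Fin 2) : Type u := Away (grading k) (X i : MvPolynomial (Fin 2) k)

/-- The constants of the coordinate ring of a chart. -/
noncomputable def chartConst (i : Fin 2) : k →+* Chart k i :=
  (fromZeroRingHom (grading k) _).comp (algebraMap k (grading k 0))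

/-- The parametrisation of a chart by the polynomial ring in the affine coordinate. -/
noncomputable def toChart (i : Fin 2) : Polynomial k →+* Chart k i :=
  Polynomial.eval₂RingHom (chartConst k i)
    (Away.mk (grading k) (X_mem_grading k i) 1 (X i.rev) (X_mem_grading_one_smul k i.rev))

/-- Dehomogenisation at the coordinate `x_i`. -/
noncomputable def dehomogenize (i : Fin 2) : MvPolynomial (Fin 2) k →+* Polynomial k :=
  (aeval fun l => if l = i then 1 else Polynomial.X : _ →ₐ[k] _).toRingHom

/-- The inverse of `toChart`. -/
noncomputable def ofChart (i : Fin 2) : Chart k i →+* Polynomial k :=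
  (IsLocalization.Away.lift (S := Localization.Away (X i : MvPolynomial (Fin 2) k)) (X i)
    (g := dehomogenize k i) (by simp [dehomogenize])).comp (algebraMap _ _)

lemma val_chartConst (i : Fin 2) (c : k) :
    (chartConst k i c).val = algebraMap (MvPolynomial (Fin 2) k) _ (C c) := by
  rw [chartConst, RingHom.comp_apply]
  rfl

lemma ofChart_toChart (i : Fin 2) (p : Polynomial k) : ofChart k i (toChart k i p) = p := by
  suffices h : (ofChart k i).comp (toChart k i) = RingHom.id _ from congr($h p)
  refine Polynomial.ringHom_ext (fun c => ?_) ?_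
  · rw [RingHom.comp_apply, toChart, Polynomial.coe_eval₂RingHom, Polynomial.eval₂_C, ofChart,
      RingHom.comp_apply, HomogeneousLocalization.algebraMap_apply, val_chartConst,
      IsLocalization.Away.lift_eq]
    simp [dehomogenize]
  · rw [RingHom.comp_apply, toChart, Polynomial.coe_eval₂RingHom, Polynomial.eval₂_X, ofChart,
      RingHom.comp_apply, HomogeneousLocalization.algebraMap_apply, Away.val_mk,
      Localization.mk_eq_mk']
    rw [IsLocalization.Away.lift, IsLocalization.lift_mk'_spec]
    fin_cases i <;> simp [dehomogenize, Fin.rev]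

lemma pow_mul_eval₂_eq {R : Type*} [CommRing R] (f : k →+* R) (g : Fin 2 → R) (s : R) {n : ℕ}
    {p : MvPolynomial (Fin 2) k} (hp : p.IsHomogeneous n) :
    s ^ n * p.eval₂ f g = p.eval₂ f (fun l => s * g l) := by
  rw [eval₂_eq', eval₂_eq', Finset.mul_sum]
  refine Finset.sum_congr rfl fun d hd => ?_
  have h := hp (mem_support_iff.1 hd)
  have h' : d 0 + d 1 = n := by
    rw [← h]
    simp [Finsupp.weight_apply, Finsupp.sum_fintype]
  simp only [Fin.prod_univ_two, mul_pow, ← h', pow_add]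
  ring

lemma toChart_surjective (i : Fin 2) : Function.Surjective (toChart k i) := by
  have hrev : ∀ i l : Fin 2, ¬ l = i → i.rev = l := by decide
  intro z
  obtain ⟨n, a, ha, rfl⟩ := Away.mk_surjective (grading k) (X_mem_grading k i) z
  refine ⟨dehomogenize k i a, val_injective _ ?_⟩
  set S := Localization.Away (X i : MvPolynomial (Fin 2) k)
  set v : Chart k i →+* S := algebraMap _ _
  have hX : IsUnit (algebraMap (MvPolynomial (Fin 2) k) S (X i)) :=
    IsLocalization.Away.algebraMap_isUnit (X i)
  set w : S := v (Away.mk (grading k) (X_mem_grading k i) 1 (X i.rev)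
    (X_mem_grading_one_smul k i.rev))
  have hw : algebraMap (MvPolynomial (Fin 2) k) S (X i) * w =
      algebraMap (MvPolynomial (Fin 2) k) S (X i.rev) := by
    change _ * (Away.mk (grading k) (X_mem_grading k i) 1 (X i.rev) _).val = _
    rw [Away.val_mk, Localization.mk_eq_mk', mul_comm]
    refine Eq.trans ?_ (IsLocalization.mk'_spec S (X i.rev : MvPolynomial (Fin 2) k)
      (⟨X i ^ 1, 1, rfl⟩ : Submonoid.powers (X i : MvPolynomial (Fin 2) k)))
    exact congrArg _ (congrArg _ (pow_one _).symm)
  have h1 : v (toChart k i (dehomogenize k i a)) =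
      a.eval₂ (v.comp (chartConst k i)) (fun l => if l = i then 1 else w) := by
    suffices h : (v.comp (toChart k i)).comp (dehomogenize k i) =
        eval₂Hom (v.comp (chartConst k i)) (fun l => if l = i then 1 else w) from congr($h a)
    refine MvPolynomial.ringHom_ext (fun c => ?_) fun l => ?_
    · simp [dehomogenize, toChart]
    · by_cases hl : l = i
      · simp [dehomogenize, hl]
      · simp [dehomogenize, toChart, hl, w]
  change v (toChart k i (dehomogenize k i a)) = _
  rw [Away.val_mk, Localization.mk_eq_mk']
  refine (IsLocalization.eq_mk'_iff_mul_eq).2 ?_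
  have hn : a.IsHomogeneous n := by simpa using ha
  rw [h1, map_pow, mul_comm, pow_mul_eval₂_eq k _ _ _ hn]
  have h2 : (fun l => algebraMap (MvPolynomial (Fin 2) k) S (X i) * if l = i then 1 else w) =
      fun l => algebraMap (MvPolynomial (Fin 2) k) S (X l) := by
    funext l
    split_ifs with h
    · rw [h, mul_one]
    · rw [hw]
      congr 2
      exact hrev i l h
  rw [h2]
  suffices h : eval₂Hom (v.comp (chartConst k i))
      (fun l => algebraMap (MvPolynomial (Fin 2) k) S (X l)) = algebraMap _ S from congr($h a)
  refine MvPolynomial.ringHom_ext (fun c => ?_) fun l => ?_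
  · rw [coe_eval₂Hom, eval₂_C]
    exact val_chartConst k i c
  · rw [coe_eval₂Hom, eval₂_X]

/-- A chart of the projective line is an affine line. -/
noncomputable def chartEquiv (i : Fin 2) : Polynomial k ≃+* Chart k i :=
  RingEquiv.ofBijective (toChart k i)
    ⟨Function.LeftInverse.injective (ofChart_toChart k i), toChart_surjective k i⟩

instance (i : Fin 2) : IsDomain (Chart k i) := (chartEquiv k i).symm.toMulEquiv.isDomain _

instance (i : Fin 2) : IsPrincipalIdealRing (Chart k i) :=
  IsPrincipalIdealRing.of_surjective (toChart k i) (toChart_surjective k i)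

/-- The inclusion of a chart. -/
noncomputable def chartι (i : Fin 2) : Spec (.of (Chart k i)) ⟶ Proj (grading k) :=
  Proj.awayι (grading k) (X i) (X_mem_grading k i) one_pos

instance (i : Fin 2) : IsOpenImmersion (chartι k i) :=
  inferInstanceAs (IsOpenImmersion (Proj.awayι ..))

lemma exists_mem_range_chartι (x : Proj (grading k)) : ∃ i y, chartι k i y = x := by
  have h := Proj.iSup_basicOpen_eq_top' (grading k) (fun i : Fin 2 => (X i : MvPolynomial _ k))
    (fun i => ⟨1, X_mem_grading k i⟩) ?_
  · have hx : x ∈ ⨆ i, Proj.basicOpen (grading k) (X i : MvPolynomial (Fin 2) k) := h ▸ trivial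
    obtain ⟨i, hi⟩ := TopologicalSpace.Opens.mem_iSup.1 hx
    rw [← Proj.opensRange_awayι (grading k) _ (X_mem_grading k i) one_pos] at hi
    exact ⟨i, hi⟩
  · refine top_le_iff.1 fun p _ => ?_
    induction p using MvPolynomial.induction_on with
    | C c => exact Subalgebra.algebraMap_mem _ (algebraMap k (grading k 0) c)
    | add p q hp hq => exact add_mem (hp trivial) (hq trivial)
    | mul_X p i hp => exact mul_mem (hp trivial) (Algebra.subset_adjoin ⟨i, rfl⟩)

instance : IrreducibleSpace (Proj (grading k)) := by
  let η : ProjectiveSpectrum (grading k) :=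
    ⟨⊥, by simpa using Ideal.isPrime_bot, fun h => by
      have h0 : (X 0 : MvPolynomial (Fin 2) k) ∈ HomogeneousIdeal.irrelevant (grading k) := by
        rw [HomogeneousIdeal.mem_irrelevant_iff, GradedRing.proj_apply,
          DirectSum.decompose_of_mem_ne (grading k) (X_mem_grading k 0) one_ne_zero]
      have h1 : (X 0 : MvPolynomial (Fin 2) k) = 0 := h h0
      exact X_ne_zero _ h1⟩
  rw [irreducibleSpace_def]
  have hη : closure {η} = Set.univ := by
    refine Set.eq_univ_of_forall fun x => ?_
    rw [← ProjectiveSpectrum.le_iff_mem_closure]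
    exact (bot_le : (⊥ : HomogeneousIdeal (grading k)) ≤ x.asHomogeneousIdeal)
  have h : IsIrreducible (closure {η}) := isIrreducible_singleton.closure
  rw [hη] at h
  exact h

instance : IsReduced (Proj (grading k)) := by
  have : ∀ x : Proj (grading k), _root_.IsReduced ((Proj (grading k)).presheaf.stalk x) := by
    intro x
    obtain ⟨i, y, rfl⟩ := exists_mem_range_chartι k x
    have e := (asIso ((chartι k i).stalkMap y)).commRingCatIsoToRingEquiv
    exact isReduced_of_injective e e.injective
  exact isReduced_of_isReduced_stalk _

instance : IsIntegral (Proj (grading k)) := isIntegral_of_irreducibleSpace_of_isReduced _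

instance (x : Proj (grading k)) : ValuationRing ((Proj (grading k)).presheaf.stalk x) := by
  obtain ⟨i, y, rfl⟩ := exists_mem_range_chartι k x
  let e := (asIso ((chartι k i).stalkMap y)).commRingCatIsoToRingEquiv
  have : ValuationRing ((Spec (.of (Chart k i))).presheaf.stalk y) := valuationRing_stalk_Spec _ y
  exact e.symm.surjective.valuationRing e.symm.toRingHom

instance : IsScalarTower k (grading k 0) (MvPolynomial (Fin 2) k) :=
  ⟨fun a b c => smul_mul_assoc a (b : MvPolynomial (Fin 2) k) c⟩

instance : Algebra.FiniteType (grading k 0) (MvPolynomial (Fin 2) k) :=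
  Algebra.FiniteType.of_restrictScalars_finiteType k _ _

lemma bijective_algebraMap_grading_zero : Function.Bijective (algebraMap k (grading k 0)) := by
  refine ⟨fun a b h => C_injective (Fin 2) k congr(($h : MvPolynomial (Fin 2) k)),
    fun ⟨p, hp⟩ => ?_⟩
  have hp' := totalDegree_eq_zero_iff_eq_C.1 ((totalDegree_zero_iff_isHomogeneous _).2 hp)
  exact ⟨_, Subtype.ext hp'.symm⟩

instance : IsProper (projectiveLine k).hom := by
  have : IsIso (CommRingCat.ofHom (algebraMap k (grading k 0))) :=
    (RingEquiv.ofBijective _ (bijective_algebraMap_grading_zero k)).toCommRingCatIso.isIso_hom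
  exact inferInstanceAs (IsProper (Proj.toSpecZero (grading k) ≫
    Spec.map (CommRingCat.ofHom (algebraMap k (grading k 0)))))

lemma chartι_comp_hom (i : Fin 2) :
    chartι k i ≫ (projectiveLine k).hom = Spec.map (CommRingCat.ofHom (chartConst k i)) := by
  change Proj.awayι _ _ _ _ ≫ Proj.toSpecZero _ ≫ _ = _
  rw [Proj.awayι_toSpecZero_assoc, ← Spec.map_comp, ← CommRingCat.ofHom_comp]
  rfl

end ProjectiveLine

lemma RegularCurve.fromSpecStalk_comp_s {k : Type u} [Field k] (C : RegularCurve k) :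
    C.X.fromSpecStalk (genericPoint C.X) ≫ C.s =
      Spec.map (CommRingCat.ofHom (algebraMap k C.K)) := by
  have h : C.s = C.X.toSpecΓ ≫ Spec.map ((Scheme.ΓSpecIso (.of k)).inv ≫ C.s.appTop) := by
    rw [Spec.map_comp, ← Scheme.toSpecΓ_naturality_assoc, toSpecΓ_SpecMap_ΓSpecIso_inv,
      Category.comp_id]
  conv_lhs => rw [h, Scheme.fromSpecStalk_toSpecΓ_assoc, ← Spec.map_comp]
  rfl

open Polynomial in
/-- A complete regular curve with a rational function field is a projective line. -/
theorem RegularCurve.IsProjectiveCurve.isProjectiveLine {k : Type u} [Field k] {C : RegularCurve k}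
    (hC : C.IsProjectiveCurve) {u : C.K} (hu : Transcendental k u)
    (hK : ∀ w : C.K, ∃ p q : k[X], q ≠ 0 ∧ w * aeval u q = aeval u p) : C.IsProjectiveLine := by
  have hinj := transcendental_iff_injective.1 hu
  let v : ProjectiveLine.Chart k 0 →+* C.K :=
    (aeval u : k[X] →ₐ[k] C.K).toRingHom.comp (ProjectiveLine.chartEquiv k 0).symm.toRingHom
  have hv : ∀ p, v (ProjectiveLine.chartEquiv k 0 p) = aeval u p := fun p => by simp [v]
  let : Algebra (ProjectiveLine.Chart k 0) C.K := v.toAlgebra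
  have : FaithfulSMul (ProjectiveLine.Chart k 0) C.K :=
    (faithfulSMul_iff_algebraMap_injective _ _).2
      (hinj.comp (ProjectiveLine.chartEquiv k 0).symm.injective)
  have : IsFractionRing (ProjectiveLine.Chart k 0) C.K := by
    refine IsFractionRing.of_field _ _ fun w => ?_
    obtain ⟨p, q, hq, hpq⟩ := hK w
    refine ⟨ProjectiveLine.chartEquiv k 0 p, ProjectiveLine.chartEquiv k 0 q, ?_⟩
    change w = v _ / v _
    rw [hv, hv]
    exact eq_div_of_mul_eq ((map_ne_zero_iff _ hinj).2 hq) hpq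
  obtain ⟨e, he⟩ := exists_iso_functionField_of_isOpenImmersion (X := Proj (ProjectiveLine.grading k))
    (B := .of (ProjectiveLine.Chart k 0)) (ProjectiveLine.chartι k 0) C.K
  have : IsProper C.s := hC
  have : IsIntegral (projectiveLine k).left :=
    inferInstanceAs (IsIntegral (Proj (ProjectiveLine.grading k)))
  have : ∀ x : (projectiveLine k).left, ValuationRing ((projectiveLine k).left.presheaf.stalk x) :=
    inferInstanceAs (∀ x : Proj (ProjectiveLine.grading k),
      ValuationRing ((Proj (ProjectiveLine.grading k)).presheaf.stalk x))
  refine nonempty_iso_of_isProper C.s (projectiveLine k).hom e ?_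
  rw [← Category.assoc]
  refine (congrArg (· ≫ (projectiveLine k).hom) he).trans ((Category.assoc _ _ _).trans
    ((congrArg (_ ≫ ·) (ProjectiveLine.chartι_comp_hom k 0)).trans ?_))
  rw [C.fromSpecStalk_comp_s, ← Spec.map_comp, ← CommRingCat.ofHom_comp]
  congr 2
  ext c
  change v (ProjectiveLine.chartConst k 0 c) = _
  rw [← aeval_C u c, ← hv]
  congr 1
  change _ = ProjectiveLine.toChart k 0 _
  simp [ProjectiveLine.toChart]

theorem lemma2p1 {k : Type u} [Field k] (C : RegularCurve k) (hC : C.AlgClosedInK)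
    {M : Type} [AddCommGroup M] [Module.Free ℤ M] [Module.Finite ℤ M]
    (D : PolyhedralDivisor C M) (hD : D.IsProper)
    (d : LFIHD k D.algebra) (e : M) (hde : d.IsHomogeneousOfDegree e) (hd : d.IsHorizontal) :
    (∃ (ω : PointedCone ℚ (LatticeQ M)) (L : AddSubgroup M) (φ : M → C.Kˣ),
      ω.FG ∧ Submodule.span ℚ (ω : Set (LatticeQ M)) = ⊤ ∧ L.FiniteIndex ∧
      (∀ m ∈ L, latticeToQ m ∈ ω → ∀ m' ∈ L, latticeToQ m' ∈ ω → φ (m + m') = φ m * φ m') ∧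
      d.kernel.map D.algebra.val.toLinearMap =
        Submodule.span k {a | ∃ m ∈ L, latticeToQ m ∈ ω ∧
          a = AddMonoidAlgebra.single m (φ m : C.K)} ∧
      (C.IsAffineCurve → ∀ m ∈ L, latticeToQ m ∈ ω →
        ∀ y, (C.ord (φ m : C.K) y : ℚ) + D.eval (latticeToQ m) y = 0)) ∧
    (C.IsProjectiveCurve → C.IsProjectiveLine) ∧
    GeometricallyIntegral D.toSpec ∧
    (C.IsAffineCurve → C.IsAffineLine) := by
  have : IsDomain (AddMonoidAlgebra C.K M) := AddMonoidAlgebra.isDomain_of_free C.K M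
  have : IsDomain D.algebra := inferInstance
  have hA : ∀ m, (LFIHD.toHomogeneousExp hde).A m = D.piece m := fun _ => rfl
  obtain ⟨L, φ, u, r, h⟩ := HomogeneousExp.exists_isKernelData hC
    (fun f hf => exists_bivariate_eval_eq_zero C.trdeg_le_one hf)
    (LFIHD.IsHorizontal.toHomogeneousExp hde hd)
  obtain ⟨ω, hωfg, hω⟩ := h.exists_cone hA
  refine ⟨⟨ω, L, φ, hωfg, h.span_eq_top hA hω, h.finiteIndex hA,
    fun m hm _ m' hm' _ => h.map_add m hm m' hm', ?_, ?_⟩, ?_, ?_, ?_⟩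
  · rw [LFIHD.map_kernel_eq_span hde, h.span_isConst_eq hω]
  · intro hC' m hm hmω
    have : IsAffine C.X := hC'
    exact h.ord_add_eval_eq_zero hA hm ((hω m hm).1 hmω)
  · exact fun hC' => hC'.isProjectiveLine h.transcendental (h.exists_mul_aeval_eq hA)
  · exact D.geometricallyIntegral_toSpec fun K' _ _ =>
      isDomain_tensorProduct_of_transcendental h.transcendental (h.exists_mul_aeval_eq hA)
  · intro hC'
    have : IsAffine C.X := hC'
    exact h.isAffineLine hA
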